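/- **Theorem (Tomita theorem for CP maps).** Let $\mathcal X$ be a unital C$^*$-algebra, $\mathcal M$ a $\sigma$-finite von Neumann algebra on a Hilbert space $\mathcal H\neq\{0\}$, and $T\in\mathrm{CP}(\mathcal X,\mathcal M)$ a completely positive map. Let $(\pi_T,\mathcal K_T,V_T)$ be a minimal Stinespring representation of $T$: $T(X)=V_T^*\pi_T(X)V_T$ and $\mathcal K_T=\overline{\mathrm{span}}\,\pi_T(\mathcal X)V_T\mathcal H$. *Definitions.* A CP-measure space with barycenter $T$ is a measurable space $(S,\mathcal F)$ with a map $\mu:\mathcal F\to\mathrm{CP}(\mathcal X,\mathcal M)$ such that $\mu(S)=T$ and $\rho(\mu(\bigcup_i\Delta_i)X)=\sum_i\rho(\mu(\Delta_i)X)$ for all disjoint sequences $(\Delta_i)$ in $\mathcal F$, all normal functionals $\rho\in\mathcal M_*$ and all $X\in\mathcal X$; write $\mu(\Delta,X)=\mu(\Delta)X$ and $(\rho\circ\mu)(\Delta)=\rho(\mu(\Delta,1))$. It is orthogonal if for every $\Delta\in\mathcal F$ the only $T'\in\mathrm{CP}(\mathcal X,\mathcal M)$ for which both $\mu(\Delta)-T'$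 and $\mu(\Delta^c)-T'$ are completely positive is $T'=0$. For CP-measure spaces with barycenter $T$, $(S_1,\mathcal F_1,\mu_1)\prec(S_2,\mathcal F_2,\mu_2)$ (dominance) means that $\{\mu_1(\Delta_1):\Delta_1\in\mathcal F_1\}\subseteq\{\mu_2(\Delta_2):\Delta_2\in\mathcal F_2\}$ and that, for some normal faithful state $\rho$ on $\mathcal M$, there are an orthogonal projection $P$ on $L^2(S_2,\rho\circ\mu_2)$ and a unitary from $L^2(S_1,\rho\circ\mu_1)$ onto $PL^2(S_2,\rho\circ\mu_2)$ that carries the algebra of multiplication operators $L^\infty(S_1,\rho\circ\mu_1)$ onto $PL^\infty(S_2,\rho\circ\mu_2)P$; and $\approx$ means dominance in both directions. The $\mathcal M$-relative commutant $\pi_T(\mathcal X)^c$ is the $\sigma$-weak closure in $B(\mathcal K_T)$ of the linear span of all $R\in\pi_T(\mathcal X)'$ with $0\le R\le1$ for which $X\mapsto V_T^*R\pi_T(X)V_T$ belongs to $\mathrm{CP}(\mathcal X,\mathcal M)$. *Claim.* On orthogonal CP-measure spaces with barycenter $T$, $\prec$ is a preorder. Let $\mathcal O_T$ be the category whose objects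 are the $\approx$-classes of orthogonal CP-measure spaces with barycenter $T$, with exactly one arrow $[\mu_1]\to[\mu_2]$ if $\mu_1\prec\mu_2$ and none otherwise, and let $\mathrm{AbvN}(\pi_T(\mathcal X)^c)$ be the category of abelian von Neumann algebras $\mathfrak B$ on $\mathcal K_T$ (containing $1$) with $\mathfrak B\subseteq\pi_T(\mathcal X)^c$, whose arrows are the inclusions. There is an isomorphism of categories $\mathcal O_T\cong\mathrm{AbvN}(\pi_T(\mathcal X)^c)$ with the following property. Let $[(S,\mathcal F,\mu)]$ correspond to $\mathfrak B$, let $(S,\mathcal F,\mu)$ be any representative, and let $\nu$ be any finite positive measure on $(S,\mathcal F)$ that is equivalent (mutually absolutely continuous) to $\rho\circ\mu$ for some normal faithful state $\rho$ on $\mathcal M$. Then there is a $*$-isomorphism $\kappa_\mu$ of $L^\infty(\nu)$ onto $\mathfrak B$ such that $$V_T^*\kappa_\mu(f)\pi_T(X)V_T=\int f(s)\,d\mu(s,X),\qquad f\in L^\infty(\nu),\ X\in\mathcal X,$$ i.e. the left side lies in $\mathcal M$ and $\rho(V_T^*\kappa_\mu(f)\pi_T(X)V_T)=\int f\,d(\rho(\mu(\cdot,X)))$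 for all $\rho\in\mathcal M_*$; and $\kappa_\mu$ is the only linear map $L^\infty(\nu)\to\pi_T(\mathcal X)^c$ with this property. -/

import Mathlib

open MeasureTheory
open scoped ENNReal InnerProductSpace CStarAlgebra

universe u v w s

namespace CPTomita

noncomputable section

/-! ### Normal functionals, faithful normal states, σ-finiteness, the σ-weak topology -/

/-- A linear functional on a von Neumann algebra `M` on `H` is normal if it is `A ↦ Tr (σ A)` for a
trace class operator `σ = ∑ₙ |yₙ⟩⟨xₙ|`, that is, `A ↦ ∑ₙ ⟪xₙ, A yₙ⟫` with `∑ₙ ‖xₙ‖² < ∞` and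
`∑ₙ ‖yₙ‖² < ∞`. -/
def IsNormal {H : Type v} [NormedAddCommGroup H] [InnerProductSpace ℂ H] [CompleteSpace H]
    {M : VonNeumannAlgebra H} (ρ : M.toStarSubalgebra →ₗ[ℂ] ℂ) : Prop :=
  ∃ x y : ℕ → H, Summable (fun n => ‖x n‖ ^ 2) ∧ Summable (fun n => ‖y n‖ ^ 2) ∧
    ∀ A : M.toStarSubalgebra, HasSum (fun n => ⟪x n, (A : H →L[ℂ] H) (y n)⟫_ℂ) (ρ A)

/-- The predual of `M`: its normal linear functionals. -/
def NormalFunctional {H : Type v} [NormedAddCommGroup H] [InnerProductSpace ℂ H] [CompleteSpace H]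
    (M : VonNeumannAlgebra H) : Type v :=
  {ρ : M.toStarSubalgebra →ₗ[ℂ] ℂ // IsNormal ρ}

/-- Normal faithful states on `M`. -/
structure NormalFaithfulState {H : Type v} [NormedAddCommGroup H] [InnerProductSpace ℂ H]
    [CompleteSpace H] (M : VonNeumannAlgebra H) where
  toFunctional : NormalFunctional M
  nonneg : ∀ A : M.toStarSubalgebra, 0 ≤ (A : H →L[ℂ] H) →
    0 ≤ (toFunctional.1 A).re ∧ (toFunctional.1 A).im = 0
  map_one : toFunctional.1 1 = 1
  faithful : ∀ A : M.toStarSubalgebra, 0 ≤ (A : H →L[ℂ] H) → toFunctional.1 A = 0 → A = 0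

/-- `M` is σ-finite: every family of nonzero, pairwise orthogonal projections of `M` is countable. -/
def IsSigmaFinite {H : Type v} [NormedAddCommGroup H] [InnerProductSpace ℂ H] [CompleteSpace H]
    (M : VonNeumannAlgebra H) : Prop :=
  ∀ F : Set (H →L[ℂ] H), (∀ p ∈ F, IsStarProjection p ∧ p ∈ M ∧ p ≠ 0) →
    F.Pairwise (fun p q => p * q = 0) → F.Countable

/-- The σ-weak topology on `B(K)`: the coarsest one for which all functionals
`A ↦ ∑ₙ ⟪xₙ, A yₙ⟫` with `∑ₙ ‖xₙ‖² < ∞`, `∑ₙ ‖yₙ‖² < ∞` are continuous. -/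
@[reducible]
def sigmaWeakTopology (K : Type w) [NormedAddCommGroup K] [InnerProductSpace ℂ K] :
    TopologicalSpace (K →L[ℂ] K) :=
  TopologicalSpace.induced
    (fun (A : K →L[ℂ] K) (p : {p : (ℕ → K) × (ℕ → K) //
        Summable (fun n => ‖p.1 n‖ ^ 2) ∧ Summable (fun n => ‖p.2 n‖ ^ 2)}) =>
      ∑' n, ⟪p.1.1 n, A (p.1.2 n)⟫_ℂ)
    Pi.topologicalSpace

/-! ### Completely positive maps into a von Neumann algebra -/

section CP

variable (X : Type u) [CStarAlgebra X] [PartialOrder X] [StarOrderedRing X]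
variable {H : Type v} [NormedAddCommGroup H] [InnerProductSpace ℂ H] [CompleteSpace H]

/-- `CP(X, M)`: the completely positive maps from `X` to `B(H)` with values in `M`. -/
def CPMap (M : VonNeumannAlgebra H) : Type (max u v) :=
  {T : X →CP (H →L[ℂ] H) // ∀ x, T x ∈ M}

variable {X} {M : VonNeumannAlgebra H}

namespace CPMap

/-- The value `T x` as an element of `M`. -/
def app (T : CPMap X M) (x : X) : M.toStarSubalgebra := ⟨T.1 x, T.2 x⟩

/-- `T₁ ≤ T₂` means that `T₂ - T₁` is completely positive. -/
def LE (T₁ T₂ : CPMap X M) : Prop :=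
  ∃ D : CPMap X M, ∀ x, T₂.1 x - T₁.1 x = D.1 x

/-- `T₁ ⊥ T₂`: only the zero map lies below both. -/
def Orthogonal (T₁ T₂ : CPMap X M) : Prop :=
  ∀ T' : CPMap X M, LE T' T₁ → LE T' T₂ → ∀ x, T'.1 x = 0

end CPMap

/-! ### CP-measure spaces -/

/-- A `CP(X, M)`-valued measure on a measurable space. -/
structure CPMeasure (X : Type u) [CStarAlgebra X] [PartialOrder X] [StarOrderedRing X]
    (M : VonNeumannAlgebra H) (S : Type s) [MeasurableSpace S] where
  toFun : {Δ : Set S // MeasurableSet Δ} → CPMap X M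
  hasSum_iUnion : ∀ Δ : ℕ → {Δ : Set S // MeasurableSet Δ},
    Pairwise (fun i j => Disjoint (Δ i : Set S) (Δ j : Set S)) →
    ∀ (ρ : NormalFunctional M) (x : X),
      HasSum (fun i => ρ.1 ((toFun (Δ i)).app x))
        (ρ.1 ((toFun ⟨⋃ i, (Δ i : Set S), MeasurableSet.iUnion fun i => (Δ i).2⟩).app x))

namespace CPMeasure

variable {S : Type s} [MeasurableSpace S]

open Classical in
/-- The complex measure `Δ ↦ ρ (μ (Δ, x))`. -/
def complexMeasure (μ : CPMeasure X M S) (ρ : NormalFunctional M) (x : X) : ComplexMeasure S where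
  measureOf' Δ := if h : MeasurableSet Δ then ρ.1 ((μ.toFun ⟨Δ, h⟩).app x) else 0
  empty' := by
    have h := μ.hasSum_iUnion (fun _ => ⟨∅, MeasurableSet.empty⟩) (by intro i j _; simp) ρ x
    have h0 := tendsto_nhds_unique tendsto_const_nhds h.summable.tendsto_atTop_zero
    simpa using h0
  not_measurable' Δ h := by simp [h]
  m_iUnion' Δ hΔ hd := by
    have h := μ.hasSum_iUnion (fun i => ⟨Δ i, hΔ i⟩) (fun i j hij => hd hij) ρ x
    simpa [hΔ, MeasurableSet.iUnion hΔ] using h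

open Classical in
theorem re_complexMeasure_apply (μ : CPMeasure X M S) (ρ : NormalFunctional M) (x : X) {Δ : Set S}
    (hΔ : MeasurableSet Δ) :
    ComplexMeasure.re (μ.complexMeasure ρ x) Δ = (ρ.1 ((μ.toFun ⟨Δ, hΔ⟩).app x)).re := by
  change ((if h : MeasurableSet Δ then ρ.1 ((μ.toFun ⟨Δ, h⟩).app x) else 0 : ℂ)).re = _
  rw [dif_pos hΔ]

/-- `(ρ ∘ μ)(Δ) = ρ (μ (Δ, 1))`, as a finite positive measure, for a normal faithful state `ρ`. -/
def scalarMeasure (μ : CPMeasure X M S) (ρ : NormalFaithfulState M) : Measure S :=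
  (ComplexMeasure.re (μ.complexMeasure ρ.toFunctional 1)).toMeasureOfZeroLE Set.univ
    MeasurableSet.univ (by
      rw [VectorMeasure.le_restrict_univ_iff_le]
      intro Δ hΔ
      have h : (0 : H →L[ℂ] H) ≤ (μ.toFun ⟨Δ, hΔ⟩).1 1 :=
        map_nonneg (μ.toFun ⟨Δ, hΔ⟩).1 zero_le_one
      rw [re_complexMeasure_apply μ _ _ hΔ]
      exact (ρ.nonneg ((μ.toFun ⟨Δ, hΔ⟩).app 1) h).1)

theorem scalarMeasure_apply (μ : CPMeasure X M S) (ρ : NormalFaithfulState M) {Δ : Set S}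
    (hΔ : MeasurableSet Δ) :
    μ.scalarMeasure ρ Δ
      = ENNReal.ofReal (ρ.toFunctional.1 ((μ.toFun ⟨Δ, hΔ⟩).app 1)).re := by
  rw [scalarMeasure, SignedMeasure.toMeasureOfZeroLE_apply _ _ _ hΔ]
  rw [ENNReal.ofReal, ENNReal.coe_inj]
  apply NNReal.eq
  have h : (0 : H →L[ℂ] H) ≤ (μ.toFun ⟨Δ, hΔ⟩).1 1 :=
    map_nonneg (μ.toFun ⟨Δ, hΔ⟩).1 zero_le_one
  have h' := (ρ.nonneg ((μ.toFun ⟨Δ, hΔ⟩).app 1) h).1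
  rw [Real.coe_toNNReal _ h']
  simp only [Set.univ_inter, NNReal.coe_mk]
  exact re_complexMeasure_apply μ _ _ hΔ

end CPMeasure

/-- A CP-measure space with barycenter `T`. -/
structure CPSpace (T : CPMap X M) where
  S : Type s
  [measurableSpace : MeasurableSpace S]
  μ : CPMeasure X M S
  barycenter : μ.toFun ⟨Set.univ, MeasurableSet.univ⟩ = T

attribute [instance] CPSpace.measurableSpace

/-- The operator of multiplication by `f ∈ L^∞(m)` on `L²(m)`. -/
def mulOp {S : Type s} [MeasurableSpace S] (m : Measure S) (f : Lp ℂ ∞ m) :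
    Lp ℂ 2 m →L[ℂ] Lp ℂ 2 m :=
  (ContinuousLinearMap.mul ℂ ℂ).holderL m ∞ 2 2 f

/-- `(L^∞(m₁), L²(m₁)) ≅ (P L^∞(m₂) P, P L²(m₂))` for a projection `P` on `L²(m₂)`: a unitary `W`
of `L²(m₁)` onto `P L²(m₂)` carries the multiplication algebra of `m₁` onto the compression by `P`
of that of `m₂` (operators on `P L²(m₂)` are regarded as operators on `L²(m₂)` that vanish on the
orthogonal complement). -/
def SpatialIsoCompression {S₁ S₂ : Type s} [MeasurableSpace S₁] [MeasurableSpace S₂]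
    (m₁ : Measure S₁) (m₂ : Measure S₂) (P : Lp ℂ 2 m₂ →L[ℂ] Lp ℂ 2 m₂) : Prop :=
  ∃ W : Lp ℂ 2 m₁ →ₗᵢ[ℂ] Lp ℂ 2 m₂,
    Set.range W = Set.range P ∧
    Set.range (fun f : Lp ℂ ∞ m₁ => W.toContinuousLinearMap ∘L mulOp m₁ f ∘L
        ContinuousLinearMap.adjoint W.toContinuousLinearMap)
      = Set.range (fun g : Lp ℂ ∞ m₂ => P ∘L mulOp m₂ g ∘L P)

namespace CPSpace

variable {T : CPMap X M}

/-- `E₁ ≺ E₂`. -/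
def Dominated (E₁ E₂ : CPSpace.{u, v, s} T) : Prop :=
  Set.range E₁.μ.toFun ⊆ Set.range E₂.μ.toFun ∧
  ∃ ρ : NormalFaithfulState M,
    ∃ P : Lp ℂ 2 (E₂.μ.scalarMeasure ρ) →L[ℂ] Lp ℂ 2 (E₂.μ.scalarMeasure ρ),
      IsStarProjection P ∧
      SpatialIsoCompression (E₁.μ.scalarMeasure ρ) (E₂.μ.scalarMeasure ρ) P

/-- `μ(Δ) ⊥ μ(Δᶜ)` for every measurable `Δ`. -/
def IsOrthogonal (E : CPSpace.{u, v, s} T) : Prop :=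
  ∀ (Δ : Set E.S) (hΔ : MeasurableSet Δ),
    CPMap.Orthogonal (E.μ.toFun ⟨Δ, hΔ⟩) (E.μ.toFun ⟨Δᶜ, hΔ.compl⟩)

end CPSpace

/-- Orthogonal CP-measure spaces with barycenter `T`. -/
def OrthSpace (T : CPMap X M) : Type (max u v (s + 1)) :=
  {E : CPSpace.{u, v, s} T // E.IsOrthogonal}

/-- The dominance relation on orthogonal CP-measure spaces. -/
def OrthSpace.Dom {T : CPMap X M} (E₁ E₂ : OrthSpace.{u, v, s} T) : Prop :=
  CPSpace.Dominated E₁.1 E₂.1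

/-! ### The category `O_T` -/

variable {T : CPMap X M}

/-- The preorder given by dominance, once dominance is known to be one. -/
@[reducible]
def dominancePreorder (h : IsPreorder (OrthSpace.{u, v, s} T) OrthSpace.Dom) :
    Preorder (OrthSpace.{u, v, s} T) where
  le := OrthSpace.Dom
  le_refl := h.refl
  le_trans := h.trans

/-- Objects of `O_T`: classes of orthogonal CP-measure spaces modulo mutual dominance. -/
def OT (h : IsPreorder (OrthSpace.{u, v, s} T) OrthSpace.Dom) : Type (max u v (s + 1)) :=
  @Antisymmetrization (OrthSpace.{u, v, s} T) OrthSpace.Dom h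

/-- The equivalence class of an orthogonal CP-measure space. -/
def OT.mk (h : IsPreorder (OrthSpace.{u, v, s} T) OrthSpace.Dom) (E : OrthSpace.{u, v, s} T) :
    OT h :=
  @toAntisymmetrization (OrthSpace.{u, v, s} T) OrthSpace.Dom h E

/-- `[E₁] ≤ [E₂]` iff `E₁ ≺ E₂`. As for every preorder, this makes `O_T` a category with exactly one
arrow `[E₁] ⟶ [E₂]` if `E₁ ≺ E₂` and none otherwise. -/
instance (h : IsPreorder (OrthSpace.{u, v, s} T) OrthSpace.Dom) : PartialOrder (OT h) :=
  @instPartialOrderAntisymmetrization (OrthSpace.{u, v, s} T) (dominancePreorder h)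

theorem OT.mk_le_mk (h : IsPreorder (OrthSpace.{u, v, s} T) OrthSpace.Dom)
    (E₁ E₂ : OrthSpace.{u, v, s} T) : OT.mk h E₁ ≤ OT.mk h E₂ ↔ CPSpace.Dominated E₁.1 E₂.1 :=
  Iff.rfl

/-! ### Minimal Stinespring representations and the relative commutant -/

/-- A minimal Stinespring representation `(π, K, V)` of `T`. -/
structure MinimalStinespring (T : CPMap X M) (K : Type w) [NormedAddCommGroup K]
    [InnerProductSpace ℂ K] [CompleteSpace K] where
  π : X →⋆ₐ[ℂ] (K →L[ℂ] K)
  V : H →L[ℂ] K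
  eq_compression : ∀ x, T.1 x = ContinuousLinearMap.adjoint V ∘L π x ∘L V
  minimal : (Submodule.span ℂ {k : K | ∃ (x : X) (ξ : H), k = π x (V ξ)}).topologicalClosure = ⊤

variable {K : Type w} [NormedAddCommGroup K] [InnerProductSpace ℂ K] [CompleteSpace K]

/-- The `M`-relative commutant `π_T(X)^c`: the σ-weak closure of the linear span of those
`0 ≤ R ≤ 1` in `π_T(X)'` for which `x ↦ V_T^* R π_T(x) V_T` belongs to `CP(X, M)`. -/
def MinimalStinespring.relativeCommutant (σ : MinimalStinespring T K) : Set (K →L[ℂ] K) :=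
  @closure (K →L[ℂ] K) (sigmaWeakTopology K)
    (Submodule.span ℂ {R : K →L[ℂ] K | (∀ x, R * σ.π x = σ.π x * R) ∧ 0 ≤ R ∧ R ≤ 1 ∧
      ∃ T_R : CPMap X M, ∀ x,
        T_R.1 x = ContinuousLinearMap.adjoint σ.V ∘L (R * σ.π x) ∘L σ.V} : Set (K →L[ℂ] K))

/-- Abelian von Neumann subalgebras of `π_T(X)^c`, ordered by inclusion; the partial order makes
them a category whose arrows are the inclusions. -/
abbrev AbvN (σ : MinimalStinespring T K) : Type w :=
  {B : VonNeumannAlgebra K // (B : Set (K →L[ℂ] K)) ⊆ σ.relativeCommutant ∧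
    ∀ a ∈ B, ∀ b ∈ B, a * b = b * a}

/-! ### The map `κ_μ` -/

/-- `κ` is a *-isomorphism of `L^∞(ν)` onto `B`. -/
structure IsStarIsoOnto {S : Type s} [MeasurableSpace S] {ν : Measure S}
    (κ : Lp ℂ ∞ ν →ₗ[ℂ] (K →L[ℂ] K)) (B : VonNeumannAlgebra K) : Prop where
  injective : Function.Injective κ
  range_eq : Set.range κ = (B : Set (K →L[ℂ] K))
  map_mul : ∀ f g : Lp ℂ ∞ ν,
    κ ((ContinuousLinearMap.mul ℂ ℂ).holder (p := ∞) (q := ∞) ∞ f g) = κ f * κ g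
  map_star : ∀ f : Lp ℂ ∞ ν, κ (star f) = star (κ f)

/-- `V_T^* κ(f) π_T(x) V_T = ∫ f dμ(·, x)` for all `f` and `x`: the left side lies in `M`, and
`ρ (V_T^* κ(f) π_T(x) V_T) = ∫ f d(ρ (μ (·, x)))` for all normal functionals `ρ` on `M`. -/
def IsIntegralMap (σ : MinimalStinespring T K) {S : Type s} [MeasurableSpace S]
    (μ : CPMeasure X M S) {ν : Measure S} (κ : Lp ℂ ∞ ν →ₗ[ℂ] (K →L[ℂ] K)) : Prop :=
  ∀ (f : Lp ℂ ∞ ν) (x : X), ∃ A : M.toStarSubalgebra,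
    (A : H →L[ℂ] H) = ContinuousLinearMap.adjoint σ.V ∘L (κ f * σ.π x) ∘L σ.V ∧
    ∀ ρ : NormalFunctional M,
      ρ.1 A = (μ.complexMeasure ρ x).integral (fun t => f t) (ContinuousLinearMap.mul ℝ ℂ)

end CP

end

end CPTomita

open CPTomita

/-! Maps below `T` are operators. By the Radon–Nikodym theorem (`MinimalStinespring.exists_density`)
every CP map `S ≤ T` has the form `S x = V* R π(x) V` with a unique `0 ≤ R ≤ 1` in `π(X)'`, its
density, and the order of maps is the order of densities. The σ-weak closure in the definition of
the relative commutant adds nothing: by `mem_relativeCommutant_iff` it consists of all `R` in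
`π(X)'` with `V* R π(x) V ∈ M` for every `x`. It is also closed under products, because
`exists_relativeCommutant_eq_centralizer` exhibits it as the commutant of `π(X)` together with the
lifts to `K` of the unitaries of `M'`.

Hence, if `R` is the density of `μ(Δ)`, then `R (1 - R)` is the density of an `M`-valued CP map
below both `μ(Δ)` and `μ(Δᶜ)`, and the two are orthogonal exactly when `R` is a projection.
Orthogonal CP-measure spaces with barycenter `T` are thus the projection-valued measures in the
relative commutant (`OrthSpace.exists_pvm`, `exists_orthSpace_of_pvm`), and the von Neumann algebra
generated by the projections is the abelian algebra attached to the space.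

σ-finiteness supplies a faithful normal state, hence a sequence `xₙ` separating for `M`; the vectors
`V xₙ` separate the relative commutant. This countability makes the spectral integral `κ` map
`L^∞(ν)` onto the whole generated algebra (`PVM.Compat.exists_kappa_eq`). Conversely, every abelian
algebra in the relative commutant is generated by a projection-valued measure on its Gelfand
spectrum (`exists_pvm_of_abelian`).

What remains is that dominance is inclusion of algebras (`OrthSpace.dom_iff`). Dominance gives
inclusion by uniqueness of densities. Conversely, an inclusion read through the two maps `κ` is an
integral-preserving embedding of `L^∞` algebras; its `L²` extension `W` is an isometry, and
compression by `W` stays in the multiplication algebra because that algebra is maximal abelian.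
Since inclusion is a partial order, dominance is a preorder and the classes form the stated
category. Uniqueness of `κ` is again uniqueness of densities. -/

namespace CPTomita

open scoped ComplexOrder
open ContinuousLinearMap

/-! ### Positive operators and positive sesquilinear forms. -/

section Operators

variable {K : Type*} [NormedAddCommGroup K] [InnerProductSpace ℂ K]

theorem inner_self_ofReal (k : K) : ⟪k, k⟫_ℂ = ((‖k‖ ^ 2 : ℝ) : ℂ) := by
  rw [inner_self_eq_norm_sq_to_K]
  norm_cast

/-- The order of `ℂ` includes vanishing of the imaginary part, and over `ℂ` a real quadratic form
already forces self-adjointness. -/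
theorem clm_nonneg_iff {A : K →L[ℂ] K} : 0 ≤ A ↔ ∀ k, 0 ≤ ⟪k, A k⟫_ℂ := by
  rw [nonneg_iff_isPositive, isPositive_iff_complex]
  refine forall_congr' fun k => ?_
  rw [← inner_conj_symm k (A k), Complex.nonneg_iff, Complex.ext_iff]
  simp only [inner_conj_symm, RCLike.re_to_complex, Complex.ofReal_re,
    Complex.ofReal_im, true_and]
  rw [← inner_conj_symm k (A k)]
  simp only [Complex.conj_re, Complex.conj_im, zero_eq_neg]
  constructor
  · rintro ⟨h1, h2⟩; exact ⟨h2, h1.symm⟩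
  · rintro ⟨h1, h2⟩; exact ⟨h2.symm, h1⟩

theorem clm_nonneg_of_dense {F : Type*} {e : F → K} (he : DenseRange e) {A : K →L[ℂ] K}
    (h : ∀ f, 0 ≤ ⟪e f, A (e f)⟫_ℂ) : 0 ≤ A := by
  rw [clm_nonneg_iff]
  intro k
  refine he.induction_on (p := fun k => 0 ≤ ⟪k, A k⟫_ℂ) k ?_ h
  exact isClosed_le continuous_const (by fun_prop)

theorem clm_eq_zero_of_dense {F G L : Type*} [NormedAddCommGroup L] [InnerProductSpace ℂ L]
    {e : F → K} (he : DenseRange e) {e' : G → L}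
    (he' : DenseRange e') {A : L →L[ℂ] K} (h : ∀ f g, ⟪e f, A (e' g)⟫_ℂ = 0) : A = 0 := by
  have h1 : ∀ g, A (e' g) = 0 := by
    intro g
    have : ∀ k, ⟪k, A (e' g)⟫_ℂ = 0 := fun k =>
      he.induction_on (p := fun k => ⟪k, A (e' g)⟫_ℂ = 0) k
        (isClosed_eq (by fun_prop) continuous_const) (fun f => h f g)
    exact inner_self_eq_zero.1 (this _)
  ext l
  exact he'.induction_on (p := fun l => A l = 0) l
    (isClosed_eq (by fun_prop) continuous_const) h1

/-- A positive sesquilinear form on a complex vector space is Hermitian. -/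
theorem conj_form_of_nonneg {F : Type*} [AddCommGroup F] [Module ℂ F]
    (B : F →ₗ⋆[ℂ] F →ₗ[ℂ] ℂ) (h0 : ∀ f, 0 ≤ B f f) (f g : F) :
    starRingEnd ℂ (B g f) = B f g := by
  have h1 := (Complex.nonneg_iff.1 (h0 (f + g))).2
  have h2 := (Complex.nonneg_iff.1 (h0 (f + Complex.I • g))).2
  have hf := (Complex.nonneg_iff.1 (h0 f)).2
  have hg := (Complex.nonneg_iff.1 (h0 g)).2
  simp at h1 h2
  apply Complex.ext <;> simp <;> linarith

/-- Cauchy–Schwarz for a possibly degenerate form, obtained by treating `B` as a pre-inner product.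
-/
theorem norm_form_le {F : Type*} [AddCommGroup F] [Module ℂ F]
    (B : F →ₗ⋆[ℂ] F →ₗ[ℂ] ℂ) (h0 : ∀ f, 0 ≤ B f f) (f g : F) :
    ‖B f g‖ ^ 2 ≤ (B f f).re * (B g g).re := by
  let c : PreInnerProductSpace.Core ℂ F :=
    { inner := fun x y => B x y
      conj_inner_symm := fun x y => conj_form_of_nonneg B h0 x y
      re_inner_nonneg := fun x => (Complex.nonneg_iff.1 (h0 x)).1
      add_left := fun x y z => by simp
      smul_left := fun x y r => by simp }
  have h := InnerProductSpace.Core.inner_mul_inner_self_le (c := c) f g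
  change ‖B f g‖ * ‖B g f‖ ≤ (B f f).re * (B g g).re at h
  have h' : ‖B g f‖ = ‖B f g‖ := by
    rw [← conj_form_of_nonneg B h0 f g, RCLike.norm_conj]
  rw [h'] at h
  nlinarith

/-- A positive form dominated by the inner product pulled back along a map with dense range is
represented by an operator `0 ≤ R ≤ 1`. -/
theorem exists_operator_of_form [CompleteSpace K] {F : Type*} [AddCommGroup F] [Module ℂ F]
    (e : F →ₗ[ℂ] K) (he : DenseRange e) (B : F →ₗ⋆[ℂ] F →ₗ[ℂ] ℂ) (h0 : ∀ f, 0 ≤ B f f)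
    (h1 : ∀ f, (B f f).re ≤ ‖e f‖ ^ 2) :
    ∃ R : K →L[ℂ] K, 0 ≤ R ∧ R ≤ 1 ∧ ∀ f g, ⟪e f, R (e g)⟫_ℂ = B f g := by
  have hb : ∀ f g, ‖B f g‖ ≤ ‖e f‖ * ‖e g‖ := by
    intro f g
    have hf := (Complex.nonneg_iff.1 (h0 f)).1
    have hg := (Complex.nonneg_iff.1 (h0 g)).1
    refine le_of_sq_le_sq ?_ (by positivity)
    calc ‖B f g‖ ^ 2 ≤ (B f f).re * (B g g).re := norm_form_le B h0 f g
      _ ≤ ‖e f‖ ^ 2 * ‖e g‖ ^ 2 := by gcongr <;> apply h1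
      _ = _ := by ring
  have hext : ∀ f g, (B f).extendOfNorm e (e g) = B f g := fun f g =>
    LinearMap.extendOfNorm_eq he ⟨‖e f‖, hb f⟩ g
  -- The form is extended by density one variable at a time: `Φ` is the extension in the second
  -- variable, and `Φ` itself is then extended in the first.
  let Φ : F →ₗ⋆[ℂ] (K →L[ℂ] ℂ) :=
    { toFun := fun f => (B f).extendOfNorm e
      map_add' := by
        intro f f'
        ext k
        refine he.induction_on k (isClosed_eq (by fun_prop) (by fun_prop)) fun g => ?_
        rw [hext, add_apply, hext, hext, map_add, LinearMap.add_apply]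
      map_smul' := by
        intro c f
        ext k
        refine he.induction_on k (isClosed_eq (by fun_prop) (by fun_prop)) fun g => ?_
        rw [hext, smul_apply, hext, map_smulₛₗ, LinearMap.smul_apply] }
  have hΦ : ∀ f, ‖Φ f‖ ≤ 1 * ‖e f‖ := fun f => by
    rw [one_mul]
    exact LinearMap.opNorm_extendOfNorm_le he (norm_nonneg _) (hb f)
  have hΨ : ∀ f g, Φ.extendOfNorm e (e f) (e g) = B f g := by
    intro f g
    rw [LinearMap.extendOfNorm_eq he ⟨1, hΦ⟩]
    exact hext f g
  -- The operator attached to a form acts in the first slot of the inner product; the adjoint moves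
  -- it to the second.
  let R := adjoint (InnerProductSpace.continuousLinearMapOfBilin (Φ.extendOfNorm e))
  have hR : ∀ f g, ⟪e f, R (e g)⟫_ℂ = B f g := by
    intro f g
    rw [adjoint_inner_right, InnerProductSpace.continuousLinearMapOfBilin_apply, hΨ]
  refine ⟨R, clm_nonneg_of_dense he fun f => by rw [hR]; exact h0 f, ?_, hR⟩
  rw [← sub_nonneg]
  refine clm_nonneg_of_dense he fun f => ?_
  rw [sub_apply, one_apply_eq_self, inner_sub_right, hR, inner_self_ofReal, Complex.nonneg_iff]
  have := (Complex.nonneg_iff.1 (h0 f)).2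
  have h2 := h1 f
  simp only [Complex.sub_re, Complex.sub_im, Complex.ofReal_re, Complex.ofReal_im]
  constructor <;> linarith

end Operators

/-! ### Negative parts in a C*-algebra. -/

section CStar

variable {A : Type*} [NonUnitalCStarAlgebra A] [PartialOrder A] [StarOrderedRing A]

theorem exists_eq_star_mul_self {a : A} (ha : 0 ≤ a) : ∃ b, a = star b * b :=
  CStarAlgebra.nonneg_iff_eq_star_mul_self.1 ha

/-- The negative part of a self-adjoint element, with the properties that are used here. -/
theorem exists_negPart {a : A} (ha : IsSelfAdjoint a) :
    ∃ c : A, star c = c ∧ 0 ≤ c * c * c ∧ star c * a * c = -(c * c * c) ∧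
      (c * c * c = 0 → 0 ≤ a) := by
  have hneg : (0 : A) ≤ a⁻ := CFC.negPart_nonneg a
  have hstar : star (a⁻) = a⁻ := (IsSelfAdjoint.of_nonneg hneg).star_eq
  refine ⟨a⁻, hstar, ?_, ?_, fun h => ?_⟩
  · have := star_left_conjugate_nonneg hneg (a⁻)
    rwa [hstar] at this
  · have h1 : a⁻ * a = - (a⁻ * a⁻) := by
      nth_rewrite 2 [← CFC.posPart_sub_negPart a ha]
      rw [mul_sub, CFC.negPart_mul_posPart, zero_sub]
    rw [hstar, h1, neg_mul]
  · have h4 : star (a⁻ * a⁻) * (a⁻ * a⁻) = 0 := by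
      rw [star_mul, hstar, ← mul_assoc, h, zero_mul]
    have h5 := CStarRing.star_mul_self_eq_zero_iff _ |>.1 h4
    have h6 : star (a⁻) * a⁻ = 0 := by rw [hstar, h5]
    have h7 := CStarRing.star_mul_self_eq_zero_iff _ |>.1 h6
    rw [← CFC.posPart_sub_negPart a ha, h7, sub_zero]
    exact CFC.posPart_nonneg a

end CStar

/-! ### Positivity of operator matrices through their quadratic forms. -/

section Matrices

variable {H : Type*} [NormedAddCommGroup H] [InnerProductSpace ℂ H] [CompleteSpace H]
variable {n : Type*} [Fintype n]

theorem matrix_form_star_mul_self (b : CStarMatrix n n (H →L[ℂ] H)) (ξ : n → H) :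
    ∑ i, ∑ j, ⟪ξ i, (star b * b) i j (ξ j)⟫_ℂ
      = ((∑ k, ‖∑ j, b k j (ξ j)‖ ^ 2 : ℝ) : ℂ) := by
  have h1 : ∀ i j, (star b * b) i j (ξ j) = ∑ k, star (b k i) (b k j (ξ j)) := by
    intro i j
    simp [CStarMatrix.mul_apply, CStarMatrix.star_apply]
  have h2 : ∀ k, ((‖∑ j, b k j (ξ j)‖ ^ 2 : ℝ) : ℂ)
      = ∑ i, ∑ j, ⟪b k i (ξ i), b k j (ξ j)⟫_ℂ := by
    intro k
    rw [← inner_self_ofReal, sum_inner]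
    simp_rw [inner_sum]
  rw [Complex.ofReal_sum]
  simp_rw [h2, h1, inner_sum, star_eq_adjoint, adjoint_inner_right]
  rw [Finset.sum_comm' (t' := Finset.univ) (s' := fun _ => Finset.univ) (by simp)]
  rw [Finset.sum_comm]
  conv_rhs => rw [Finset.sum_comm]
  refine Finset.sum_congr rfl fun i _ => ?_
  rw [Finset.sum_comm]

theorem matrix_form_nonneg {a : CStarMatrix n n (H →L[ℂ] H)} (ha : 0 ≤ a) (ξ : n → H) :
    0 ≤ ∑ i, ∑ j, ⟪ξ i, a i j (ξ j)⟫_ℂ := by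
  obtain ⟨b, rfl⟩ := exists_eq_star_mul_self ha
  rw [matrix_form_star_mul_self]
  exact_mod_cast by positivity

theorem matrix_form_conj (a c : CStarMatrix n n (H →L[ℂ] H)) (ξ : n → H) :
    ∑ i, ∑ j, ⟪ξ i, (star c * a * c) i j (ξ j)⟫_ℂ
      = ∑ i, ∑ j, ⟪∑ l, c i l (ξ l), a i j (∑ l, c j l (ξ l))⟫_ℂ := by
  have h1 : ∀ i j, (star c * a * c) i j (ξ j)
      = ∑ q, ∑ p, star (c p i) (a p q (c q j (ξ j))) := by
    intro i j
    simp [CStarMatrix.mul_apply, CStarMatrix.star_apply]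
  simp_rw [h1, inner_sum, sum_inner, map_sum, inner_sum, star_eq_adjoint, adjoint_inner_right]
  have e1 : ∀ i, ∑ j, ∑ q, ∑ p, ⟪c p i (ξ i), a p q (c q j (ξ j))⟫_ℂ
     = ∑ p, ∑ q, ∑ j, ⟪c p i (ξ i), a p q (c q j (ξ j))⟫_ℂ := by
    intro i
    rw [Finset.sum_comm]
    rw [Finset.sum_comm]
    conv_lhs => enter [2, j]; rw [Finset.sum_comm]
    rw [Finset.sum_comm]
    refine Finset.sum_congr rfl fun p _ => ?_
    rw [Finset.sum_comm]
  simp_rw [e1]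
  rw [Finset.sum_comm]
  refine Finset.sum_congr rfl fun p _ => ?_
  rw [Finset.sum_comm]

theorem matrix_ext_form [DecidableEq n] {b : CStarMatrix n n (H →L[ℂ] H)}
    (h : ∀ ξ : n → H, ∑ i, ∑ j, ⟪ξ i, (star b * b) i j (ξ j)⟫_ℂ = 0) : b = 0 := by
  apply CStarMatrix.ext
  intro k j
  ext ξ
  have h1 := h (Pi.single j ξ)
  rw [matrix_form_star_mul_self] at h1
  have h2 := (Finset.sum_eq_zero_iff_of_nonneg (fun _ _ => by positivity)).1
    (Complex.ofReal_eq_zero.1 h1) k (Finset.mem_univ _)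
  have h3 : ∑ l, b k l ((Pi.single j ξ : n → H) l) = b k j ξ := by
    rw [Finset.sum_eq_single j]
    · simp
    · intro l _ hl; simp [hl]
    · simp
  rw [h3] at h2
  simpa using h2

/-- The order of `CStarMatrix` is the abstract C*-order, so the form has to be tied to it. With `c`
the negative part of `a`, the form of `c* a c = -c³` is nonnegative by hypothesis and nonpositive
because `c³ ≥ 0`; so `c³` has zero form and vanishes. -/
theorem matrix_nonneg_of_form {a : CStarMatrix n n (H →L[ℂ] H)} (hsa : IsSelfAdjoint a)
    (h : ∀ ξ : n → H, 0 ≤ ∑ i, ∑ j, ⟪ξ i, a i j (ξ j)⟫_ℂ) : 0 ≤ a := by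
  classical
  obtain ⟨c, hc, hcube, hmul, hfin⟩ := exists_negPart hsa
  obtain ⟨b, hb⟩ := exists_eq_star_mul_self hcube
  have hb0 : b = 0 := by
    apply matrix_ext_form
    intro ξ
    rw [← hb]
    apply le_antisymm _ (matrix_form_nonneg hcube ξ)
    have h1 := h (fun i => ∑ l, c i l (ξ l))
    rw [← matrix_form_conj, hmul] at h1
    simpa using h1
  apply hfin
  rw [hb, hb0, mul_zero]

end Matrices

end CPTomita

namespace CPTomita

open scoped ComplexOrder
open ContinuousLinearMap

/-! ### The sesquilinear form of a completely positive map. -/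

section CPForm

variable {X : Type*} [CStarAlgebra X] [PartialOrder X] [StarOrderedRing X]
variable {H : Type*} [NormedAddCommGroup H] [InnerProductSpace ℂ H] [CompleteSpace H]
variable {K : Type*} [NormedAddCommGroup K] [InnerProductSpace ℂ K] [CompleteSpace K]

/-- The sesquilinear form `⟨δ_x ⊗ ξ, δ_y ⊗ η⟩ = ⟨ξ, S (x^* y) η⟩` on finitely supported functions. -/
noncomputable def cpForm (S : X →ₗ[ℂ] (H →L[ℂ] H)) : (X →₀ H) →ₗ⋆[ℂ] (X →₀ H) →ₗ[ℂ] ℂ :=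
  LinearMap.mk₂'ₛₗ (starRingEnd ℂ) (RingHom.id ℂ)
    (fun f g => f.sum fun x ξ => g.sum fun y η => ⟪ξ, S (star x * y) η⟫_ℂ)
    (fun f f' g => by
      refine Finsupp.sum_add_index' (by simp) fun x ξ ξ' => ?_
      simp [Finsupp.sum_add])
    (fun c f g => by
      rw [Finsupp.sum_smul_index' (by simp), Finsupp.smul_sum]
      refine Finsupp.sum_congr fun x _ => ?_
      rw [Finsupp.smul_sum]
      simp [mul_comm])
    (fun f g g' => by
      rw [← Finsupp.sum_add]
      refine Finsupp.sum_congr fun x _ => ?_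
      exact Finsupp.sum_add_index' (by simp) (by simp))
    (fun c f g => by
      rw [Finsupp.smul_sum]
      refine Finsupp.sum_congr fun x _ => ?_
      rw [Finsupp.sum_smul_index' (by simp), Finsupp.smul_sum]
      simp)

theorem cpForm_apply (S : X →ₗ[ℂ] (H →L[ℂ] H)) (f g : X →₀ H) :
    cpForm S f g = f.sum fun x ξ => g.sum fun y η => ⟪ξ, S (star x * y) η⟫_ℂ := rfl

theorem cpForm_single (S : X →ₗ[ℂ] (H →L[ℂ] H)) (x y : X) (ξ η : H) :
    cpForm S (Finsupp.single x ξ) (Finsupp.single y η) = ⟪ξ, S (star x * y) η⟫_ℂ := by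
  simp [cpForm_apply]

/-- The Gram matrix is `b* b` for the row `(x j)`; to have a square matrix the row is placed in
position `k` and all other rows are zero. -/
theorem gramMatrix_nonneg {n : Type*} [Fintype n] (x : n → X) :
    (0 : CStarMatrix n n X) ≤ CStarMatrix.ofMatrix (fun i j => star (x i) * x j) := by
  classical
  rcases isEmpty_or_nonempty n with h | ⟨⟨k⟩⟩
  · exact le_of_eq (CStarMatrix.ext fun i => h.elim i)
  · let b : CStarMatrix n n X := CStarMatrix.ofMatrix (fun i j => if i = k then x j else 0)
    have : CStarMatrix.ofMatrix (fun i j => star (x i) * x j) = star b * b := by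
      apply CStarMatrix.ext
      intro i j
      rw [CStarMatrix.mul_apply]
      change star (x i) * x j
        = ∑ l, star (if l = k then x i else 0) * (if l = k then x j else 0)
      rw [Finset.sum_eq_single k]
      · simp
      · intro l _ hl; simp [hl]
      · simp
    rw [this]
    exact star_mul_self_nonneg b

/-- Complete positivity enters the Radon–Nikodym argument here: `S` is applied entrywise to the Gram
matrix of the support of `f`. -/
theorem cpForm_self_nonneg (S : X →CP (H →L[ℂ] H)) (f : X →₀ H) :
    0 ≤ cpForm S.toLinearMap f f := by
  have h := matrix_form_nonneg
    (S.map_cstarMatrix_nonneg _ (gramMatrix_nonneg fun i : f.support => (i : X)))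
    (fun i => f i)
  have e : cpForm S.toLinearMap f f
      = ∑ i : f.support, ∑ j : f.support, ⟪f i, S (star (i : X) * (j : X)) (f j)⟫_ℂ := by
    rw [cpForm_apply, Finsupp.sum, ← Finset.sum_coe_sort]
    refine Finset.sum_congr rfl fun i _ => ?_
    rw [Finsupp.sum, ← Finset.sum_coe_sort]
    rfl
  rw [e]
  exact h

/-- Compression of a representation is completely positive. -/
noncomputable def conjCP (π : X →⋆ₐ[ℂ] (K →L[ℂ] K)) (C : H →L[ℂ] K) : X →CP (H →L[ℂ] H) where
  toFun x := adjoint C ∘L π x ∘L C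
  map_add' x y := by simp
  map_smul' c x := by simp
  map_cstarMatrix_nonneg' k a ha := by
    obtain ⟨b, rfl⟩ := exists_eq_star_mul_self ha
    have happ : ∀ i j, ((star b * b).map fun x => adjoint C ∘L π x ∘L C) i j
        = ∑ l, adjoint (π (b l i) ∘L C) ∘L (π (b l j) ∘L C) := by
      intro i j
      rw [CStarMatrix.map_apply, CStarMatrix.mul_apply, map_sum]
      ext ξ
      simp only [coe_comp, Function.comp_apply, sum_apply, map_sum]
      refine Finset.sum_congr rfl fun l _ => ?_
      rw [CStarMatrix.star_apply, map_mul, map_star, adjoint_comp, star_eq_adjoint]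
      rfl
    refine matrix_nonneg_of_form ?_ fun ξ => ?_
    · apply CStarMatrix.ext
      intro i j
      refine Eq.trans (CStarMatrix.star_apply) ?_
      refine (congrArg star (happ j i)).trans (Eq.trans ?_ (happ i j).symm)
      rw [star_sum]
      refine Finset.sum_congr rfl fun l _ => ?_
      rw [star_eq_adjoint, adjoint_comp, adjoint_adjoint]
    · have e : ∑ i, ∑ j, ⟪ξ i, ((star b * b).map fun x => adjoint C ∘L π x ∘L C) i j (ξ j)⟫_ℂ
          = ∑ l, ⟪∑ i, π (b l i) (C (ξ i)), ∑ j, π (b l j) (C (ξ j))⟫_ℂ := by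
        simp_rw [happ, sum_inner, inner_sum, sum_apply, inner_sum, comp_apply, adjoint_inner_right]
        conv_rhs => rw [Finset.sum_comm]
        refine Finset.sum_congr rfl fun i _ => ?_
        rw [Finset.sum_comm]
        rfl
      refine le_of_le_of_eq ?_ e.symm
      refine Finset.sum_nonneg fun l _ => ?_
      rw [inner_self_ofReal]
      exact_mod_cast by positivity

theorem conjCP_apply (π : X →⋆ₐ[ℂ] (K →L[ℂ] K)) (C : H →L[ℂ] K) (x : X) :
    conjCP π C x = adjoint C ∘L π x ∘L C := rfl

end CPForm

theorem mem_vonNeumann_iff {H : Type*} [NormedAddCommGroup H] [InnerProductSpace ℂ H]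
    [CompleteSpace H] {M : VonNeumannAlgebra H} {A : H →L[ℂ] H} :
    A ∈ M ↔ ∀ a ∈ M.commutant, a * A = A * a := by
  conv_lhs => rw [← M.commutant_commutant]
  exact VonNeumannAlgebra.mem_commutant_iff

/-! ### Matrix coefficients are σ-weakly continuous. -/

section SigmaWeak

variable {K : Type*} [NormedAddCommGroup K] [InnerProductSpace ℂ K]

theorem continuous_inner_sigmaWeak (k l : K) :
    @Continuous _ _ (sigmaWeakTopology K) _ (fun A : K →L[ℂ] K => ⟪k, A l⟫_ℂ) := by
  have hs : ∀ k : K, Summable (fun n => ‖(Pi.single 0 k : ℕ → K) n‖ ^ 2) := by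
    intro k
    refine summable_of_ne_finset_zero (s := {0}) fun n hn => ?_
    have : n ≠ 0 := by simpa using hn
    simp [this]
  let p : {p : (ℕ → K) × (ℕ → K) //
        Summable (fun n => ‖p.1 n‖ ^ 2) ∧ Summable (fun n => ‖p.2 n‖ ^ 2)} :=
    ⟨(Pi.single 0 k, Pi.single 0 l), hs k, hs l⟩
  have h : (fun A : K →L[ℂ] K => ⟪k, A l⟫_ℂ)
      = (fun F => F p) ∘ (fun (A : K →L[ℂ] K) (p : {p : (ℕ → K) × (ℕ → K) //
        Summable (fun n => ‖p.1 n‖ ^ 2) ∧ Summable (fun n => ‖p.2 n‖ ^ 2)}) =>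
          ∑' n, ⟪p.1.1 n, A (p.1.2 n)⟫_ℂ) := by
    funext A
    simp only [Function.comp, p]
    rw [tsum_eq_single 0]
    · simp
    · intro n hn; simp [hn]
  rw [h]
  exact @Continuous.comp _ _ _ (sigmaWeakTopology K) _ _ _ _ (continuous_apply p)
    continuous_induced_dom

end SigmaWeak

/-! ### Densities and the Radon–Nikodym theorem. -/

namespace MinimalStinespring

variable {X : Type u} [CStarAlgebra X] [PartialOrder X] [StarOrderedRing X]
variable {H : Type v} [NormedAddCommGroup H] [InnerProductSpace ℂ H] [CompleteSpace H]
variable {M : VonNeumannAlgebra H} {T : CPMap X M}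
variable {K : Type w} [NormedAddCommGroup K] [InnerProductSpace ℂ K] [CompleteSpace K]
variable (σ : MinimalStinespring T K)

/-- The map `∑ δ_x ⊗ ξ ↦ ∑ π(x) V ξ`. -/
noncomputable def assemble : (X →₀ H) →ₗ[ℂ] K :=
  Finsupp.lsum ℂ (fun x => ((σ.π x ∘L σ.V : H →L[ℂ] K) : H →ₗ[ℂ] K))

theorem assemble_apply (f : X →₀ H) : σ.assemble f = f.sum fun x ξ => σ.π x (σ.V ξ) := rfl

theorem assemble_single (x : X) (ξ : H) : σ.assemble (Finsupp.single x ξ) = σ.π x (σ.V ξ) := by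
  simp [assemble]

theorem denseRange_assemble : DenseRange σ.assemble := by
  have h : Submodule.span ℂ {k : K | ∃ (x : X) (ξ : H), k = σ.π x (σ.V ξ)}
      ≤ LinearMap.range σ.assemble := by
    rw [Submodule.span_le]
    rintro _ ⟨x, ξ, rfl⟩
    exact ⟨Finsupp.single x ξ, σ.assemble_single x ξ⟩
  have h1 := Submodule.topologicalClosure_mono h
  rw [σ.minimal, top_le_iff] at h1
  rw [DenseRange, ← LinearMap.coe_range]
  exact Submodule.dense_iff_topologicalClosure_eq_top.2 h1

theorem inner_generators (x y : X) (ξ η : H) (R : K →L[ℂ] K) :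
    ⟪σ.π x (σ.V ξ), R (σ.π y (σ.V η))⟫_ℂ
      = ⟪ξ, adjoint σ.V (σ.π (star x) (R (σ.π y (σ.V η))))⟫_ℂ := by
  rw [adjoint_inner_right, map_star, star_eq_adjoint, adjoint_inner_right]

theorem ext_generators {A B : K →L[ℂ] K}
    (h : ∀ x y ξ η, ⟪σ.π x (σ.V ξ), A (σ.π y (σ.V η))⟫_ℂ
      = ⟪σ.π x (σ.V ξ), B (σ.π y (σ.V η))⟫_ℂ) : A = B := by
  rw [← sub_eq_zero]
  refine clm_eq_zero_of_dense σ.denseRange_assemble σ.denseRange_assemble fun f g => ?_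
  simp only [assemble_apply, Finsupp.sum, sum_inner, map_sum, inner_sum, sub_apply, inner_sub_right,
    h, sub_self, Finset.sum_const_zero]

/-- `R` is a density of `S` with respect to `T`. -/
def IsDensity (S : X → H →L[ℂ] H) (R : K →L[ℂ] K) : Prop :=
  (∀ x, R * σ.π x = σ.π x * R) ∧ ∀ x, S x = adjoint σ.V ∘L (R * σ.π x) ∘L σ.V

variable {σ}

/-- Since `R` commutes with `π(x*)`, its matrix coefficients on the total set `π(x) V ξ` are
determined by `S`. Uniqueness of densities and all order comparisons rest on this. -/
theorem IsDensity.inner_eq {S : X → H →L[ℂ] H} {R : K →L[ℂ] K} (h : σ.IsDensity S R) (x y : X)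
    (ξ η : H) :
    ⟪σ.π x (σ.V ξ), R (σ.π y (σ.V η))⟫_ℂ = ⟪ξ, S (star x * y) η⟫_ℂ := by
  have h1 : R (σ.π (star x * y) (σ.V η)) = σ.π (star x) (R (σ.π y (σ.V η))) := by
    have := congrArg (fun A : K →L[ℂ] K => A (σ.π y (σ.V η))) (h.1 (star x))
    simp only [mul_def, comp_apply] at this
    rw [map_mul, mul_def, comp_apply, this]
  rw [inner_generators, h.2, ← h1]
  rfl

theorem IsDensity.unique {S : X → H →L[ℂ] H} {R R' : K →L[ℂ] K} (h : σ.IsDensity S R)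
    (h' : σ.IsDensity S R') : R = R' :=
  σ.ext_generators fun x y ξ η => by rw [h.inner_eq, h'.inner_eq]

theorem IsDensity.add {S S' : X → H →L[ℂ] H} {R R' : K →L[ℂ] K} (h : σ.IsDensity S R)
    (h' : σ.IsDensity S' R') : σ.IsDensity (fun x => S x + S' x) (R + R') :=
  ⟨fun x => by rw [add_mul, mul_add, h.1, h'.1], fun x => by
    change S x + S' x = _
    rw [h.2, h'.2, add_mul]; ext; simp⟩

theorem IsDensity.sub {S S' : X → H →L[ℂ] H} {R R' : K →L[ℂ] K} (h : σ.IsDensity S R)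
    (h' : σ.IsDensity S' R') : σ.IsDensity (fun x => S x - S' x) (R - R') :=
  ⟨fun x => by rw [sub_mul, mul_sub, h.1, h'.1], fun x => by
    change S x - S' x = _
    rw [h.2, h'.2, sub_mul]; ext; simp⟩

theorem IsDensity.smul {S : X → H →L[ℂ] H} {R : K →L[ℂ] K} (c : ℂ) (h : σ.IsDensity S R) :
    σ.IsDensity (fun x => c • S x) (c • R) :=
  ⟨fun x => by rw [smul_mul_assoc, mul_smul_comm, h.1], fun x => by
    change c • S x = _
    rw [h.2, smul_mul_assoc]; ext; simp⟩

theorem IsDensity.star {S : X → H →L[ℂ] H} {R : K →L[ℂ] K} (h : σ.IsDensity S R) :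
    σ.IsDensity (fun x => star (S (star x))) (star R) := by
  have hc : ∀ x, Star.star R * σ.π x = σ.π x * Star.star R := by
    intro x
    have := congrArg Star.star (h.1 (Star.star x))
    rw [star_mul, star_mul, map_star, star_star] at this
    exact this.symm
  refine ⟨hc, fun x => ?_⟩
  change Star.star (S (Star.star x)) = _
  rw [h.2, hc, map_star, star_eq_adjoint, star_eq_adjoint, star_eq_adjoint, mul_def, mul_def,
    adjoint_comp, adjoint_comp, adjoint_comp, adjoint_adjoint, adjoint_adjoint]
  rfl

theorem isDensity_one : σ.IsDensity (fun x => T.1 x) 1 :=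
  ⟨fun x => by rw [one_mul, mul_one], fun x => by
    rw [one_mul]; exact σ.eq_compression x⟩

theorem inner_assemble (f g : X →₀ H) :
    ⟪σ.assemble f, σ.assemble g⟫_ℂ = cpForm T.1.toLinearMap f g := by
  simp only [assemble_apply, Finsupp.sum, sum_inner, inner_sum, cpForm_apply]
  rw [Finset.sum_comm]
  refine Finset.sum_congr rfl fun x _ => Finset.sum_congr rfl fun y _ => ?_
  exact (isDensity_one (σ := σ)).inner_eq x y _ _

/-- The Radon–Nikodym theorem for completely positive maps. -/
theorem exists_density {S D : X →CP (H →L[ℂ] H)} (h : ∀ x, T.1 x - S x = D x) :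
    ∃ R : K →L[ℂ] K, 0 ≤ R ∧ R ≤ 1 ∧ σ.IsDensity S R := by
  have hsum : ∀ f, cpForm T.1.toLinearMap f f - cpForm S.toLinearMap f f
      = cpForm D.toLinearMap f f := by
    intro f
    simp only [cpForm_apply, Finsupp.sum, ← Finset.sum_sub_distrib, ← inner_sub_right]
    refine Finset.sum_congr rfl fun x _ => Finset.sum_congr rfl fun y _ => ?_
    change ⟪f x, (T.1 (star x * y)) (f y) - (S (star x * y)) (f y)⟫_ℂ = ⟪f x, D (star x * y) (f y)⟫_ℂ
    rw [← h]
    rfl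
  obtain ⟨R, hR0, hR1, hR⟩ := exists_operator_of_form σ.assemble σ.denseRange_assemble
    (cpForm S.toLinearMap) (cpForm_self_nonneg S) (fun f => by
      have h1 := (Complex.nonneg_iff.1 (cpForm_self_nonneg D f)).1
      rw [← hsum, ← inner_assemble (σ := σ), inner_self_ofReal] at h1
      rw [Complex.sub_re, Complex.ofReal_re] at h1
      linarith)
  have hgen : ∀ x y ξ η, ⟪σ.π x (σ.V ξ), R (σ.π y (σ.V η))⟫_ℂ = ⟪ξ, S (star x * y) η⟫_ℂ := by
    intro x y ξ η
    rw [← assemble_single, ← assemble_single, hR, cpForm_single]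
    rfl
  refine ⟨R, hR0, hR1, fun z => ?_, fun y => ?_⟩
  -- Both sides have matrix coefficient `⟪ξ, S (x* z y) η⟫`, since `z` can be attached to either
  -- generator.
  · refine σ.ext_generators fun x y ξ η => ?_
    have h1 : σ.π z (σ.π y (σ.V η)) = σ.π (z * y) (σ.V η) := by rw [map_mul]; rfl
    have h2 : adjoint (σ.π z) (σ.π x (σ.V ξ)) = σ.π (star z * x) (σ.V ξ) := by
      rw [map_mul, map_star]; rfl
    rw [mul_def, mul_def, comp_apply, comp_apply, h1, hgen, ← adjoint_inner_left (σ.π z), h2, hgen,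
      star_mul, star_star, mul_assoc]
  · ext1 η
    refine ext_inner_left ℂ fun ξ => ?_
    have := hgen 1 y ξ η
    rw [map_one, star_one, one_mul] at this
    rw [← this, comp_apply, adjoint_inner_right]
    rfl

/-- A positive operator in the commutant gives a completely positive map. -/
theorem exists_cp_of_nonneg {R : K →L[ℂ] K} (hR : 0 ≤ R) (hc : ∀ x, R * σ.π x = σ.π x * R) :
    ∃ S : X →CP (H →L[ℂ] H), σ.IsDensity S R := by
  -- The square root also commutes with `π`, so `R π(x) = √R π(x) √R` and the map is a compression
  -- of `π`.
  refine ⟨conjCP σ.π (CFC.sqrt R ∘L σ.V), hc, fun x => ?_⟩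
  have hs : Commute (CFC.sqrt R) (σ.π x) := Commute.cfcₙ_nnreal (hc x) _
  have hsa : adjoint (CFC.sqrt R) = CFC.sqrt R := (IsSelfAdjoint.of_nonneg (CFC.sqrt_nonneg R)).star_eq
  have hsq : R * σ.π x = CFC.sqrt R * σ.π x * CFC.sqrt R := by
    rw [mul_assoc, ← hs.eq, ← mul_assoc, CFC.sqrt_mul_sqrt_self R hR]
  rw [conjCP_apply, hsq, adjoint_comp, hsa]
  rfl

theorem exists_cpMap_of_nonneg {R : K →L[ℂ] K} (hR : 0 ≤ R) (hc : ∀ x, R * σ.π x = σ.π x * R)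
    (hM : ∀ x, adjoint σ.V ∘L (R * σ.π x) ∘L σ.V ∈ M) :
    ∃ S : CPMap X M, σ.IsDensity (fun x => S.1 x) R := by
  obtain ⟨S, hS⟩ := exists_cp_of_nonneg hR hc
  exact ⟨⟨S, fun x => by rw [hS.2]; exact hM x⟩, hS⟩

end MinimalStinespring

end CPTomita

namespace CPTomita

open scoped ComplexOrder
open ContinuousLinearMap

/-! ### The relative commutant is a commutant. -/

namespace MinimalStinespring

variable {X : Type u} [CStarAlgebra X] [PartialOrder X] [StarOrderedRing X]
variable {H : Type v} [NormedAddCommGroup H] [InnerProductSpace ℂ H] [CompleteSpace H]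
variable {M : VonNeumannAlgebra H} {T : CPMap X M}
variable {K : Type w} [NormedAddCommGroup K] [InnerProductSpace ℂ K] [CompleteSpace K]
variable {σ : MinimalStinespring T K}

/-- The densities of `M`-valued maps. -/
def IsRelative (σ : MinimalStinespring T K) (R : K →L[ℂ] K) : Prop :=
  (∀ x, R * σ.π x = σ.π x * R) ∧ ∀ x, adjoint σ.V ∘L (R * σ.π x) ∘L σ.V ∈ M

theorem IsRelative.isDensity {R : K →L[ℂ] K} (h : σ.IsRelative R) :
    σ.IsDensity (fun x => adjoint σ.V ∘L (R * σ.π x) ∘L σ.V) R := ⟨h.1, fun _ => rfl⟩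

theorem IsDensity.isRelative {S : X → H →L[ℂ] H} {R : K →L[ℂ] K} (h : σ.IsDensity S R)
    (hS : ∀ x, S x ∈ M) : σ.IsRelative R := ⟨h.1, fun x => by rw [← h.2]; exact hS x⟩

theorem isRelative_one : σ.IsRelative 1 := (isDensity_one (σ := σ)).isRelative T.2

theorem IsRelative.add {R R' : K →L[ℂ] K} (h : σ.IsRelative R) (h' : σ.IsRelative R') :
    σ.IsRelative (R + R') :=
  (h.isDensity.add h'.isDensity).isRelative fun x => add_mem (h.2 x) (h'.2 x)

theorem smul_mem_vonNeumann (c : ℂ) {A : H →L[ℂ] H} (hA : A ∈ M) : c • A ∈ M :=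
  M.toStarSubalgebra.smul_mem hA c

theorem IsRelative.smul {R : K →L[ℂ] K} (c : ℂ) (h : σ.IsRelative R) : σ.IsRelative (c • R) :=
  (h.isDensity.smul c).isRelative fun x => smul_mem_vonNeumann c (h.2 x)

theorem IsRelative.star {R : K →L[ℂ] K} (h : σ.IsRelative R) : σ.IsRelative (star R) :=
  h.isDensity.star.isRelative fun x => star_mem (h.2 (Star.star x))

/-- Commuting with `π(x)`, and membership of `V* R π(x) V` in `M = M''`, are both families of
equations between matrix coefficients of `R`. -/
theorem isClosed_isRelative :
    @IsClosed _ (sigmaWeakTopology K) {R : K →L[ℂ] K | σ.IsRelative R} := by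
  letI := sigmaWeakTopology K
  have e : {R : K →L[ℂ] K | σ.IsRelative R}
      = (⋂ x : X, ⋂ k : K, ⋂ l : K, {R | ⟪k, R (σ.π x l)⟫_ℂ = ⟪adjoint (σ.π x) k, R l⟫_ℂ}) ∩
        ⋂ x : X, ⋂ a : M.commutant, ⋂ ξ : H, ⋂ η : H,
          {R | ⟪σ.V (adjoint (a : H →L[ℂ] H) ξ), R (σ.π x (σ.V η))⟫_ℂ
            = ⟪σ.V ξ, R (σ.π x (σ.V ((a : H →L[ℂ] H) η)))⟫_ℂ} := by
    ext R
    simp only [Set.mem_setOf_eq, Set.mem_inter_iff, Set.mem_iInter, IsRelative]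
    refine and_congr (forall_congr' fun x => ⟨fun h k l => ?_, fun h => ?_⟩)
      (forall_congr' fun x => ?_)
    · rw [adjoint_inner_left]
      exact congrArg (fun A : K →L[ℂ] K => ⟪k, A l⟫_ℂ) h
    · ext l
      refine ext_inner_left ℂ fun k => ?_
      have := h k l
      rw [adjoint_inner_left] at this
      exact this
    · rw [mem_vonNeumann_iff]
      refine ⟨fun h a ξ η => ?_, fun h a ha => ?_⟩
      · have := congrArg (fun A : H →L[ℂ] H => ⟪ξ, A η⟫_ℂ) (h a a.2)
        simp only [mul_def, comp_apply] at this
        rwa [adjoint_inner_right, ← adjoint_inner_left, adjoint_inner_right] at this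
      · ext η
        refine ext_inner_left ℂ fun ξ => ?_
        have := h ⟨a, ha⟩ ξ η
        simp only [mul_def, comp_apply]
        rw [adjoint_inner_right, ← adjoint_inner_left, adjoint_inner_right]
        exact this
  rw [e]
  refine IsClosed.inter ?_ ?_
  · refine isClosed_iInter fun x => isClosed_iInter fun k => isClosed_iInter fun l => ?_
    exact isClosed_eq (continuous_inner_sigmaWeak _ _) (continuous_inner_sigmaWeak _ _)
  · refine isClosed_iInter fun x => isClosed_iInter fun a => isClosed_iInter fun ξ =>
      isClosed_iInter fun η => ?_
    exact isClosed_eq (continuous_inner_sigmaWeak _ _) (continuous_inner_sigmaWeak _ _)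

/-- The condition on the right is linear and σ-weakly closed, so it survives the closure.
Conversely, an operator satisfying it already lies in the span: its real and imaginary parts satisfy
it too, and a self-adjoint operator is a combination of `1` and a positive contraction. -/
theorem mem_relativeCommutant_iff {R : K →L[ℂ] K} :
    R ∈ σ.relativeCommutant ↔ σ.IsRelative R := by
  constructor
  · intro h
    refine (@closure_minimal _ (sigmaWeakTopology K) _ _ ?_ isClosed_isRelative) h
    intro R hR
    refine Submodule.span_induction ?_ ?_ (fun _ _ _ _ => IsRelative.add)
      (fun c _ _ => IsRelative.smul c) hR
    · rintro R ⟨hc, -, -, S, hS⟩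
      exact ⟨hc, fun x => by rw [← hS]; exact S.2 x⟩
    · simpa using (isRelative_one (σ := σ)).smul 0
  · intro h
    refine (@subset_closure _ (sigmaWeakTopology K) _) ?_
    set P := Submodule.span ℂ {R : K →L[ℂ] K | (∀ x, R * σ.π x = σ.π x * R) ∧ 0 ≤ R ∧ R ≤ 1 ∧
      ∃ T_R : CPMap X M, ∀ x, T_R.1 x = adjoint σ.V ∘L (R * σ.π x) ∘L σ.V} with hP
    have hmem : ∀ R : K →L[ℂ] K, 0 ≤ R → R ≤ 1 → σ.IsRelative R → R ∈ P := by
      intro R h0 h1 hR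
      obtain ⟨S, hS⟩ := exists_cpMap_of_nonneg h0 hR.1 hR.2
      exact Submodule.subset_span ⟨hR.1, h0, h1, S, hS.2⟩
    have hone : (1 : K →L[ℂ] K) ∈ P := hmem 1 zero_le_one le_rfl isRelative_one
    have hsa : ∀ A : K →L[ℂ] K, IsSelfAdjoint A → σ.IsRelative A → A ∈ P := by
      intro A hA hrel
      -- The summand `1` keeps `c` positive when `A = 0`; then `(A + c) / (2c)` lies between `0` and
      -- `1`.
      set c : ℝ := ‖A‖ + 1 with hc
      have hc0 : 0 < c := by positivity
      have hle : A ≤ algebraMap ℝ _ c := hA.le_algebraMap_norm_self.trans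
        (algebraMap_mono _ (by linarith))
      have hge : -algebraMap ℝ _ c ≤ A := le_trans
        (neg_le_neg (algebraMap_mono _ (by linarith))) hA.neg_algebraMap_norm_le_self
      let B : K →L[ℂ] K := (1 / (2 * c) : ℝ) • (A + algebraMap ℝ _ c)
      have hBrel : σ.IsRelative B := by
        have := (hrel.add (isRelative_one.smul (c : ℂ))).smul ((1 / (2 * c) : ℝ) : ℂ)
        convert this using 1
        ext k
        simp only [B, Algebra.algebraMap_eq_smul_one, smul_apply, add_apply, Complex.coe_smul]
      have hB : B ∈ P := by
        refine hmem B ?_ ?_ hBrel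
        · refine smul_nonneg (by positivity) ?_
          rwa [neg_le_iff_add_nonneg] at hge
        · have : (1 : K →L[ℂ] K) = (1 / (2 * c) : ℝ) • (algebraMap ℝ _ c + algebraMap ℝ _ c) := by
            ext k
            simp only [Algebra.algebraMap_eq_smul_one, ← add_smul, smul_smul]
            rw [show 1 / (2 * c) * (c + c) = 1 by field_simp; ring, one_smul]
          rw [this]
          exact smul_le_smul_of_nonneg_left (by gcongr) (by positivity)
      have : A = ((2 * c : ℝ) : ℂ) • B - (c : ℂ) • (1 : K →L[ℂ] K) := by
        ext k
        simp only [B, Algebra.algebraMap_eq_smul_one, sub_apply, smul_apply, add_apply,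
          one_apply_eq_self, Complex.coe_smul, smul_smul]
        rw [show 2 * c * (1 / (2 * c)) = 1 by field_simp, one_smul, add_sub_cancel_right]
      rw [this]
      exact sub_mem (P.smul_mem _ hB) (P.smul_mem _ hone)
    have hdec : R = (1 / 2 : ℂ) • (R + star R)
        + (-Complex.I / 2) • (Complex.I • (R - star R)) := by
      rw [smul_smul, show -Complex.I / 2 * Complex.I = 1 / 2 by
        rw [div_mul_eq_mul_div, neg_mul, Complex.I_mul_I, neg_neg], ← smul_add, add_add_sub_cancel,
        ← two_smul ℂ R, smul_smul]
      norm_num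
    change R ∈ P
    rw [hdec]
    refine add_mem (P.smul_mem _ (hsa _ ?_ (h.add h.star))) (P.smul_mem _ (hsa _ ?_ ?_))
    · exact IsSelfAdjoint.add_star_self R
    · rw [IsSelfAdjoint, star_smul, star_sub, star_star]
      simp only [RCLike.star_def, Complex.conj_I, neg_smul, smul_sub]
      abel
    · have := (h.add (h.star.smul (-1))).smul Complex.I
      simpa [sub_eq_add_neg] using this

/-- The map `π(x) V ξ ↦ π(x) V u ξ` is well defined and bounded for a unitary `u` of the commutant
of `M`. -/
theorem exists_lift (σ : MinimalStinespring T K) {u : H →L[ℂ] H} (hu : u ∈ M.commutant)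
    (huu : star u * u = 1) :
    ∃ J : K →L[ℂ] K, ∀ x ξ, J (σ.π x (σ.V ξ)) = σ.π x (σ.V (u ξ)) := by
  let g : (X →₀ H) →ₗ[ℂ] K :=
    Finsupp.lsum ℂ (fun x => ((σ.π x ∘L σ.V ∘L u : H →L[ℂ] K) : H →ₗ[ℂ] K))
  have hg : ∀ x ξ, g (Finsupp.single x ξ) = σ.π x (σ.V (u ξ)) := by
    intro x ξ; simp [g]
  -- `u` commutes with the values of `T`, so replacing each `ξ` by `u ξ` preserves the inner
  -- products of the generators. This gives both well-definedness and boundedness.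
  have hT : ∀ x ξ η, ⟪u ξ, T.1 x (u η)⟫_ℂ = ⟪ξ, T.1 x η⟫_ℂ := by
    intro x ξ η
    have h1 := (VonNeumannAlgebra.mem_commutant_iff.1 hu) _ (T.2 x)
    have h2 : T.1 x (u η) = u (T.1 x η) := congrArg (fun A : H →L[ℂ] H => A η) h1
    have h3 : adjoint u (u (T.1 x η)) = T.1 x η := congrArg (fun A : H →L[ℂ] H => A (T.1 x η)) huu
    rw [h2, ← adjoint_inner_right, h3]
  have hin : ∀ f, ⟪g f, g f⟫_ℂ = ⟪σ.assemble f, σ.assemble f⟫_ℂ := by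
    intro f
    have e : g f = f.sum fun x ξ => σ.π x (σ.V (u ξ)) := rfl
    rw [inner_assemble, e]
    simp only [Finsupp.sum, sum_inner, inner_sum, cpForm_apply]
    rw [Finset.sum_comm]
    refine Finset.sum_congr rfl fun x _ => Finset.sum_congr rfl fun y _ => ?_
    exact ((isDensity_one (σ := σ)).inner_eq x y _ _).trans (hT _ _ _)
  have hb : ∃ C, ∀ f, ‖g f‖ ≤ C * ‖σ.assemble f‖ := by
    refine ⟨1, fun f => ?_⟩
    have := hin f
    rw [inner_self_ofReal, inner_self_ofReal, Complex.ofReal_inj] at this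
    rw [one_mul]
    exact le_of_sq_le_sq this.le (norm_nonneg _)
  refine ⟨g.extendOfNorm σ.assemble, fun x ξ => ?_⟩
  rw [← assemble_single, LinearMap.extendOfNorm_eq σ.denseRange_assemble hb, hg]

theorem inner_lift {u : H →L[ℂ] H} (hu : u ∈ M.commutant) {J J' : K →L[ℂ] K}
    (hJ : ∀ x ξ, J (σ.π x (σ.V ξ)) = σ.π x (σ.V (u ξ)))
    (hJ' : ∀ x ξ, J' (σ.π x (σ.V ξ)) = σ.π x (σ.V (star u ξ))) : adjoint J = J' := by
  refine σ.ext_generators fun x y ξ η => ?_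
  rw [adjoint_inner_right, hJ, hJ']
  have h1 := (VonNeumannAlgebra.mem_commutant_iff.1 (star_mem hu)) _ (T.2 (star x * y))
  have h2 : T.1 (star x * y) (star u η) = star u (T.1 (star x * y) η) :=
    congrArg (fun A : H →L[ℂ] H => A η) h1
  have e := (isDensity_one (σ := σ)).inner_eq x y
  simp only [one_apply_eq_self] at e
  rw [e, e, h2, star_eq_adjoint, adjoint_inner_right]

/-- A C*-algebra is the linear span of its unitaries, so commuting with the unitaries of `M'` is
commuting with `M'`. Unitaries are the elements for which `exists_lift` is available. -/
theorem mem_vonNeumann_of_unitary {A : H →L[ℂ] H}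
    (h : ∀ u ∈ M.commutant, star u * u = 1 → u * star u = 1 → u * A = A * u) : A ∈ M := by
  rw [mem_vonNeumann_iff]
  intro a ha
  let C : StarSubalgebra ℂ (H →L[ℂ] H) := StarSubalgebra.centralizer ℂ (M : Set (H →L[ℂ] H))
  have hC : ∀ b, b ∈ C ↔ b ∈ M.commutant := fun b => Iff.rfl
  haveI : IsClosed (C : Set (H →L[ℂ] H)) := by
    have : (C : Set (H →L[ℂ] H)) = Set.centralizer (M : Set (H →L[ℂ] H)) :=
      M.coe_commutant
    rw [this]
    exact Set.isClosed_centralizer _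
  letI : CStarAlgebra C := inferInstance
  have hspan : (⟨a, ha⟩ : C) ∈ Submodule.span ℂ (unitary C : Set C) := by
    rw [CStarAlgebra.span_unitary]; trivial
  refine Submodule.span_induction (p := fun (b : C) _ => (b : H →L[ℂ] H) * A = A * b)
    ?_ ?_ ?_ ?_ hspan
  · intro b hb
    have hb' := Unitary.mem_iff.1 hb
    refine h b b.2 ?_ ?_
    · exact congrArg (Subtype.val) hb'.1
    · exact congrArg (Subtype.val) hb'.2
  · simp
  · intro b c _ _ hb hc
    change (b + c : H →L[ℂ] H) * A = A * (b + c : H →L[ℂ] H)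
    rw [add_mul, mul_add, hb, hc]
  · intro r b _ hb
    change (r • (b : H →L[ℂ] H)) * A = A * (r • (b : H →L[ℂ] H))
    rw [smul_mul_assoc, mul_smul_comm, hb]

/-- The relative commutant is a commutant; in particular it is a von Neumann algebra. -/
theorem exists_relativeCommutant_eq_centralizer (σ : MinimalStinespring T K) :
    ∃ G : Set (K →L[ℂ] K), σ.relativeCommutant = Set.centralizer G := by
  -- If `J` lifts `u`, then its adjoint lifts `u*`, and on generators the equation `J R = R J` says
  -- that `V* R π(x) V` commutes with `u`.
  refine ⟨Set.range σ.π ∪ {J | ∃ u ∈ M.commutant, star u * u = 1 ∧ u * star u = 1 ∧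
    ∀ x ξ, J (σ.π x (σ.V ξ)) = σ.π x (σ.V (u ξ))}, ?_⟩
  ext R
  rw [mem_relativeCommutant_iff, Set.mem_centralizer_iff]
  constructor
  · rintro hR _ (⟨x, rfl⟩ | ⟨u, hu, hu1, hu2, hJ⟩)
    · exact (hR.1 x).symm
    · rename_i J
      obtain ⟨J', hJ'⟩ := σ.exists_lift (star_mem hu) (by rw [star_star]; exact hu2)
      have hadj := inner_lift hu hJ hJ'
      refine σ.ext_generators fun x y ξ η => ?_
      have e := hR.isDensity.inner_eq
      have hM := hR.2 (star x * y)
      have h1 := (VonNeumannAlgebra.mem_commutant_iff.1 hu) _ hM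
      rw [mul_def, mul_def, comp_apply, comp_apply, ← adjoint_inner_left, hadj, hJ, hJ', e, e,
        star_eq_adjoint, adjoint_inner_left]
      exact congrArg (fun A : H →L[ℂ] H => ⟪ξ, A η⟫_ℂ) h1.symm
  · intro h
    have hc : ∀ x, R * σ.π x = σ.π x * R := fun x => (h _ (Or.inl ⟨x, rfl⟩)).symm
    refine ⟨hc, fun x => mem_vonNeumann_of_unitary fun u hu hu1 hu2 => ?_⟩
    obtain ⟨J, hJ⟩ := σ.exists_lift hu hu1
    obtain ⟨J', hJ'⟩ := σ.exists_lift (star_mem hu) (by rw [star_star]; exact hu2)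
    have hadj := inner_lift hu hJ hJ'
    have hcomm := h J (Or.inr ⟨u, hu, hu1, hu2, hJ⟩)
    ext η
    refine ext_inner_left ℂ fun ξ => ?_
    have e1 : σ.V (star u ξ) = J' (σ.V ξ) := by
      have := hJ' 1 ξ
      simpa using this.symm
    simp only [mul_def, comp_apply]
    rw [← adjoint_inner_left, adjoint_inner_right, adjoint_inner_right, ← star_eq_adjoint, e1,
      ← hadj, adjoint_inner_left, ← hJ]
    exact congrArg (fun A : K →L[ℂ] K => ⟪σ.V ξ, A (σ.π x (σ.V η))⟫_ℂ) hcomm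

/-- Immediate for a commutant, though `V* R R' π(x) V ∈ M` is not visible from the two factors. It
is what allows `R (1 - R)` to define an `M`-valued map. -/
theorem IsRelative.mul {R R' : K →L[ℂ] K} (h : σ.IsRelative R) (h' : σ.IsRelative R') :
    σ.IsRelative (R * R') := by
  obtain ⟨G, hG⟩ := σ.exists_relativeCommutant_eq_centralizer
  rw [← mem_relativeCommutant_iff, hG] at h h' ⊢
  exact Set.mul_mem_centralizer h h'

end MinimalStinespring

end CPTomita

namespace CPTomita

open scoped ComplexOrder
open ContinuousLinearMap

/-! ### Normal functionals and separating sequences. -/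

section Normal

variable {H : Type v} [NormedAddCommGroup H] [InnerProductSpace ℂ H] [CompleteSpace H]
variable {M : VonNeumannAlgebra H}

theorem summable_inner_of_sq {K : Type*} [NormedAddCommGroup K] [InnerProductSpace ℂ K]
    {x y : ℕ → K} (hx : Summable fun n => ‖x n‖ ^ 2) (hy : Summable fun n => ‖y n‖ ^ 2) :
    Summable fun n => ⟪x n, y n⟫_ℂ := by
  refine Summable.of_norm_bounded (hx.add hy) fun n => ?_
  have h1 := norm_inner_le_norm (𝕜 := ℂ) (x n) (y n)
  nlinarith [sq_nonneg (‖x n‖ - ‖y n‖), sq_nonneg (‖x n‖ + ‖y n‖)]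

theorem summable_sq_apply {K L : Type*} [NormedAddCommGroup K] [NormedSpace ℂ K]
    [NormedAddCommGroup L] [NormedSpace ℂ L] (A : K →L[ℂ] L)
    {x : ℕ → K} (hx : Summable fun n => ‖x n‖ ^ 2) : Summable fun n => ‖A (x n)‖ ^ 2 := by
  refine Summable.of_nonneg_of_le (fun n => by positivity) (fun n => ?_) (hx.mul_left (‖A‖ ^ 2))
  rw [← mul_pow]
  exact pow_le_pow_left₀ (norm_nonneg _) (A.le_opNorm _) 2

/-- The normal functional `A ↦ ∑ₙ ⟪xₙ, A yₙ⟫`. -/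
noncomputable def NormalFunctional.ofSeq (M : VonNeumannAlgebra H) (x y : ℕ → H)
    (hx : Summable fun n => ‖x n‖ ^ 2) (hy : Summable fun n => ‖y n‖ ^ 2) : NormalFunctional M :=
  have hs : ∀ A : H →L[ℂ] H, Summable fun n => ⟪x n, A (y n)⟫_ℂ := fun A =>
    summable_inner_of_sq hx (summable_sq_apply A hy)
  ⟨{ toFun := fun A => ∑' n, ⟪x n, (A : H →L[ℂ] H) (y n)⟫_ℂ
     map_add' := fun A B => by
       rw [← (hs A).tsum_add (hs B)]
       simp [inner_add_right]
     map_smul' := fun c A => by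
       rw [RingHom.id_apply, smul_eq_mul, ← tsum_mul_left]
       simp [inner_smul_right] }, x, y, hx, hy, fun A => (hs A).hasSum⟩

theorem NormalFunctional.ofSeq_hasSum (x y : ℕ → H)
    (hx : Summable fun n => ‖x n‖ ^ 2) (hy : Summable fun n => ‖y n‖ ^ 2)
    (A : M.toStarSubalgebra) :
    HasSum (fun n => ⟪x n, (A : H →L[ℂ] H) (y n)⟫_ℂ) ((ofSeq M x y hx hy).1 A) :=
  (summable_inner_of_sq hx (summable_sq_apply _ hy)).hasSum

theorem summable_sq_single (ξ : H) : Summable fun n => ‖(Pi.single 0 ξ : ℕ → H) n‖ ^ 2 := by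
  refine summable_of_ne_finset_zero (s := {0}) fun n hn => ?_
  have : n ≠ 0 := by simpa using hn
  simp [this]

/-- The vector functional `A ↦ ⟪ξ, A η⟫`. -/
noncomputable def NormalFunctional.vector (M : VonNeumannAlgebra H) (ξ η : H) :
    NormalFunctional M :=
  ofSeq M (Pi.single 0 ξ) (Pi.single 0 η) (summable_sq_single ξ) (summable_sq_single η)

theorem NormalFunctional.vector_apply (ξ η : H) (A : M.toStarSubalgebra) :
    (vector M ξ η).1 A = ⟪ξ, (A : H →L[ℂ] H) η⟫_ℂ := by
  have h := ofSeq_hasSum (Pi.single 0 ξ) (Pi.single 0 η) (summable_sq_single ξ)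
    (summable_sq_single η) A
  refine h.unique ?_
  convert hasSum_single (f := fun n => ⟪(Pi.single 0 ξ : ℕ → H) n,
    (A : H →L[ℂ] H) ((Pi.single 0 η : ℕ → H) n)⟫_ℂ) 0 ?_ using 1
  · simp
  · intro n hn; simp [hn]

theorem NormalFunctional.ext_of_forall {A B : M.toStarSubalgebra}
    (h : ∀ ρ : NormalFunctional M, ρ.1 A = ρ.1 B) : (A : H →L[ℂ] H) = B := by
  ext η
  refine ext_inner_left ℂ fun ξ => ?_
  have := h (vector M ξ η)
  rwa [vector_apply, vector_apply] at this

theorem inner_star_mul_self {K : Type*} [NormedAddCommGroup K] [InnerProductSpace ℂ K]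
    [CompleteSpace K] (A : K →L[ℂ] K) (k l : K) : ⟪k, (star A * A) l⟫_ℂ = ⟪A k, A l⟫_ℂ := by
  rw [mul_def, comp_apply, star_eq_adjoint, adjoint_inner_right]

/-- A normal faithful state gives a countable separating family. -/
theorem NormalFaithfulState.exists_separating (ρ : NormalFaithfulState M) :
    ∃ x : ℕ → H, (Summable fun n => ‖x n‖ ^ 2) ∧
      ∀ A ∈ M, (∀ n, ⟪x n, (A : H →L[ℂ] H) (x n)⟫_ℂ = 0) → 0 ≤ A → A = 0 := by
  obtain ⟨x, y, hx, hy, hs⟩ := ρ.toFunctional.2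
  refine ⟨x, hx, fun A hA h0 hpos => ?_⟩
  obtain ⟨b, hb⟩ := exists_eq_star_mul_self hpos
  have hbx : ∀ n, b (x n) = 0 := by
    intro n
    have := h0 n
    rw [hb, inner_star_mul_self] at this
    exact inner_self_eq_zero.1 this
  -- The left vectors suffice: with `A = b* b` and `b xₙ = 0`, each term `⟪xₙ, A yₙ⟫ = ⟪b xₙ, b yₙ⟫`
  -- vanishes.
  have hz : ρ.toFunctional.1 ⟨A, hA⟩ = 0 := by
    refine (hs ⟨A, hA⟩).unique ?_
    convert hasSum_zero (α := ℂ) (β := ℕ) using 2 with n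
    change ⟪x n, A (y n)⟫_ℂ = 0
    rw [hb, inner_star_mul_self, hbx, inner_zero_left]
  exact congrArg Subtype.val (ρ.faithful ⟨A, hA⟩ hpos hz)

end Normal

/-! ### Faithful normal states from σ-finiteness. -/

section FaithfulState

variable {H : Type v} [NormedAddCommGroup H] [InnerProductSpace ℂ H] [CompleteSpace H]
variable (M : VonNeumannAlgebra H)

/-- The closed subspace generated by `M' ξ`. -/
noncomputable def cyclicSpace (ξ : H) : Submodule ℂ H :=
  (Submodule.map (LinearMap.applyₗ ξ ∘ₗ ContinuousLinearMap.coeLM ℂ)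
    (M.commutant.toStarSubalgebra.toSubalgebra.toSubmodule)).topologicalClosure

variable {M}

theorem mem_cyclicSpace {a : H →L[ℂ] H} (ha : a ∈ M.commutant) (ξ : H) :
    a ξ ∈ cyclicSpace M ξ :=
  Submodule.le_topologicalClosure _ ⟨a, ha, rfl⟩

theorem cyclicSpace_induction {ξ : H} {p : H → Prop} (hp : IsClosed {k | p k})
    (h : ∀ a ∈ M.commutant, p (a ξ)) {k : H} (hk : k ∈ cyclicSpace M ξ) : p k := by
  refine closure_minimal ?_ hp hk
  rintro _ ⟨a, ha, rfl⟩
  exact h a ha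

instance (ξ : H) : CompleteSpace (cyclicSpace M ξ) :=
  (Submodule.isClosed_topologicalClosure _).completeSpace_coe

theorem cyclicProjection_mem (ξ : H) : (cyclicSpace M ξ).starProjection ∈ M := by
  rw [VonNeumannAlgebra.IsStarProjection.mem_iff
    (isStarProjection_starProjection (U := cyclicSpace M ξ))]
  intro y hy
  rw [Submodule.range_starProjection]
  intro k hk
  refine cyclicSpace_induction (p := fun k => y k ∈ cyclicSpace M ξ) ?_ (fun a ha => ?_) hk
  · exact (Submodule.isClosed_topologicalClosure _).preimage y.continuous
  · exact mem_cyclicSpace (mul_mem hy ha) ξ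

theorem inner_cyclicSpace_eq_zero {ξ η : H} (h : ∀ a ∈ M.commutant, ⟪ξ, a η⟫_ℂ = 0)
    {k l : H} (hk : k ∈ cyclicSpace M ξ) (hl : l ∈ cyclicSpace M η) : ⟪k, l⟫_ℂ = 0 := by
  refine cyclicSpace_induction (p := fun k => ⟪k, l⟫_ℂ = 0)
    (isClosed_eq (by fun_prop) continuous_const) (fun a ha => ?_) hk
  refine cyclicSpace_induction (p := fun l => ⟪a ξ, l⟫_ℂ = 0)
    (isClosed_eq (by fun_prop) continuous_const) (fun b hb => ?_) hl
  rw [← adjoint_inner_right]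
  exact h _ (mul_mem (star_mem ha) hb)

/-- A σ-finite von Neumann algebra has a countable separating family of vectors. -/
theorem IsSigmaFinite.exists_separating [Nontrivial H] (hM : IsSigmaFinite M) :
    ∃ f : ℕ → H, (∀ n, f n ≠ 0) ∧ ∀ A ∈ M, (∀ n, A (f n) = 0) → A = 0 := by
  -- A maximal family of nonzero vectors with mutually orthogonal spaces `M' ξ`. The projections
  -- onto the closures are orthogonal and lie in `M`, so σ-finiteness makes the family countable,
  -- and by maximality only `0` is orthogonal to all of them.
  let 𝒞 : Set (Set H) := {F | (∀ ξ ∈ F, ξ ≠ 0) ∧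
    F.Pairwise fun ξ η => ∀ a ∈ M.commutant, ⟪ξ, a η⟫_ℂ = 0}
  obtain ⟨F, hF⟩ : ∃ F, Maximal (· ∈ 𝒞) F := by
    refine zorn_subset 𝒞 fun c hc hchain => ⟨⋃₀ c, ⟨?_, ?_⟩, fun s hs => Set.subset_sUnion_of_mem hs⟩
    · rintro ξ ⟨s, hs, hξ⟩
      exact (hc hs).1 ξ hξ
    · exact (Set.pairwise_sUnion hchain.directedOn).2 fun s hs => (hc hs).2
  have hmax : ∀ ζ : H, (∀ ξ ∈ F, ∀ a ∈ M.commutant, ⟪ζ, a ξ⟫_ℂ = 0) → ζ = 0 := by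
    intro ζ hζ
    by_contra hne
    have hins : insert ζ F ∈ 𝒞 := by
      refine ⟨?_, ?_⟩
      · rintro ξ (rfl | hξ)
        · exact hne
        · exact hF.prop.1 ξ hξ
      · refine (Set.pairwise_insert).2 ⟨hF.prop.2, fun ξ hξ _ => ⟨hζ ξ hξ, fun a ha => ?_⟩⟩
        rw [← adjoint_inner_left, ← inner_conj_symm, ← star_eq_adjoint,
          hζ ξ hξ (star a) (star_mem ha), map_zero]
    have hmem : ζ ∈ F := hF.le_of_ge hins (Set.subset_insert _ _) (Set.mem_insert _ _)
    have := hζ ζ hmem 1 (one_mem _)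
    exact hne (inner_self_eq_zero.1 this)
  have hself : ∀ ξ : H, ξ ∈ cyclicSpace M ξ := fun ξ => by
    simpa using mem_cyclicSpace (M := M) (one_mem M.commutant) ξ
  have hproj : ∀ ξ : H, (cyclicSpace M ξ).starProjection ξ = ξ := fun ξ =>
    Submodule.starProjection_eq_self_iff.2 (hself ξ)
  have hinj : Set.InjOn (fun ξ => (cyclicSpace M ξ).starProjection) F := by
    intro ξ hξ η hη he
    by_contra hne
    have h1 : ξ ∈ cyclicSpace M η := by
      have he' : (cyclicSpace M ξ).starProjection = (cyclicSpace M η).starProjection := he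
      rw [← Submodule.starProjection_eq_self_iff, ← he', hproj]
    exact hF.prop.1 ξ hξ (inner_self_eq_zero.1
      (inner_cyclicSpace_eq_zero (hF.prop.2 hξ hη hne) (hself ξ) h1))
  have hcount : F.Countable := by
    refine Set.countable_of_injective_of_countable_image hinj (hM _ ?_ ?_)
    · rintro _ ⟨ξ, hξ, rfl⟩
      refine ⟨isStarProjection_starProjection, cyclicProjection_mem ξ, fun h0 => ?_⟩
      apply hF.prop.1 ξ hξ
      have h0' : (cyclicSpace M ξ).starProjection = 0 := h0
      rw [← hproj ξ, h0', zero_apply]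
    · rintro _ ⟨ξ, hξ, rfl⟩ _ ⟨η, hη, rfl⟩ hne
      have hne' : ξ ≠ η := fun h => hne (by rw [h])
      change (cyclicSpace M ξ).starProjection ∘L (cyclicSpace M η).starProjection = 0
      ext k
      refine ext_inner_left ℂ fun l => ?_
      rw [comp_apply, zero_apply, inner_zero_right, ← Submodule.inner_starProjection_left_eq_right]
      exact inner_cyclicSpace_eq_zero (hF.prop.2 hξ hη hne')
        (Submodule.starProjection_apply_mem _ _) (Submodule.starProjection_apply_mem _ _)
  have hne : F.Nonempty := by
    by_contra hemp
    rw [Set.not_nonempty_iff_eq_empty] at hemp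
    obtain ⟨ζ, hζ⟩ := exists_ne (0 : H)
    exact hζ (hmax ζ (by simp [hemp]))
  obtain ⟨f, hf⟩ := hcount.exists_eq_range hne
  have hfF : ∀ n, f n ∈ F := fun n => by rw [hf]; exact ⟨n, rfl⟩
  refine ⟨f, fun n => hF.prop.1 _ (hfF n), fun A hA h0 => ?_⟩
  -- `A` commutes with `M'` and so kills every `a (f n)`; the range of `A*` is therefore orthogonal
  -- to the whole family.
  have hstar : adjoint A = 0 := by
    ext k
    refine hmax _ fun ξ hξ a ha => ?_
    rw [hf] at hξ
    obtain ⟨n, rfl⟩ := hξ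
    have hcomm : A (a (f n)) = a (A (f n)) :=
      congrArg (fun B : H →L[ℂ] H => B (f n)) ((VonNeumannAlgebra.mem_commutant_iff.1 ha) A hA)
    rw [adjoint_inner_left, hcomm, h0, map_zero, inner_zero_right]
  rw [← adjoint_adjoint A, hstar, map_zero]

theorem IsSigmaFinite.nonempty_normalFaithfulState [Nontrivial H] (hM : IsSigmaFinite M) :
    Nonempty (NormalFaithfulState M) := by
  obtain ⟨f, hf0, hf⟩ := hM.exists_separating
  -- The scaling makes `‖xₙ‖² = 2^{-(n+1)}`, with sum `1`, so that `∑ ⟪xₙ, A xₙ⟫` is a state.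
  let x : ℕ → H := fun n => ((√((1 / 2 : ℝ) / 2 ^ n) * ‖f n‖⁻¹ : ℝ) : ℂ) • f n
  have hxn : ∀ n, ‖x n‖ ^ 2 = (1 / 2 : ℝ) / 2 ^ n := by
    intro n
    have hn : ‖f n‖ ≠ 0 := norm_ne_zero_iff.2 (hf0 n)
    have : ‖x n‖ = √((1 / 2 : ℝ) / 2 ^ n) := by
      simp only [x, norm_smul, Complex.norm_real, norm_mul, norm_inv, norm_norm]
      rw [Real.norm_eq_abs, abs_of_nonneg (Real.sqrt_nonneg _)]
      rw [mul_assoc, inv_mul_cancel₀ hn, mul_one]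
    rw [this, Real.sq_sqrt (by positivity)]
  have hgeo : HasSum (fun n => ‖x n‖ ^ 2) 1 := by
    simp_rw [hxn]
    exact hasSum_geometric_two' 1
  have hx := hgeo.summable
  have hs := NormalFunctional.ofSeq_hasSum (M := M) x x hx hx
  refine ⟨⟨NormalFunctional.ofSeq M x x hx hx, fun A hA => ?_, ?_, fun A hA h0 => ?_⟩⟩
  · have h1 : 0 ≤ (NormalFunctional.ofSeq M x x hx hx).1 A :=
      (hs A).nonneg fun n => clm_nonneg_iff.1 hA _
    exact ⟨(Complex.nonneg_iff.1 h1).1, (Complex.nonneg_iff.1 h1).2.symm⟩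
  · refine (hs 1).unique ?_
    have : (fun n => ⟪x n, ((1 : M.toStarSubalgebra) : H →L[ℂ] H) (x n)⟫_ℂ)
        = fun n => ((‖x n‖ ^ 2 : ℝ) : ℂ) := by
      funext n
      rw [← inner_self_ofReal]
      rfl
    rw [this]
    rw [← Complex.ofReal_one]
    exact Complex.hasSum_ofReal.2 hgeo
  · have hz : ∀ n, ⟪x n, (A : H →L[ℂ] H) (x n)⟫_ℂ = 0 := by
      have h1 := hs A
      rw [h0] at h1
      exact congrFun ((hasSum_zero_iff_of_nonneg fun n => clm_nonneg_iff.1 hA _).1 h1)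
    obtain ⟨b, hb⟩ := exists_eq_star_mul_self hA
    apply Subtype.ext
    refine hf A A.2 fun n => ?_
    have hbx : b (x n) = 0 := by
      have := hz n
      rw [hb, inner_star_mul_self] at this
      exact inner_self_eq_zero.1 this
    have hAx : (A : H →L[ℂ] H) (x n) = 0 := by
      rw [hb, mul_def, comp_apply, hbx, map_zero]
    simp only [x, map_smul, smul_eq_zero] at hAx
    refine hAx.resolve_left ?_
    have hn : ‖f n‖ ≠ 0 := norm_ne_zero_iff.2 (hf0 n)
    have : √((1 / 2 : ℝ) / 2 ^ n) ≠ 0 := by positivity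
    exact_mod_cast mul_ne_zero this (inv_ne_zero hn)

end FaithfulState

end CPTomita

namespace CPTomita

open scoped ComplexOrder
open ContinuousLinearMap

/-! ### Simple functions and finitely additive integration. -/

section Simple

variable {S : Type*} [MeasurableSpace S]

/-- The indicator of a measurable set as a simple function. -/
noncomputable def simpleInd (Δ : Set S) (hΔ : MeasurableSet Δ) : SimpleFunc S ℂ :=
  SimpleFunc.piecewise Δ hΔ (SimpleFunc.const S 1) (SimpleFunc.const S 0)

theorem simpleInd_apply (Δ : Set S) (hΔ : MeasurableSet Δ) (t : S) :
    simpleInd Δ hΔ t = Δ.indicator 1 t := by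
  classical
  simp [simpleInd, Set.indicator, Set.piecewise]

theorem simpleInd_mul (Δ Δ' : Set S) (hΔ : MeasurableSet Δ) (hΔ' : MeasurableSet Δ') :
    simpleInd Δ hΔ * simpleInd Δ' hΔ' = simpleInd (Δ ∩ Δ') (hΔ.inter hΔ') := by
  ext t
  rw [SimpleFunc.mul_apply]
  simp only [simpleInd_apply, Set.indicator, Pi.one_apply, Set.mem_inter_iff]
  by_cases h : t ∈ Δ <;> by_cases h' : t ∈ Δ' <;> simp [h, h']

theorem star_simpleInd (Δ : Set S) (hΔ : MeasurableSet Δ) :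
    star (simpleInd Δ hΔ) = simpleInd Δ hΔ := by
  ext t
  change star (simpleInd Δ hΔ t) = _
  simp only [simpleInd_apply, Set.indicator, Pi.one_apply]
  split <;> simp

theorem simpleInd_univ : simpleInd (Set.univ : Set S) MeasurableSet.univ = 1 := by
  ext t
  simp [simpleInd_apply]

theorem simpleFunc_induction {p : SimpleFunc S ℂ → Prop}
    (hind : ∀ Δ hΔ, p (simpleInd Δ hΔ)) (hsmul : ∀ (c : ℂ) f, p f → p (c • f))
    (hadd : ∀ f g, p f → p g → p (f + g)) (f : SimpleFunc S ℂ) : p f := by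
  refine SimpleFunc.induction (fun c Δ hΔ => ?_) (fun f g _ => hadd f g) f
  convert hsmul c _ (hind Δ hΔ) using 1
  ext t
  rw [SimpleFunc.smul_apply]
  classical
  by_cases h : t ∈ Δ <;> simp [simpleInd_apply, h]

theorem simpleFunc_linearMap_ext {V : Type*} [AddCommGroup V] [Module ℂ V]
    {F G : SimpleFunc S ℂ →ₗ[ℂ] V}
    (h : ∀ Δ hΔ, F (simpleInd Δ hΔ) = G (simpleInd Δ hΔ)) : F = G := by
  ext f
  exact simpleFunc_induction (p := fun f => F f = G f) h
    (fun c f hf => by rw [map_smul, map_smul, hf])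
    (fun f g hf hg => by rw [map_add, map_add, hf, hg]) f

/-- A finitely additive set function extends linearly to simple functions. -/
theorem exists_simple_integral {V : Type*} [NormedAddCommGroup V] [NormedSpace ℂ V]
    (R : Set S → V)
    (hadd : ∀ Δ Δ', MeasurableSet Δ → MeasurableSet Δ' → Disjoint Δ Δ' →
      R (Δ ∪ Δ') = R Δ + R Δ') :
    ∃ I : SimpleFunc S ℂ →ₗ[ℂ] V, ∀ Δ hΔ, I (simpleInd Δ hΔ) = R Δ := by
  let Q : Set S → ℂ →L[ℝ] V := fun Δ =>
    ((ContinuousLinearMap.id ℂ ℂ).smulRight (R Δ)).restrictScalars ℝ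
  have hQ : ∀ Δ c, Q Δ c = c • R Δ := fun _ _ => rfl
  -- Only finite additivity matters. With the zero measure as reference every set has finite measure
  -- and every function is integrable.
  have hfin : FinMeasAdditive (0 : Measure S) Q := by
    intro Δ Δ' hΔ hΔ' _ _ hd
    ext1 c
    rw [add_apply, hQ, hQ, hQ, hadd Δ Δ' hΔ hΔ' hd, smul_add]
  have hempty : Q ∅ = 0 := by
    have h := hadd ∅ ∅ MeasurableSet.empty MeasurableSet.empty (by simp)
    rw [Set.union_empty, left_eq_add] at h
    ext1 c
    rw [hQ, h, smul_zero, zero_apply]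
  have hInt : ∀ f : SimpleFunc S ℂ, Integrable f (0 : Measure S) := fun f => integrable_zero_measure
  refine ⟨{ toFun := SimpleFunc.setToSimpleFunc Q
            map_add' := fun f g => SimpleFunc.setToSimpleFunc_add Q hfin (hInt f) (hInt g)
            map_smul' := fun c f => SimpleFunc.setToSimpleFunc_smul Q hfin
              (fun c Δ x => by rw [hQ, hQ, smul_assoc]) c (hInt f) }, fun Δ hΔ => ?_⟩
  change SimpleFunc.setToSimpleFunc Q _ = _
  rw [simpleInd, SimpleFunc.setToSimpleFunc_indicator Q hempty hΔ, hQ, one_smul]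

/-- Bounded measurable functions are uniform limits of simple functions. -/
theorem exists_simpleFunc_near {g : S → ℂ} (hg : Measurable g) {C : ℝ} (hC : ∀ t, ‖g t‖ ≤ C)
    {ε : ℝ} (hε : 0 < ε) : ∃ φ : SimpleFunc S ℂ, ∀ t, ‖φ t - g t‖ ≤ ε := by
  -- Compactness leaves finitely many centres; sending `g t` to the nearest of the first few points
  -- of the dense sequence gives a uniform approximation.
  have hcov : Metric.closedBall (0 : ℂ) C ⊆ ⋃ k : ℕ, Metric.ball (TopologicalSpace.denseSeq ℂ k) ε := by
    intro z _
    obtain ⟨k, hk⟩ := (TopologicalSpace.denseRange_denseSeq ℂ).exists_dist_lt z hε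
    exact Set.mem_iUnion.2 ⟨k, hk⟩
  obtain ⟨F, hF⟩ := (isCompact_closedBall (0 : ℂ) C).elim_finite_subcover _
    (fun _ => Metric.isOpen_ball) hcov
  refine ⟨(SimpleFunc.nearestPt (TopologicalSpace.denseSeq ℂ) (F.sup id)).comp g hg, fun t => ?_⟩
  obtain ⟨k, hkF, hk⟩ := Set.mem_iUnion₂.1 (hF (mem_closedBall_zero_iff.2 (hC t)))
  have h1 := SimpleFunc.edist_nearestPt_le (TopologicalSpace.denseSeq ℂ) (g t)
    (Finset.le_sup (f := id) hkF : k ≤ F.sup id)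
  rw [edist_dist, edist_dist, ENNReal.ofReal_le_ofReal_iff dist_nonneg] at h1
  rw [SimpleFunc.coe_comp, Function.comp_apply, ← dist_eq_norm]
  refine h1.trans ?_
  rw [dist_comm]
  exact (Metric.mem_ball.1 hk).le

end Simple

/-! ### The algebra `L^∞` acting on `L²` of a finite measure. -/

section Lp

variable {S : Type*} [MeasurableSpace S] (m : Measure S)

/-- Simple functions as elements of `L^p`. -/
noncomputable def simpleLp (p : ℝ≥0∞) [IsFiniteMeasure m] : SimpleFunc S ℂ →ₗ[ℂ] Lp ℂ p m where
  toFun φ := (φ.memLp_of_isFiniteMeasure p m).toLp φ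
  map_add' φ ψ := rfl
  map_smul' c φ := rfl

variable {m}

theorem simpleLp_coeFn (p : ℝ≥0∞) [IsFiniteMeasure m] (φ : SimpleFunc S ℂ) :
    simpleLp m p φ =ᵐ[m] φ := MemLp.coeFn_toLp (φ.memLp_of_isFiniteMeasure p m)

/-- Setting `f` to zero on the null set where `|f| > ‖f‖` makes the bound hold everywhere. An
everywhere bounded representative can be carried to another measure and approximated uniformly by
simple functions. -/
theorem linfty_exists_rep (f : Lp ℂ ∞ m) :
    ∃ g : S → ℂ, Measurable g ∧ (∀ t, ‖g t‖ ≤ ‖f‖) ∧ f =ᵐ[m] g := by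
  have hm : Measurable f := (Lp.stronglyMeasurable f).measurable
  have hΔ : MeasurableSet {t | ‖f t‖ ≤ ‖f‖} := measurableSet_le hm.norm measurable_const
  have hb : ∀ᵐ t ∂m, ‖f t‖ ≤ ‖f‖ := by
    have h := ae_le_eLpNormEssSup (f := f) (μ := m)
    filter_upwards [h] with t ht
    rw [Lp.norm_def, eLpNorm_exponent_top, ← toReal_enorm]
    refine ENNReal.toReal_mono ?_ ht
    have := Lp.eLpNorm_ne_top f
    rwa [eLpNorm_exponent_top] at this
  refine ⟨{t | ‖f t‖ ≤ ‖f‖}.indicator f, hm.indicator hΔ, fun t => ?_, ?_⟩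
  · by_cases h : t ∈ {t | ‖f t‖ ≤ ‖f‖}
    · rw [Set.indicator_of_mem h]; exact h
    · rw [Set.indicator_of_notMem h, norm_zero]; exact norm_nonneg f
  · filter_upwards [hb] with t ht
    rw [Set.indicator_of_mem]
    exact ht

theorem linfty_norm_le {f : Lp ℂ ∞ m} {C : ℝ} (hC : 0 ≤ C) (h : ∀ᵐ t ∂m, ‖f t‖ ≤ C) : ‖f‖ ≤ C := by
  rw [Lp.norm_def, eLpNorm_exponent_top]
  refine ENNReal.toReal_le_of_le_ofReal hC ?_
  refine essSup_le_of_ae_le _ ?_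
  filter_upwards [h] with t ht
  rw [← ofReal_norm_eq_enorm]
  exact ENNReal.ofReal_le_ofReal ht

theorem linfty_ae_norm_le (f : Lp ℂ ∞ m) : ∀ᵐ t ∂m, ‖f t‖ ≤ ‖f‖ := by
  obtain ⟨g, -, hb, hg⟩ := linfty_exists_rep f
  filter_upwards [hg] with t ht
  rw [ht]; exact hb t

theorem denseRange_simpleLp_top [IsFiniteMeasure m] : DenseRange (simpleLp m ∞) := by
  intro f
  rw [Metric.mem_closure_iff]
  intro ε hε
  obtain ⟨g, hgm, hgb, hfg⟩ := linfty_exists_rep f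
  obtain ⟨φ, hφ⟩ := exists_simpleFunc_near hgm hgb (half_pos hε)
  refine ⟨_, ⟨φ, rfl⟩, ?_⟩
  rw [dist_comm, dist_eq_norm]
  refine (linfty_norm_le (half_pos hε).le ?_).trans_lt (half_lt_self hε)
  filter_upwards [Lp.coeFn_sub (simpleLp m ∞ φ) f, hfg, simpleLp_coeFn ∞ φ] with t h1 h2 h3
  rw [h1, Pi.sub_apply, h2, h3]
  exact hφ t

theorem denseRange_simpleLp_two [IsFiniteMeasure m] : DenseRange (simpleLp m 2) := by
  have h := Lp.simpleFunc.dense (E := ℂ) (p := 2) (μ := m) (by norm_num)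
  refine h.mono ?_
  intro f hf
  refine ⟨Lp.simpleFunc.toSimpleFunc ⟨f, hf⟩, Lp.ext ?_⟩
  exact (simpleLp_coeFn 2 _).trans (Lp.simpleFunc.toSimpleFunc_eq_toFun ⟨f, hf⟩)

theorem linfty_clm_ext [IsFiniteMeasure m] {V : Type*} [NormedAddCommGroup V] [NormedSpace ℂ V]
    {F G : Lp ℂ ∞ m →L[ℂ] V}
    (h : ∀ Δ hΔ, F (simpleLp m ∞ (simpleInd Δ hΔ)) = G (simpleLp m ∞ (simpleInd Δ hΔ))) :
    F = G := by
  have h1 : F.toLinearMap ∘ₗ simpleLp m ∞ = G.toLinearMap ∘ₗ simpleLp m ∞ :=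
    simpleFunc_linearMap_ext h
  ext f
  exact denseRange_simpleLp_top.induction_on (p := fun f => F f = G f) f
    (isClosed_eq F.continuous G.continuous) fun φ => LinearMap.congr_fun h1 φ

/-- The product of `L^∞`. -/
noncomputable def linftyMul (f g : Lp ℂ ∞ m) : Lp ℂ ∞ m :=
  (ContinuousLinearMap.mul ℂ ℂ).holder (p := ∞) (q := ∞) ∞ f g

theorem linftyMul_coeFn (f g : Lp ℂ ∞ m) : linftyMul f g =ᵐ[m] fun t => f t * g t :=
  ContinuousLinearMap.coeFn_holder _ f g

theorem simpleLp_mul [IsFiniteMeasure m] (φ ψ : SimpleFunc S ℂ) :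
    simpleLp m ∞ (φ * ψ) = linftyMul (simpleLp m ∞ φ) (simpleLp m ∞ ψ) := by
  refine Lp.ext ?_
  filter_upwards [simpleLp_coeFn (m := m) ∞ (φ * ψ), simpleLp_coeFn (m := m) ∞ φ,
    simpleLp_coeFn (m := m) ∞ ψ, linftyMul_coeFn (simpleLp m ∞ φ) (simpleLp m ∞ ψ)]
    with t h1 h2 h3 h4
  rw [h1, h4, h2, h3, SimpleFunc.mul_apply]

theorem simpleLp_star [IsFiniteMeasure m] (φ : SimpleFunc S ℂ) :
    simpleLp m ∞ (star φ) = star (simpleLp m ∞ φ) := by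
  refine Lp.ext ?_
  filter_upwards [simpleLp_coeFn (m := m) ∞ (star φ), simpleLp_coeFn (m := m) ∞ φ,
    Lp.coeFn_star (simpleLp m ∞ φ)] with t h1 h2 h3
  rw [h1, h3, Pi.star_apply, h2]
  rfl

theorem mulOp_coeFn (f : Lp ℂ ∞ m) (h : Lp ℂ 2 m) : mulOp m f h =ᵐ[m] fun t => f t * h t :=
  ContinuousLinearMap.coeFn_holder _ f h

theorem mulOp_mul (f g : Lp ℂ ∞ m) : mulOp m (linftyMul f g) = mulOp m f ∘L mulOp m g := by
  ext1 h
  refine Lp.ext ?_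
  filter_upwards [mulOp_coeFn (linftyMul f g) h, linftyMul_coeFn f g, mulOp_coeFn f (mulOp m g h),
    mulOp_coeFn g h] with t h1 h2 h3 h4
  rw [h1, h2, comp_apply, h3, h4, mul_assoc]

theorem linftyMul_comm (f g : Lp ℂ ∞ m) : linftyMul f g = linftyMul g f := by
  refine Lp.ext ?_
  filter_upwards [linftyMul_coeFn f g, linftyMul_coeFn g f] with t h1 h2
  rw [h1, h2, mul_comm]

theorem adjoint_mulOp (f : Lp ℂ ∞ m) : adjoint (mulOp m f) = mulOp m (star f) := by
  symm
  rw [eq_adjoint_iff]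
  intro h k
  rw [L2.inner_def, L2.inner_def]
  refine integral_congr_ae ?_
  filter_upwards [mulOp_coeFn (star f) h, mulOp_coeFn f k, Lp.coeFn_star f] with t h1 h2 h3
  rw [h1, h2, h3, Pi.star_apply, RCLike.inner_apply, RCLike.inner_apply, map_mul, RCLike.star_def,
    RCLike.conj_conj]
  ring

/-- The inclusion of `L^∞` in `L²` for a finite measure. -/
noncomputable def toL2 (m : Measure S) [IsFiniteMeasure m] : Lp ℂ ∞ m →ₗ[ℂ] Lp ℂ 2 m where
  toFun f := mulOp m f (simpleLp m 2 1)
  map_add' f g := by simp [mulOp]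
  map_smul' c f := by simp [mulOp]

theorem toL2_coeFn [IsFiniteMeasure m] (f : Lp ℂ ∞ m) : toL2 m f =ᵐ[m] f := by
  filter_upwards [mulOp_coeFn f (simpleLp m 2 1), simpleLp_coeFn (m := m) 2 1] with t h1 h2
  change (mulOp m f (simpleLp m 2 1)) t = _
  rw [h1, h2]
  simp

theorem toL2_simpleLp [IsFiniteMeasure m] (φ : SimpleFunc S ℂ) :
    toL2 m (simpleLp m ∞ φ) = simpleLp m 2 φ :=
  Lp.ext ((toL2_coeFn _).trans ((simpleLp_coeFn ∞ φ).trans (simpleLp_coeFn 2 φ).symm))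

theorem denseRange_toL2 [IsFiniteMeasure m] : DenseRange (toL2 m) := by
  refine denseRange_simpleLp_two.mono ?_
  rintro _ ⟨φ, rfl⟩
  exact ⟨simpleLp m ∞ φ, toL2_simpleLp φ⟩

theorem mulOp_toL2 [IsFiniteMeasure m] (f g : Lp ℂ ∞ m) :
    mulOp m f (toL2 m g) = toL2 m (linftyMul f g) := by
  change _ = mulOp m (linftyMul f g) (simpleLp m 2 1)
  rw [mulOp_mul]
  rfl

theorem norm_toL2_sq [IsFiniteMeasure m] (f : Lp ℂ ∞ m) :
    ((‖toL2 m f‖ ^ 2 : ℝ) : ℂ) = ∫ t, (linftyMul (star f) f) t ∂m := by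
  rw [← inner_self_ofReal, L2.inner_def]
  refine integral_congr_ae ?_
  filter_upwards [toL2_coeFn f, linftyMul_coeFn (star f) f, Lp.coeFn_star f] with t h1 h2 h3
  rw [h1, h2, h3, Pi.star_apply, RCLike.inner_apply, mul_comm, RCLike.star_def]

theorem norm_sq_L2_eq_lintegral (a : Lp ℂ 2 m) :
    ENNReal.ofReal (‖a‖ ^ 2) = ∫⁻ t, ‖a t‖ₑ ^ 2 ∂m := by
  have h1 : eLpNorm a 2 m = (∫⁻ t, ‖a t‖ₑ ^ (2 : ℝ) ∂m) ^ (1 / (2 : ℝ)) := by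
    have := eLpNorm_eq_lintegral_rpow_enorm_toReal (f := a) (μ := m) (p := 2) (by norm_num)
      (by norm_num)
    simpa using this
  have h2 : ENNReal.ofReal ‖a‖ = eLpNorm a 2 m := by
    rw [Lp.norm_def, ENNReal.ofReal_toReal (Lp.eLpNorm_ne_top a)]
  rw [ENNReal.ofReal_pow (norm_nonneg _), h2, h1, ← ENNReal.rpow_natCast, ← ENNReal.rpow_mul]
  norm_num

/-- An element of `L²` that acts boundedly on indicators is bounded. -/
theorem exists_toL2_eq [IsFiniteMeasure m] {a : Lp ℂ 2 m} {C : ℝ} (hC : 0 ≤ C)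
    (h : ∀ Δ hΔ, ‖mulOp m (simpleLp m ∞ (simpleInd Δ hΔ)) a‖
      ≤ C * ‖simpleLp m 2 (simpleInd Δ hΔ)‖) :
    ∃ f : Lp ℂ ∞ m, toL2 m f = a := by
  -- Squared, the hypothesis compares the integrals of `|a|²` and `C²` over every measurable set,
  -- which yields `|a| ≤ C` almost everywhere.
  have key : ∀ Δ, MeasurableSet Δ → ∫⁻ t in Δ, ‖a t‖ₑ ^ 2 ∂m ≤ ∫⁻ _ in Δ, ENNReal.ofReal C ^ 2 ∂m := by
    intro Δ hΔ
    have e1 : ∫⁻ t in Δ, ‖a t‖ₑ ^ 2 ∂m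
        = ENNReal.ofReal (‖mulOp m (simpleLp m ∞ (simpleInd Δ hΔ)) a‖ ^ 2) := by
      rw [norm_sq_L2_eq_lintegral, ← lintegral_indicator hΔ]
      refine lintegral_congr_ae ?_
      filter_upwards [mulOp_coeFn (simpleLp m ∞ (simpleInd Δ hΔ)) a,
        simpleLp_coeFn (m := m) ∞ (simpleInd Δ hΔ)] with t h1 h2
      rw [h1, h2, simpleInd_apply]
      by_cases ht : t ∈ Δ <;> simp [ht]
    have e2 : ENNReal.ofReal (‖simpleLp m 2 (simpleInd Δ hΔ)‖ ^ 2) = m Δ := by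
      rw [norm_sq_L2_eq_lintegral]
      calc _ = ∫⁻ t, Δ.indicator 1 t ∂m := by
            refine lintegral_congr_ae ?_
            filter_upwards [simpleLp_coeFn (m := m) 2 (simpleInd Δ hΔ)] with t h1
            rw [h1, simpleInd_apply]
            by_cases ht : t ∈ Δ <;> simp [ht]
        _ = m Δ := by rw [lintegral_indicator_one hΔ]
    rw [e1, setLIntegral_const, ← e2, ← ENNReal.ofReal_pow hC, ← ENNReal.ofReal_mul (by positivity),
      ← mul_pow]
    exact ENNReal.ofReal_le_ofReal (pow_le_pow_left₀ (norm_nonneg _) (h Δ hΔ) 2)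
  have hmeas : Measurable fun t => ‖a t‖ₑ ^ 2 :=
    ((Lp.stronglyMeasurable a).measurable.enorm).pow_const 2
  have hae := ae_le_of_forall_setLIntegral_le_of_sigmaFinite (μ := m) hmeas
    (g := fun _ => ENNReal.ofReal C ^ 2) (fun Δ hΔ _ => key Δ hΔ)
  have hb : ∀ᵐ t ∂m, ‖a t‖ ≤ C := by
    filter_upwards [hae] with t ht
    have h1 : ‖a t‖ₑ ≤ ENNReal.ofReal C := (ENNReal.pow_le_pow_left_iff two_ne_zero).1 ht
    rw [← ofReal_norm_eq_enorm, ENNReal.ofReal_le_ofReal_iff hC] at h1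
    exact h1
  have hmem := memLp_top_of_bound (Lp.aestronglyMeasurable a) C hb
  exact ⟨hmem.toLp a, Lp.ext ((toL2_coeFn _).trans (MemLp.coeFn_toLp hmem))⟩

/-- The multiplication algebra of a finite measure is maximal abelian. -/
theorem exists_eq_mulOp [IsFiniteMeasure m] (A : Lp ℂ 2 m →L[ℂ] Lp ℂ 2 m)
    (hA : ∀ f, A ∘L mulOp m f = mulOp m f ∘L A) : ∃ f, A = mulOp m f := by
  have hA' : ∀ f h, A (mulOp m f h) = mulOp m f (A h) := fun f h =>
    congrArg (fun B : Lp ℂ 2 m →L[ℂ] Lp ℂ 2 m => B h) (hA f)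
  -- The constant function `1` is cyclic, so `A` is determined by `A 1`. Boundedness of `A` on
  -- indicators makes `A 1` a bounded function, the symbol of `A`.
  have hone : ∀ g, A (toL2 m g) = mulOp m g (A (simpleLp m 2 1)) := fun g => hA' g _
  obtain ⟨f, hf⟩ := exists_toL2_eq (a := A (simpleLp m 2 1)) (norm_nonneg A) (fun Δ hΔ => by
    rw [← hone, toL2_simpleLp]
    exact A.le_opNorm _)
  refine ⟨f, ?_⟩
  ext1 h
  refine denseRange_toL2.induction_on (p := fun h => A h = mulOp m f h) h
    (isClosed_eq A.continuous (mulOp m f).continuous) fun g => ?_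
  rw [hone, ← hf, mulOp_toL2, mulOp_toL2, linftyMul_comm]

end Lp

end CPTomita

/-! ### Projection-valued measures and their spectral integral. -/

namespace CPTomita

open scoped ComplexOrder
open ContinuousLinearMap

/-- A projection-valued measure. -/
structure PVM (S : Type*) [MeasurableSpace S] (K : Type*) [NormedAddCommGroup K]
    [InnerProductSpace ℂ K] [CompleteSpace K] where
  toFun : Set S → K →L[ℂ] K
  proj : ∀ Δ, MeasurableSet Δ → IsStarProjection (toFun Δ)
  univ : toFun Set.univ = 1
  union : ∀ Δ Δ', MeasurableSet Δ → MeasurableSet Δ' → Disjoint Δ Δ' →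
    toFun (Δ ∪ Δ') = toFun Δ + toFun Δ'
  hasSum : ∀ Δ : ℕ → Set S, (∀ i, MeasurableSet (Δ i)) → Pairwise (fun i j => Disjoint (Δ i) (Δ j)) →
    ∀ k, HasSum (fun i => toFun (Δ i) k) (toFun (⋃ i, Δ i) k)

theorem IsStarProjection.inner_apply_self {K : Type*} [NormedAddCommGroup K]
    [InnerProductSpace ℂ K] [CompleteSpace K] {p : K →L[ℂ] K} (hp : IsStarProjection p) (k : K) :
    ⟪k, p k⟫_ℂ = ((‖p k‖ ^ 2 : ℝ) : ℂ) := by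
  have h1 : star p * p = p := by
    rw [hp.isSelfAdjoint.star_eq]; exact hp.isIdempotentElem
  conv_lhs => rw [← h1]
  rw [inner_star_mul_self, inner_self_ofReal]

/-- Expanding `(p + q)² = p + q` gives `p q + q p = 0`. Multiplying by `p` on either side gives `p q
= -p q p = q p`, so `2 p q = 0`. -/
theorem mul_eq_zero_of_add_isIdempotentElem {A : Type*} [Ring A] [Module ℂ A] {p q : A}
    (hp : IsIdempotentElem p) (hq : IsIdempotentElem q) (h : IsIdempotentElem (p + q)) :
    p * q = 0 := by
  have h0 : p * q + q * p = 0 := by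
    have := h.eq
    rw [add_mul, mul_add, mul_add, hp.eq, hq.eq] at this
    have h2 : p + q + (p * q + q * p) = p + q := by
      refine Eq.trans ?_ this
      abel
    simpa using h2
  have h1 : p * q + p * q * p = 0 := by
    have := congrArg (p * ·) h0
    simp only [mul_add, mul_zero] at this
    rwa [← mul_assoc, hp.eq, ← mul_assoc] at this
  have h2 : p * q * p + q * p = 0 := by
    have := congrArg (· * p) h0
    simp only [add_mul, zero_mul] at this
    rwa [mul_assoc q p p, hp.eq] at this
  have h3 : p * q = q * p := by
    rw [eq_neg_of_add_eq_zero_left h1, eq_neg_of_add_eq_zero_right h2]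
  rw [← h3, ← two_smul ℂ] at h0
  exact (smul_eq_zero_iff_right two_ne_zero).1 h0

theorem continuous_star_linfty {S : Type*} [MeasurableSpace S] {m : Measure S} :
    Continuous (star : Lp ℂ ∞ m → Lp ℂ ∞ m) := by
  refine (LipschitzWith.of_dist_le_mul (K := 1) fun f g => ?_).continuous
  rw [NNReal.coe_one, one_mul, dist_eq_norm, dist_eq_norm]
  refine linfty_norm_le (norm_nonneg _) ?_
  filter_upwards [linfty_ae_norm_le (f - g), Lp.coeFn_sub f g, Lp.coeFn_sub (star f) (star g),
    Lp.coeFn_star f, Lp.coeFn_star g] with t h1 h2 h3 h4 h5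
  rw [h3, Pi.sub_apply, h4, h5, Pi.star_apply, Pi.star_apply, ← star_sub, norm_star]
  rwa [h2, Pi.sub_apply] at h1

namespace PVM

variable {S : Type*} [MeasurableSpace S] {K : Type*} [NormedAddCommGroup K]
    [InnerProductSpace ℂ K] [CompleteSpace K] (R : PVM S K)

theorem empty : R.toFun ∅ = 0 := by
  have h := R.union ∅ ∅ MeasurableSet.empty MeasurableSet.empty (by simp)
  rwa [Set.union_empty, left_eq_add] at h

theorem star_eq {Δ : Set S} (hΔ : MeasurableSet Δ) : star (R.toFun Δ) = R.toFun Δ :=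
  (R.proj Δ hΔ).isSelfAdjoint.star_eq

theorem mul_disjoint {Δ Δ' : Set S} (hΔ : MeasurableSet Δ) (hΔ' : MeasurableSet Δ')
    (hd : Disjoint Δ Δ') : R.toFun Δ * R.toFun Δ' = 0 := by
  refine mul_eq_zero_of_add_isIdempotentElem (R.proj Δ hΔ).isIdempotentElem
    (R.proj Δ' hΔ').isIdempotentElem ?_
  rw [← R.union Δ Δ' hΔ hΔ' hd]
  exact (R.proj _ (hΔ.union hΔ')).isIdempotentElem

theorem mul_eq {Δ Δ' : Set S} (hΔ : MeasurableSet Δ) (hΔ' : MeasurableSet Δ') :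
    R.toFun Δ * R.toFun Δ' = R.toFun (Δ ∩ Δ') := by
  have hi := hΔ.inter hΔ'
  have h1 : R.toFun Δ = R.toFun (Δ ∩ Δ') + R.toFun (Δ \ Δ') := by
    rw [← R.union _ _ hi (hΔ.diff hΔ') (by
      exact Set.disjoint_left.2 fun t h h' => h'.2 h.2), Set.inter_union_diff]
  have h2 : R.toFun Δ' = R.toFun (Δ ∩ Δ') + R.toFun (Δ' \ Δ) := by
    rw [← R.union _ _ hi (hΔ'.diff hΔ) (by
      exact Set.disjoint_left.2 fun t h h' => h'.2 h.1), Set.inter_comm, Set.inter_union_diff]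
  rw [h1, h2, add_mul, mul_add, mul_add, (R.proj _ hi).isIdempotentElem.eq,
    R.mul_disjoint hi (hΔ'.diff hΔ) (Set.disjoint_left.2 fun t h h' => h'.2 h.1),
    R.mul_disjoint (hΔ.diff hΔ') hi (Set.disjoint_left.2 fun t h h' => h.2 h'.2),
    R.mul_disjoint (hΔ.diff hΔ') (hΔ'.diff hΔ) (Set.disjoint_left.2 fun t h h' => h.2 h'.1)]
  simp

theorem commute {Δ Δ' : Set S} (hΔ : MeasurableSet Δ) (hΔ' : MeasurableSet Δ') :
    R.toFun Δ * R.toFun Δ' = R.toFun Δ' * R.toFun Δ := by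
  rw [R.mul_eq hΔ hΔ', R.mul_eq hΔ' hΔ, Set.inter_comm]

/-- The measure `Δ ↦ ‖R(Δ) k‖²`. -/
noncomputable def meas (k : K) : Measure S :=
  Measure.ofMeasurable (fun Δ _ => ENNReal.ofReal (‖R.toFun Δ k‖ ^ 2)) (by simp [R.empty])
    (fun Δ hΔ hd => by
      have h := (R.hasSum Δ hΔ (fun i j hij => hd hij) k)
      have h1 : HasSum (fun i => ⟪k, R.toFun (Δ i) k⟫_ℂ) ⟪k, R.toFun (⋃ i, Δ i) k⟫_ℂ :=
        h.mapL (innerSL ℂ k)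
      simp_rw [(R.proj _ (hΔ _)).inner_apply_self,
        (R.proj _ (MeasurableSet.iUnion hΔ)).inner_apply_self] at h1
      have h2 := Complex.hasSum_ofReal.1 h1
      rw [← h2.tsum_eq, ENNReal.ofReal_tsum_of_nonneg (fun i => by positivity) h2.summable])

theorem meas_apply (k : K) {Δ : Set S} (hΔ : MeasurableSet Δ) :
    R.meas k Δ = ENNReal.ofReal (‖R.toFun Δ k‖ ^ 2) := Measure.ofMeasurable_apply Δ hΔ

theorem meas_eq_zero_iff (k : K) {Δ : Set S} (hΔ : MeasurableSet Δ) :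
    R.meas k Δ = 0 ↔ R.toFun Δ k = 0 := by
  rw [R.meas_apply k hΔ, ENNReal.ofReal_eq_zero]
  constructor
  · intro h
    have : ‖R.toFun Δ k‖ ^ 2 = 0 := le_antisymm h (by positivity)
    simpa using this
  · intro h; simp [h]

instance (k : K) : IsFiniteMeasure (R.meas k) :=
  ⟨by rw [R.meas_apply k MeasurableSet.univ]; exact ENNReal.ofReal_lt_top⟩

/-- The integral of simple functions. -/
noncomputable def simpleInt : SimpleFunc S ℂ →ₗ[ℂ] (K →L[ℂ] K) :=
  (exists_simple_integral R.toFun R.union).choose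

theorem simpleInt_ind (Δ : Set S) (hΔ : MeasurableSet Δ) :
    R.simpleInt (simpleInd Δ hΔ) = R.toFun Δ :=
  (exists_simple_integral R.toFun R.union).choose_spec Δ hΔ

theorem simpleInt_one : R.simpleInt 1 = 1 := by
  rw [← simpleInd_univ, simpleInt_ind, R.univ]

theorem simpleInt_mul (φ ψ : SimpleFunc S ℂ) :
    R.simpleInt (φ * ψ) = R.simpleInt φ * R.simpleInt ψ := by
  refine simpleFunc_induction (p := fun φ => R.simpleInt (φ * ψ) = R.simpleInt φ * R.simpleInt ψ)
    (fun Δ hΔ => ?_) (fun c φ h => ?_) (fun φ φ' h h' => ?_) φ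
  · refine simpleFunc_induction (p := fun ψ => R.simpleInt (simpleInd Δ hΔ * ψ)
      = R.simpleInt (simpleInd Δ hΔ) * R.simpleInt ψ)
      (fun Δ' hΔ' => ?_) (fun c φ h => ?_) (fun φ φ' h h' => ?_) ψ
    · rw [simpleInd_mul, simpleInt_ind, simpleInt_ind, simpleInt_ind, R.mul_eq hΔ hΔ']
    · have e : simpleInd Δ hΔ * c • φ = c • (simpleInd Δ hΔ * φ) := by
        ext t
        simp [mul_left_comm]
      rw [e, map_smul, map_smul, mul_smul_comm, h]
    · rw [mul_add, map_add, map_add, mul_add, h, h']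
  · have e : c • φ * ψ = c • (φ * ψ) := by
      ext t
      simp [mul_assoc]
    rw [e, map_smul, map_smul, smul_mul_assoc, h]
  · rw [add_mul, map_add, map_add, add_mul, h, h']

theorem simpleInt_star (φ : SimpleFunc S ℂ) :
    R.simpleInt (star φ) = star (R.simpleInt φ) := by
  refine simpleFunc_induction (p := fun φ => R.simpleInt (star φ) = star (R.simpleInt φ))
    (fun Δ hΔ => ?_) (fun c φ h => ?_) (fun φ φ' h h' => ?_) φ
  · rw [star_simpleInd, simpleInt_ind, R.star_eq hΔ]
  · have e : star (c • φ) = star c • star φ := by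
      ext t
      change star (c • φ t) = star c • star (φ t)
      rw [star_smul]
    rw [e, map_smul, map_smul, star_smul, h]
  · have e : star (φ + φ') = star φ + star φ' := by
      ext t
      change star (φ t + φ' t) = star (φ t) + star (φ' t)
      rw [star_add]
    rw [e, map_add, map_add, star_add, h, h']

theorem inner_simpleInt (k : K) (φ : SimpleFunc S ℂ) :
    ⟪k, R.simpleInt φ k⟫_ℂ = ∫ t, φ t ∂(R.meas k) := by
  have hInt : ∀ φ : SimpleFunc S ℂ, Integrable φ (R.meas k) := fun φ =>
    φ.integrable_of_isFiniteMeasure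
  refine simpleFunc_induction (p := fun φ => ⟪k, R.simpleInt φ k⟫_ℂ = ∫ t, φ t ∂(R.meas k))
    (fun Δ hΔ => ?_) (fun c φ h => ?_) (fun φ φ' h h' => ?_) φ
  · have e : ∫ t, simpleInd Δ hΔ t ∂(R.meas k) = (((R.meas k).real Δ : ℝ) : ℂ) := by
      simp_rw [simpleInd_apply]
      rw [integral_indicator hΔ]
      simp
    rw [e, simpleInt_ind, (R.proj _ hΔ).inner_apply_self, measureReal_def,
      R.meas_apply k hΔ, ENNReal.toReal_ofReal (by positivity)]
  · rw [map_smul, smul_apply, inner_smul_right, h]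
    simp_rw [SimpleFunc.smul_apply]
    rw [integral_smul, smul_eq_mul]
  · rw [map_add, add_apply, inner_add_right, h, h']
    simp_rw [SimpleFunc.add_apply]
    rw [integral_add (hInt φ) (hInt φ')]

/-- `‖R(φ) k‖² = ⟪k, R(φ̄ φ) k⟫ = ∫ |φ|² dm_k`, as the simple integral is a *-homomorphism. -/
theorem norm_simpleInt_apply (k : K) (φ : SimpleFunc S ℂ) :
    ‖R.simpleInt φ k‖ = ‖simpleLp (R.meas k) 2 φ‖ := by
  have h1 : ((‖R.simpleInt φ k‖ ^ 2 : ℝ) : ℂ) = ((‖simpleLp (R.meas k) 2 φ‖ ^ 2 : ℝ) : ℂ) := by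
    rw [← inner_self_ofReal, ← inner_star_mul_self, ← simpleInt_star, ← simpleInt_mul,
      inner_simpleInt, ← toL2_simpleLp, norm_toL2_sq]
    refine integral_congr_ae ?_
    filter_upwards [linftyMul_coeFn (star (simpleLp (R.meas k) ∞ φ)) (simpleLp (R.meas k) ∞ φ),
      Lp.coeFn_star (simpleLp (R.meas k) ∞ φ), simpleLp_coeFn (m := R.meas k) ∞ φ] with t h1 h2 h3
    rw [h1, h2, Pi.star_apply, h3]
    rfl
  have h2 := Complex.ofReal_inj.1 h1
  exact (pow_left_inj₀ (norm_nonneg _) (norm_nonneg _) two_ne_zero).1 h2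

/-- The linear map `φ ↦ R(φ) k`. -/
noncomputable def simpleIntApply (k : K) : SimpleFunc S ℂ →ₗ[ℂ] K where
  toFun φ := R.simpleInt φ k
  map_add' φ ψ := by rw [map_add, add_apply]
  map_smul' c φ := by rw [map_smul, smul_apply, RingHom.id_apply]

/-- The isometry `L²(m_k) → K`, `φ ↦ R(φ) k`. -/
noncomputable def vectorMap (k : K) : Lp ℂ 2 (R.meas k) →L[ℂ] K :=
  (R.simpleIntApply k).extendOfNorm
    (simpleLp (R.meas k) 2)

theorem vectorMap_simpleLp (k : K) (φ : SimpleFunc S ℂ) :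
    R.vectorMap k (simpleLp (R.meas k) 2 φ) = R.simpleInt φ k :=
  LinearMap.extendOfNorm_eq (f := R.simpleIntApply k) denseRange_simpleLp_two
    ⟨1, fun φ => by rw [one_mul]; exact (R.norm_simpleInt_apply k φ).le⟩ φ

theorem norm_vectorMap (k : K) (a : Lp ℂ 2 (R.meas k)) : ‖R.vectorMap k a‖ = ‖a‖ :=
  denseRange_simpleLp_two.induction_on (p := fun a => ‖R.vectorMap k a‖ = ‖a‖) a
    (isClosed_eq (by fun_prop) (by fun_prop)) fun φ => by
      rw [vectorMap_simpleLp, norm_simpleInt_apply]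

/-- `ν` has the same null sets as `R`. -/
def Compat (ν : Measure S) : Prop := ∀ Δ, MeasurableSet Δ → (ν Δ = 0 ↔ R.toFun Δ = 0)

variable {R} {ν : Measure S}

theorem Compat.meas_absolutelyContinuous (h : R.Compat ν) (k : K) : R.meas k ≪ ν := by
  refine Measure.AbsolutelyContinuous.mk fun Δ hΔ h0 => ?_
  rw [R.meas_eq_zero_iff k hΔ, (h Δ hΔ).1 h0, zero_apply]

variable [IsFiniteMeasure ν]

/-- `‖R(φ) k‖` is the `L²(m_k)` norm of `φ`; the measure `m_k` has mass `‖k‖²` and `m_k ≪ ν`, so the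
`ν`-essential supremum bounds it. -/
theorem Compat.norm_simpleInt_le (h : R.Compat ν) (φ : SimpleFunc S ℂ) :
    ‖R.simpleInt φ‖ ≤ 1 * ‖simpleLp ν ∞ φ‖ := by
  rw [one_mul]
  refine opNorm_le_bound _ (norm_nonneg _) fun k => ?_
  rw [norm_simpleInt_apply]
  have hb : ∀ᵐ t ∂(R.meas k), ‖simpleLp (R.meas k) 2 φ t‖ ≤ ‖simpleLp ν ∞ φ‖ := by
    filter_upwards [simpleLp_coeFn (m := R.meas k) 2 φ,
      (h.meas_absolutelyContinuous k).ae_le (simpleLp_coeFn (m := ν) ∞ φ),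
      (h.meas_absolutelyContinuous k).ae_le (linfty_ae_norm_le (simpleLp ν ∞ φ))] with t h1 h2 h3
    rwa [h1, ← h2]
  refine (Lp.norm_le_of_ae_bound (norm_nonneg _) hb).trans_eq ?_
  have : ((measureUnivNNReal (R.meas k) : ℝ)) = ‖k‖ ^ 2 := by
    change (R.meas k Set.univ).toReal = _
    rw [R.meas_apply k MeasurableSet.univ, R.univ, one_apply_eq_self,
      ENNReal.toReal_ofReal (by positivity)]
  rw [mul_comm]
  congr 1
  have h2 : ((2 : ℝ≥0∞).toReal)⁻¹ = 1 / 2 := by norm_num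
  rw [this, h2, ← Real.sqrt_eq_rpow, Real.sqrt_sq (norm_nonneg _)]

variable (R ν) in
/-- The integral of bounded functions with respect to a projection-valued measure. -/
noncomputable def kappa : Lp ℂ ∞ ν →L[ℂ] (K →L[ℂ] K) :=
  R.simpleInt.extendOfNorm (simpleLp ν ∞)

theorem Compat.kappa_simpleLp (h : R.Compat ν) (φ : SimpleFunc S ℂ) :
    R.kappa ν (simpleLp ν ∞ φ) = R.simpleInt φ :=
  LinearMap.extendOfNorm_eq denseRange_simpleLp_top ⟨1, h.norm_simpleInt_le⟩ φ

theorem Compat.kappa_ind (h : R.Compat ν) (Δ : Set S) (hΔ : MeasurableSet Δ) :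
    R.kappa ν (simpleLp ν ∞ (simpleInd Δ hΔ)) = R.toFun Δ := by
  rw [h.kappa_simpleLp, simpleInt_ind]

theorem Compat.kappa_mul (h : R.Compat ν) (f g : Lp ℂ ∞ ν) :
    R.kappa ν (linftyMul f g) = R.kappa ν f * R.kappa ν g := by
  have hc : Continuous fun p : Lp ℂ ∞ ν × Lp ℂ ∞ ν => linftyMul p.1 p.2 :=
    ((ContinuousLinearMap.mul ℂ ℂ).holderL ν ∞ ∞ ∞).continuous₂
  refine (denseRange_simpleLp_top.prodMap denseRange_simpleLp_top).induction_on
    (p := fun p : Lp ℂ ∞ ν × Lp ℂ ∞ ν =>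
      R.kappa ν (linftyMul p.1 p.2) = R.kappa ν p.1 * R.kappa ν p.2) (f, g)
    (isClosed_eq (by fun_prop) (by fun_prop)) fun p => ?_
  simp only [Prod.map_fst, Prod.map_snd]
  rw [← simpleLp_mul, h.kappa_simpleLp, h.kappa_simpleLp, h.kappa_simpleLp, simpleInt_mul]

theorem Compat.kappa_star (h : R.Compat ν) (f : Lp ℂ ∞ ν) :
    R.kappa ν (star f) = star (R.kappa ν f) := by
  refine denseRange_simpleLp_top.induction_on
    (p := fun f : Lp ℂ ∞ ν => R.kappa ν (star f) = star (R.kappa ν f)) f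
    (isClosed_eq ((R.kappa ν).continuous.comp continuous_star_linfty)
      (continuous_star.comp (R.kappa ν).continuous)) fun φ => ?_
  rw [← simpleLp_star, h.kappa_simpleLp, h.kappa_simpleLp, simpleInt_star]

/-- `kappa` extends the simple integral from `L^∞(ν)` and `vectorMap` extends it from `L²(m_k)`. A
simple function uniformly close to `f` is close in both norms, so the two extensions agree. -/
theorem Compat.kappa_apply (h : R.Compat ν) {f : Lp ℂ ∞ ν} {k : K} {a : Lp ℂ 2 (R.meas k)}
    (hfa : f =ᵐ[R.meas k] a) : R.kappa ν f k = R.vectorMap k a := by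
  obtain ⟨g, hgm, hgb, hfg⟩ := linfty_exists_rep f
  have hac := h.meas_absolutelyContinuous k
  rw [← sub_eq_zero, ← norm_le_zero_iff]
  set c : ℝ := measureUnivNNReal (R.meas k) ^ (2 : ℝ≥0∞).toReal⁻¹ with hc
  set C : ℝ := ‖R.kappa ν‖ * ‖k‖ + c with hC
  have hc0 : 0 ≤ c := by positivity
  refine le_of_forall_pos_le_add fun ε hε => ?_
  have hC0 : 0 < C + 1 := by positivity
  obtain ⟨φ, hφ⟩ := exists_simpleFunc_near hgm hgb (div_pos hε hC0)
  set δ := ε / (C + 1) with hδ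
  have hδ0 : 0 ≤ δ := (div_pos hε hC0).le
  have h1 : ‖R.kappa ν f k - R.simpleInt φ k‖ ≤ δ * (‖R.kappa ν‖ * ‖k‖) := by
    have e : ‖f - simpleLp ν ∞ φ‖ ≤ δ := by
      refine linfty_norm_le hδ0 ?_
      filter_upwards [Lp.coeFn_sub f (simpleLp ν ∞ φ), hfg, simpleLp_coeFn (m := ν) ∞ φ]
        with t h1 h2 h3
      rw [h1, Pi.sub_apply, h2, h3, norm_sub_rev]
      exact hφ t
    rw [← h.kappa_simpleLp, ← sub_apply, ← map_sub]
    calc _ ≤ ‖R.kappa ν (f - simpleLp ν ∞ φ)‖ * ‖k‖ := le_opNorm _ _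
      _ ≤ (‖R.kappa ν‖ * ‖f - simpleLp ν ∞ φ‖) * ‖k‖ := by gcongr; exact le_opNorm _ _
      _ ≤ (‖R.kappa ν‖ * δ) * ‖k‖ := by gcongr
      _ = _ := by ring
  have h2 : ‖R.simpleInt φ k - R.vectorMap k a‖ ≤ δ * c := by
    rw [← vectorMap_simpleLp, ← map_sub, norm_vectorMap, mul_comm]
    refine Lp.norm_le_of_ae_bound hδ0 ?_
    filter_upwards [Lp.coeFn_sub (simpleLp (R.meas k) 2 φ) a, hfa, hac.ae_le hfg,
      simpleLp_coeFn (m := R.meas k) 2 φ] with t h1 h2 h3 h4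
    rw [h1, Pi.sub_apply, h4, ← h2, h3]
    exact hφ t
  calc ‖R.kappa ν f k - R.vectorMap k a‖
      ≤ ‖R.kappa ν f k - R.simpleInt φ k‖ + ‖R.simpleInt φ k - R.vectorMap k a‖ :=
        norm_sub_le_norm_sub_add_norm_sub _ _ _
    _ ≤ δ * (‖R.kappa ν‖ * ‖k‖) + δ * c := add_le_add h1 h2
    _ = δ * C := by rw [hC]; ring
    _ ≤ δ * (C + 1) := by gcongr; linarith
    _ = 0 + ε := by rw [hδ, div_mul_cancel₀ _ hC0.ne', zero_add]

/-- A bounded function whose integral annihilates `k` vanishes `m_k`-almost everywhere. -/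
theorem Compat.ae_eq_zero_of_kappa_apply (h : R.Compat ν) {f : Lp ℂ ∞ ν} {k : K}
    (h0 : R.kappa ν f k = 0) :
    ∃ Δ, MeasurableSet Δ ∧ R.toFun Δ k = 0 ∧ ∀ᵐ t ∂ν, t ∉ Δ → f t = 0 := by
  obtain ⟨g, hgm, hgb, hfg⟩ := linfty_exists_rep f
  have hac := h.meas_absolutelyContinuous k
  have hmem : MemLp g 2 (R.meas k) :=
    MemLp.of_bound hgm.aestronglyMeasurable _ (Filter.Eventually.of_forall hgb)
  have hfa : f =ᵐ[R.meas k] hmem.toLp g := by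
    filter_upwards [hac.ae_le hfg, hmem.coeFn_toLp] with t h1 h2
    rw [h1, h2]
  rw [h.kappa_apply hfa, ← norm_eq_zero, norm_vectorMap, norm_eq_zero] at h0
  have hg0 : g =ᵐ[R.meas k] 0 := by
    have := hmem.coeFn_toLp
    rw [h0] at this
    exact this.symm.trans (Lp.coeFn_zero _ _ _)
  have hΔ : MeasurableSet {t | g t ≠ 0} := hgm (measurableSet_singleton 0).compl
  refine ⟨{t | g t ≠ 0}, hΔ, (R.meas_eq_zero_iff k hΔ).1 hg0, ?_⟩
  filter_upwards [hfg] with t ht hn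
  rw [ht]
  simpa using hn

theorem Compat.eq_zero_of_kappa_apply (h : R.Compat ν) {f : Lp ℂ ∞ ν} {k : K}
    (hk : ∀ Δ, MeasurableSet Δ → R.toFun Δ k = 0 → R.toFun Δ = 0)
    (h0 : R.kappa ν f k = 0) : f = 0 := by
  obtain ⟨Δ, hΔ, hΔk, hf⟩ := h.ae_eq_zero_of_kappa_apply h0
  have hν : ν Δ = 0 := (h Δ hΔ).2 (hk Δ hΔ hΔk)
  refine Lp.ext ?_
  have hnot : ∀ᵐ t ∂ν, t ∉ Δ := measure_eq_zero_iff_ae_notMem.1 hν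
  filter_upwards [hf, hnot, Lp.coeFn_zero ℂ ∞ ν] with t h1 h2 h3
  rw [h1 h2, h3]
  rfl

end PVM

end CPTomita

namespace CPTomita

open scoped ComplexOrder
open ContinuousLinearMap

/-! ### The von Neumann algebra generated by a projection-valued measure. -/

namespace PVM

variable {S : Type*} [MeasurableSpace S] {K : Type*} [NormedAddCommGroup K]
    [InnerProductSpace ℂ K] [CompleteSpace K] (R : PVM S K)

/-- The projections of a projection-valued measure. -/
def projections : Set (K →L[ℂ] K) := {p | ∃ Δ, MeasurableSet Δ ∧ R.toFun Δ = p}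

theorem mem_projections {Δ : Set S} (hΔ : MeasurableSet Δ) : R.toFun Δ ∈ R.projections :=
  ⟨Δ, hΔ, rfl⟩

/-- The von Neumann algebra generated by a projection-valued measure. -/
noncomputable def algebra : VonNeumannAlgebra K where
  toStarSubalgebra := StarSubalgebra.centralizer ℂ (Set.centralizer R.projections)
  centralizer_centralizer' := by simp

/-- `StarSubalgebra.centralizer` centralizes a set together with its adjoints; the projections are
self-adjoint, so their centralizer is already star-closed and the result is the plain bicommutant.
-/
theorem coe_algebra :
    (R.algebra : Set (K →L[ℂ] K)) = Set.centralizer (Set.centralizer R.projections) := by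
  change ((StarSubalgebra.centralizer ℂ (Set.centralizer R.projections) :
    StarSubalgebra ℂ (K →L[ℂ] K)) : Set (K →L[ℂ] K)) = _
  rw [StarSubalgebra.coe_centralizer]
  have hstar : ∀ p ∈ R.projections, star p = p := by
    rintro _ ⟨Δ, hΔ, rfl⟩
    exact R.star_eq hΔ
  have h1 : star (Set.centralizer R.projections) = Set.centralizer R.projections := by
    ext a
    rw [Set.mem_star, Set.mem_centralizer_iff, Set.mem_centralizer_iff]
    refine forall₂_congr fun p hp => ?_
    rw [← star_inj, star_mul, star_mul, star_star, hstar p hp, eq_comm]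
  rw [h1, Set.union_self]

theorem mem_algebra_iff {A : K →L[ℂ] K} :
    A ∈ R.algebra ↔ A ∈ Set.centralizer (Set.centralizer R.projections) := by
  rw [← coe_algebra]; rfl

theorem toFun_mem_algebra {Δ : Set S} (hΔ : MeasurableSet Δ) : R.toFun Δ ∈ R.algebra := by
  rw [mem_algebra_iff]
  exact Set.subset_centralizer_centralizer (R.mem_projections hΔ)

theorem algebra_commute {A B : K →L[ℂ] K} (hA : A ∈ R.algebra) (hB : B ∈ R.algebra) :
    A * B = B * A := by
  rw [mem_algebra_iff] at hA hB
  have h1 : R.projections ⊆ Set.centralizer R.projections := by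
    rintro _ ⟨Δ, hΔ, rfl⟩ _ ⟨Δ', hΔ', rfl⟩
    exact R.commute hΔ' hΔ
  have h2 : A ∈ Set.centralizer R.projections := Set.centralizer_subset h1 hA
  exact hB A h2

theorem isClosed_algebra : IsClosed (R.algebra : Set (K →L[ℂ] K)) := by
  rw [coe_algebra]
  exact Set.isClosed_centralizer _

theorem simpleInt_mem_algebra (φ : SimpleFunc S ℂ) : R.simpleInt φ ∈ R.algebra := by
  refine simpleFunc_induction (p := fun φ => R.simpleInt φ ∈ R.algebra)
    (fun Δ hΔ => ?_) (fun c φ h => ?_) (fun φ φ' h h' => ?_) φ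
  · rw [simpleInt_ind]; exact R.toFun_mem_algebra hΔ
  · rw [map_smul]; exact R.algebra.toStarSubalgebra.smul_mem h c
  · rw [map_add]; exact add_mem h h'

theorem Compat.kappa_mem_algebra {R : PVM S K} {ν : Measure S} [IsFiniteMeasure ν]
    (h : R.Compat ν) (f : Lp ℂ ∞ ν) : R.kappa ν f ∈ R.algebra := by
  refine denseRange_simpleLp_top.induction_on (p := fun f => R.kappa ν f ∈ R.algebra) f
    (R.isClosed_algebra.preimage (R.kappa ν).continuous) fun φ => ?_
  rw [h.kappa_simpleLp]
  exact R.simpleInt_mem_algebra φ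

/-- The closed subspace generated by a vector. -/
noncomputable def cyclic (k : K) : Submodule ℂ K :=
  (LinearMap.range (R.simpleIntApply k)).topologicalClosure

instance (k : K) : CompleteSpace (R.cyclic k) :=
  (Submodule.isClosed_topologicalClosure _).completeSpace_coe

theorem cyclic_induction {k : K} {p : K → Prop} (hp : IsClosed {l | p l})
    (h : ∀ φ, p (R.simpleInt φ k)) {l : K} (hl : l ∈ R.cyclic k) : p l := by
  refine closure_minimal ?_ hp hl
  rintro _ ⟨φ, rfl⟩
  exact h φ

theorem simpleInt_apply_mem_cyclic (φ : SimpleFunc S ℂ) (k : K) : R.simpleInt φ k ∈ R.cyclic k :=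
  Submodule.le_topologicalClosure _ ⟨φ, rfl⟩

theorem self_mem_cyclic (k : K) : k ∈ R.cyclic k := by
  simpa [simpleInt_one] using R.simpleInt_apply_mem_cyclic 1 k

/-- A projection whose range is invariant under a self-adjoint operator commutes with it. -/
theorem starProjection_commute_of_invariant {U : Submodule ℂ K} [U.HasOrthogonalProjection]
    {A : K →L[ℂ] K} (hA : star A = A) (hU : ∀ l ∈ U, A l ∈ U) :
    A * U.starProjection = U.starProjection * A := by
  have h1 : U.starProjection * (A * U.starProjection) = A * U.starProjection := by
    ext l
    exact Submodule.starProjection_eq_self_iff.2 (hU _ (Submodule.starProjection_apply_mem _ _))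
  have hs : star U.starProjection = U.starProjection :=
    (isStarProjection_starProjection (U := U)).isSelfAdjoint.star_eq
  have h2 := congrArg star h1
  rw [star_mul, star_mul, hs, hA, mul_assoc] at h2
  rw [← h1, h2]

theorem cyclicProjection_mem_centralizer (k : K) :
    (R.cyclic k).starProjection ∈ Set.centralizer R.projections := by
  rintro _ ⟨Δ, hΔ, rfl⟩
  refine starProjection_commute_of_invariant (R.star_eq hΔ) fun l hl => ?_
  refine R.cyclic_induction (p := fun l => R.toFun Δ l ∈ R.cyclic k)
    ((Submodule.isClosed_topologicalClosure _).preimage (R.toFun Δ).continuous) (fun φ => ?_) hl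
  have : R.toFun Δ (R.simpleInt φ k) = R.simpleInt (simpleInd Δ hΔ * φ) k := by
    rw [simpleInt_mul, simpleInt_ind]; rfl
  rw [this]
  exact R.simpleInt_apply_mem_cyclic _ _

theorem cyclicProjection_commute {A : K →L[ℂ] K} (hA : A ∈ R.algebra) (k l : K) :
    A ((R.cyclic k).starProjection l) = (R.cyclic k).starProjection (A l) := by
  rw [mem_algebra_iff] at hA
  exact (congrArg (fun B : K →L[ℂ] K => B l) (hA _ (R.cyclicProjection_mem_centralizer k))).symm

/-- The projection onto the cyclic space of `k` commutes with every `R(Δ)`, hence with `A`, and it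
fixes `k`. -/
theorem apply_mem_cyclic {A : K →L[ℂ] K} (hA : A ∈ R.algebra) (k : K) : A k ∈ R.cyclic k := by
  have h := R.cyclicProjection_commute hA k k
  rw [Submodule.starProjection_eq_self_iff.2 (R.self_mem_cyclic k)] at h
  exact Submodule.starProjection_eq_self_iff.1 h.symm

theorem exists_vectorMap_eq {k l : K} (hl : l ∈ R.cyclic k) : ∃ a, R.vectorMap k a = l := by
  let U : Lp ℂ 2 (R.meas k) →ₗᵢ[ℂ] K := ⟨(R.vectorMap k).toLinearMap, R.norm_vectorMap k⟩
  have hcl : IsClosed (Set.range U) := U.isometry.isUniformInducing.isComplete_range.isClosed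
  refine R.cyclic_induction (p := fun l => ∃ a, R.vectorMap k a = l) hcl (fun φ => ?_) hl
  exact ⟨_, R.vectorMap_simpleLp k φ⟩

theorem toFun_vectorMap (k : K) (Δ : Set S) (hΔ : MeasurableSet Δ) (a : Lp ℂ 2 (R.meas k)) :
    R.toFun Δ (R.vectorMap k a)
      = R.vectorMap k (mulOp (R.meas k) (simpleLp (R.meas k) ∞ (simpleInd Δ hΔ)) a) := by
  refine denseRange_simpleLp_two.induction_on (p := fun a => R.toFun Δ (R.vectorMap k a)
      = R.vectorMap k (mulOp (R.meas k) (simpleLp (R.meas k) ∞ (simpleInd Δ hΔ)) a)) a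
    (isClosed_eq (by fun_prop) (by fun_prop)) fun φ => ?_
  rw [← toL2_simpleLp, mulOp_toL2, ← simpleLp_mul, toL2_simpleLp, toL2_simpleLp,
    vectorMap_simpleLp, vectorMap_simpleLp, simpleInt_mul, simpleInt_ind]
  rfl

variable {R} {ν : Measure S} [IsFiniteMeasure ν]

/-- On every vector, an element of the generated algebra acts as a bounded function. -/
theorem Compat.exists_kappa_apply (h : R.Compat ν) {A : K →L[ℂ] K} (hA : A ∈ R.algebra) (k : K) :
    ∃ f, R.kappa ν f k = A k := by
  obtain ⟨a, ha⟩ := R.exists_vectorMap_eq (R.apply_mem_cyclic hA k)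
  -- `a ∈ L²(m_k)` represents `A k`. As `A` commutes with `R(Δ)`, `‖1_Δ a‖ = ‖A R(Δ) k‖ ≤ ‖A‖
  -- ‖1_Δ‖`, so `a` is bounded.
  obtain ⟨f, hf⟩ := exists_toL2_eq (a := a) (norm_nonneg A) (fun Δ hΔ => by
    rw [← R.norm_vectorMap, ← toFun_vectorMap, ha, ← R.norm_vectorMap k, vectorMap_simpleLp,
      simpleInt_ind]
    have : R.toFun Δ (A k) = A (R.toFun Δ k) :=
      congrArg (fun B : K →L[ℂ] K => B k) (R.algebra_commute (R.toFun_mem_algebra hΔ) hA)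
    rw [this]
    exact A.le_opNorm _)
  obtain ⟨g, hgm, hgb, hfg⟩ := linfty_exists_rep f
  have hmem : MemLp g ∞ ν :=
    memLp_top_of_bound hgm.aestronglyMeasurable _ (Filter.Eventually.of_forall hgb)
  refine ⟨hmem.toLp g, ?_⟩
  rw [← ha]
  refine h.kappa_apply ?_
  rw [← hf]
  filter_upwards [(h.meas_absolutelyContinuous k).ae_le hmem.coeFn_toLp, hfg, toL2_coeFn f]
    with t h1 h2 h3
  rw [h1, h3, h2]

/-- A countable separating family yields a single separating vector. -/
theorem Compat.exists_separating (h : R.Compat ν) {x : ℕ → K}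
    (hx : ∀ Δ, MeasurableSet Δ → (∀ n, R.toFun Δ (x n) = 0) → R.toFun Δ = 0) :
    ∃ k, ∀ Δ, MeasurableSet Δ → R.toFun Δ k = 0 → R.toFun Δ = 0 := by
  -- `D₀` is where the density of `m_{xₙ}` with respect to `ν` is nonzero: off `D₀` the vector `xₙ`
  -- is not seen, and within `D₀` it detects every set of positive `ν`-measure.
  have hsupp : ∀ n, ∃ D₀ : Set S, MeasurableSet D₀ ∧ R.toFun D₀ᶜ (x n) = 0 ∧
      ∀ Δ, MeasurableSet Δ → Δ ⊆ D₀ → R.toFun Δ (x n) = 0 → ν Δ = 0 := by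
    intro n
    have hd := Measure.withDensity_rnDeriv_eq _ _ (h.meas_absolutelyContinuous (x n))
    have hm := Measure.measurable_rnDeriv (R.meas (x n)) ν
    set d := (R.meas (x n)).rnDeriv ν
    have hD₀ : MeasurableSet {t | d t ≠ 0} := hm (measurableSet_singleton 0).compl
    have h0 : ∀ Δ, MeasurableSet Δ → (R.toFun Δ (x n) = 0 ↔ ν ({t | d t ≠ 0} ∩ Δ) = 0) := by
      intro Δ hΔ
      rw [← R.meas_eq_zero_iff _ hΔ, ← hd, withDensity_apply_eq_zero hm]
    refine ⟨_, hD₀, (h0 _ hD₀.compl).2 (by simp), fun Δ hΔ hsub hz => ?_⟩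
    rw [h0 Δ hΔ, Set.inter_eq_right.2 hsub] at hz
    exact hz
  choose D hDm hDc hDn using hsupp
  have hE : ∀ n, MeasurableSet (disjointed D n) := fun n => MeasurableSet.disjointed hDm n
  -- The `xₙ` are glued along the disjointed supports, where their contributions cannot cancel; the
  -- weights only make the series converge.
  set c : ℕ → ℝ := fun n => (1 / 2) ^ n / (1 + ‖x n‖) with hc
  have hc0 : ∀ n, 0 < c n := fun n => by positivity
  have hsum : Summable fun n => (c n : ℂ) • R.toFun (disjointed D n) (x n) := by
    refine Summable.of_norm_bounded (g := fun n => (1 / 2 : ℝ) ^ n) summable_geometric_two fun n => ?_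
    have h1 : ‖R.toFun (disjointed D n) (x n)‖ ≤ ‖x n‖ := by
      have := (R.toFun (disjointed D n)).le_opNorm (x n)
      refine this.trans ?_
      have h2 := (R.proj _ (hE n)).norm_le
      nlinarith [norm_nonneg (x n)]
    rw [norm_smul, Complex.norm_real, Real.norm_of_nonneg (hc0 n).le]
    calc c n * ‖R.toFun (disjointed D n) (x n)‖ ≤ c n * (1 + ‖x n‖) := by
          have := (hc0 n).le
          gcongr
          linarith
      _ = (1 / 2) ^ n := by rw [hc]; field_simp
  refine ⟨∑' n, (c n : ℂ) • R.toFun (disjointed D n) (x n), fun Δ hΔ h0 => ?_⟩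
  set k := ∑' n, (c n : ℂ) • R.toFun (disjointed D n) (x n) with hk
  have hEk : ∀ n, R.toFun (disjointed D n) k = (c n : ℂ) • R.toFun (disjointed D n) (x n) := by
    intro n
    have hm : ∀ i, R.toFun (disjointed D n) (R.toFun (disjointed D i) (x i))
        = R.toFun (disjointed D n ∩ disjointed D i) (x i) := by
      intro i
      rw [← R.mul_eq (hE n) (hE i)]
      rfl
    rw [hk, ContinuousLinearMap.map_tsum _ hsum, tsum_eq_single n]
    · rw [map_smul, hm, Set.inter_self]
    · intro i hi
      have : disjointed D n ∩ disjointed D i = ∅ :=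
        Set.disjoint_iff_inter_eq_empty.1 (disjoint_disjointed D hi.symm)
      rw [map_smul, hm, this, R.empty, zero_apply, smul_zero]
  have h1 : ∀ n, ν (Δ ∩ disjointed D n) = 0 := by
    intro n
    refine hDn n _ (hΔ.inter (hE n)) (Set.inter_subset_right.trans (disjointed_subset D n)) ?_
    have h2 : (c n : ℂ) • R.toFun (Δ ∩ disjointed D n) (x n) = 0 := by
      have e1 : R.toFun Δ (R.toFun (disjointed D n) (x n))
          = R.toFun (Δ ∩ disjointed D n) (x n) := by
        rw [← R.mul_eq hΔ (hE n)]; rfl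
      have e2 : R.toFun Δ (R.toFun (disjointed D n) k) = R.toFun (disjointed D n) (R.toFun Δ k) :=
        congrArg (fun B : K →L[ℂ] K => B k) (R.commute hΔ (hE n))
      rw [← e1, ← map_smul, ← hEk, e2, h0, map_zero]
    exact (smul_eq_zero.1 h2).resolve_left (by exact_mod_cast (hc0 n).ne')
  have hU : MeasurableSet (⋃ n, D n) := MeasurableSet.iUnion hDm
  have h2 : ν (Δ ∩ (⋃ n, D n)ᶜ) = 0 := by
    rw [h _ (hΔ.inter hU.compl)]
    refine hx _ (hΔ.inter hU.compl) fun n => ?_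
    have hsub : Δ ∩ (⋃ n, D n)ᶜ = (Δ ∩ (⋃ n, D n)ᶜ) ∩ (D n)ᶜ := by
      rw [Set.inter_assoc, Set.inter_eq_left.2 (Set.compl_subset_compl.2 (Set.subset_iUnion D n))]
    rw [hsub, ← R.mul_eq (hΔ.inter hU.compl) (hDm n).compl, mul_def, comp_apply, hDc, map_zero]
  rw [← h Δ hΔ]
  have h3 : Δ = (⋃ n, Δ ∩ disjointed D n) ∪ (Δ ∩ (⋃ n, D n)ᶜ) := by
    rw [← Set.inter_iUnion, iUnion_disjointed, Set.inter_union_compl]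
  rw [h3]
  exact measure_union_null (measure_iUnion_null h1) h2

/-- The integral maps `L^∞(ν)` onto the generated von Neumann algebra. -/
theorem Compat.exists_kappa_eq (h : R.Compat ν) {x : ℕ → K}
    (hx : ∀ Δ, MeasurableSet Δ → (∀ n, R.toFun Δ (x n) = 0) → R.toFun Δ = 0)
    {A : K →L[ℂ] K} (hA : A ∈ R.algebra) : ∃ f, R.kappa ν f = A := by
  obtain ⟨k, hk⟩ := h.exists_separating hx
  obtain ⟨f, hf⟩ := h.exists_kappa_apply hA k
  -- `C = A - κ(f)` kills the separating vector `k`, hence its cyclic space. For `l₂` orthogonal to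
  -- that space, some `κ(g)` agrees with `C` at `k + l₂`; projecting to the cyclic space gives `κ(g)
  -- k = 0`, so `g = 0` and `C l₂ = 0`.
  refine ⟨f, ?_⟩
  rw [eq_comm, ← sub_eq_zero]
  set C := A - R.kappa ν f with hC
  have hCmem : C ∈ R.algebra := sub_mem hA (h.kappa_mem_algebra f)
  have hCk : C k = 0 := by rw [hC, sub_apply, hf, sub_self]
  have hcyc : ∀ l ∈ R.cyclic k, C l = 0 := by
    intro l hl
    refine R.cyclic_induction (p := fun l => C l = 0)
      (isClosed_eq C.continuous continuous_const) (fun φ => ?_) hl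
    have : C (R.simpleInt φ k) = R.simpleInt φ (C k) :=
      congrArg (fun B : K →L[ℂ] K => B k) (R.algebra_commute hCmem (R.simpleInt_mem_algebra φ))
    rw [this, hCk, map_zero]
  set P := (R.cyclic k).starProjection with hP
  ext l
  set l₂ := l - P l with hl₂
  have hPl₂ : P l₂ = 0 := by
    rw [hl₂, map_sub, hP, Submodule.starProjection_eq_self_iff.2
      (Submodule.starProjection_apply_mem _ l), sub_self]
  obtain ⟨g, hg⟩ := h.exists_kappa_apply hCmem (k + l₂)
  rw [map_add, map_add, hCk, zero_add] at hg
  have hgk : R.kappa ν g k = 0 := by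
    have h1 := congrArg P hg
    rw [map_add, hP, ← R.cyclicProjection_commute (h.kappa_mem_algebra g),
      ← R.cyclicProjection_commute (h.kappa_mem_algebra g),
      ← R.cyclicProjection_commute hCmem, ← hP, hPl₂, map_zero, map_zero, add_zero, hP,
      Submodule.starProjection_eq_self_iff.2 (R.self_mem_cyclic k)] at h1
    exact h1
  have hg0 : g = 0 := h.eq_zero_of_kappa_apply hk hgk
  have hCl₂ : C l₂ = 0 := by
    rw [← hg, hg0]
    simp
  have : l = P l + l₂ := by rw [hl₂]; abel
  rw [this, map_add, hCl₂, hcyc _ (Submodule.starProjection_apply_mem _ _), zero_apply, add_zero]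

theorem Compat.kappa_injective (h : R.Compat ν) : Function.Injective (R.kappa ν) := by
  rw [injective_iff_map_eq_zero]
  intro f hf
  obtain ⟨g, hgm, hgb, hfg⟩ := linfty_exists_rep f
  have hΔ : MeasurableSet {t | g t ≠ 0} := hgm (measurableSet_singleton 0).compl
  have hz : R.toFun {t | g t ≠ 0} = 0 := by
    ext k
    rw [zero_apply]
    obtain ⟨Δ, hΔm, hΔk, hae⟩ := h.ae_eq_zero_of_kappa_apply (f := f) (k := k) (by rw [hf, zero_apply])
    rw [← R.meas_eq_zero_iff k hΔ]
    have hac := h.meas_absolutelyContinuous k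
    have hnot : ∀ᵐ t ∂(R.meas k), t ∉ Δ :=
      measure_eq_zero_iff_ae_notMem.1 ((R.meas_eq_zero_iff k hΔm).2 hΔk)
    rw [measure_eq_zero_iff_ae_notMem]
    filter_upwards [hnot, hac.ae_le hae, hac.ae_le hfg] with t h1 h2 h3
    simp only [Set.mem_setOf_eq, not_not]
    rw [← h3, h2 h1]
  have hν := (h _ hΔ).2 hz
  refine Lp.ext ?_
  filter_upwards [hfg, measure_eq_zero_iff_ae_notMem.1 hν, Lp.coeFn_zero ℂ ∞ ν] with t h1 h2 h3
  rw [h1, h3]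
  simpa using h2

theorem Compat.range_kappa (h : R.Compat ν) {x : ℕ → K}
    (hx : ∀ Δ, MeasurableSet Δ → (∀ n, R.toFun Δ (x n) = 0) → R.toFun Δ = 0) :
    Set.range (R.kappa ν) = (R.algebra : Set (K →L[ℂ] K)) := by
  ext A
  constructor
  · rintro ⟨f, rfl⟩
    exact h.kappa_mem_algebra f
  · exact fun hA => h.exists_kappa_eq hx hA

/-- Every projection in the range of the integral is a value of the measure. -/
theorem Compat.exists_toFun_eq (h : R.Compat ν) {f : Lp ℂ ∞ ν}
    (hf : IsStarProjection (R.kappa ν f)) :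
    ∃ Δ, MeasurableSet Δ ∧ R.toFun Δ = R.kappa ν f := by
  have h1 : linftyMul f f = f := h.kappa_injective (by
    rw [h.kappa_mul]; exact hf.isIdempotentElem)
  have hm : Measurable f := (Lp.stronglyMeasurable f).measurable
  -- By injectivity of `κ`, `f² = f`, so `f` takes only the values `0` and `1` almost everywhere.
  have hΔ : MeasurableSet {t | f t = 1} := hm (measurableSet_singleton 1)
  refine ⟨_, hΔ, ?_⟩
  rw [← h.kappa_ind _ hΔ]
  congr 1
  refine Lp.ext ?_
  have h2 := linftyMul_coeFn f f
  rw [h1] at h2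
  filter_upwards [h2, simpleLp_coeFn (m := ν) ∞ (simpleInd {t | f t = 1} hΔ)] with t h3 h4
  rw [h4, simpleInd_apply]
  by_cases h5 : f t = 1
  · rw [Set.indicator_of_mem (by exact h5), h5]; rfl
  · rw [Set.indicator_of_notMem (by exact h5)]
    have h6 : f t * (1 - f t) = 0 := by rw [mul_sub, mul_one, ← h3, sub_self]
    rcases mul_eq_zero.1 h6 with h7 | h7
    · exact h7.symm
    · exact absurd (sub_eq_zero.1 h7).symm h5

end PVM

end CPTomita

namespace CPTomita

open scoped ComplexOrder
open ContinuousLinearMap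

/-! ### Projection-valued measures from weak additivity. -/

section WeakPVM

variable {S : Type*} [MeasurableSpace S] {K : Type*} [NormedAddCommGroup K]
    [InnerProductSpace ℂ K] [CompleteSpace K]

theorem finitelyAdditive_biUnion {R : Set S → K →L[ℂ] K}
    (hunion : ∀ Δ Δ', MeasurableSet Δ → MeasurableSet Δ' → Disjoint Δ Δ' →
      R (Δ ∪ Δ') = R Δ + R Δ')
    {Δ : ℕ → Set S} (hΔ : ∀ i, MeasurableSet (Δ i))
    (hd : Pairwise fun i j => Disjoint (Δ i) (Δ j)) (F : Finset ℕ) :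
    R (⋃ i ∈ F, Δ i) = ∑ i ∈ F, R (Δ i) := by
  induction F using Finset.induction_on with
  | empty =>
    have := hunion ∅ ∅ .empty .empty (by simp)
    simpa using this
  | insert i F hi ih =>
    rw [Finset.sum_insert hi, Finset.set_biUnion_insert, hunion _ _ (hΔ i)
      (Finset.measurableSet_biUnion F fun j _ => hΔ j), ih]
    rw [Set.disjoint_iUnion₂_right]
    intro j hj
    exact hd fun h => hi (h ▸ hj)

/-- A finitely additive projection-valued set function that is weakly countably additive on a dense
set of vectors is a projection-valued measure. -/
noncomputable def PVM.ofWeak (R : Set S → K →L[ℂ] K)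
    (proj : ∀ Δ, MeasurableSet Δ → IsStarProjection (R Δ)) (univ : R Set.univ = 1)
    (union : ∀ Δ Δ', MeasurableSet Δ → MeasurableSet Δ' → Disjoint Δ Δ' →
      R (Δ ∪ Δ') = R Δ + R Δ') (D : Set K) (hD : Dense D)
    (weak : ∀ Δ : ℕ → Set S, (∀ i, MeasurableSet (Δ i)) →
      Pairwise (fun i j => Disjoint (Δ i) (Δ j)) →
      ∀ k ∈ D, HasSum (fun i => ⟪k, R (Δ i) k⟫_ℂ) ⟪k, R (⋃ i, Δ i) k⟫_ℂ) : PVM S K where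
  toFun := R
  proj := proj
  univ := univ
  union := union
  hasSum Δ hΔ hd k := by
    have hU : MeasurableSet (⋃ i, Δ i) := MeasurableSet.iUnion hΔ
    -- The tails are projections, so `⟪l, Q_F l⟫ = ‖Q_F l‖²` turns weak convergence on `D` into norm
    -- convergence, and `‖Q_F‖ ≤ 1` carries it to all vectors.
    let Q : Finset ℕ → K →L[ℂ] K := fun F => R ((⋃ i, Δ i) \ ⋃ i ∈ F, Δ i)
    have hF : ∀ F : Finset ℕ, MeasurableSet (⋃ i ∈ F, Δ i) :=
      fun F => Finset.measurableSet_biUnion F fun j _ => hΔ j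
    have hQp : ∀ F, IsStarProjection (Q F) := fun F => proj _ (hU.diff (hF F))
    have hQ : ∀ F, R (⋃ i, Δ i) = Q F + ∑ i ∈ F, R (Δ i) := by
      intro F
      rw [← finitelyAdditive_biUnion union hΔ hd F, ← union _ _ (hU.diff (hF F)) (hF F)
        Set.disjoint_sdiff_left, Set.diff_union_of_subset (Set.iUnion₂_subset fun i _ =>
          Set.subset_iUnion Δ i)]
    have hQD : ∀ l ∈ D, Filter.Tendsto (fun F => Q F l) Filter.atTop (nhds 0) := by
      intro l hl
      have h1 := (weak Δ hΔ hd l hl).const_sub ⟪l, R (⋃ i, Δ i) l⟫_ℂ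
      rw [sub_self] at h1
      have h2 : ∀ F : Finset ℕ, ⟪l, R (⋃ i, Δ i) l⟫_ℂ - ∑ i ∈ F, ⟪l, R (Δ i) l⟫_ℂ
          = ((‖Q F l‖ ^ 2 : ℝ) : ℂ) := by
        intro F
        rw [← (hQp F).inner_apply_self, hQ F, add_apply, sum_apply, inner_add_right, inner_sum]
        ring
      simp_rw [h2] at h1
      have h3 := (Complex.continuous_re.tendsto _).comp h1
      simp only [Function.comp_def, Complex.ofReal_re, Complex.zero_re] at h3
      rw [tendsto_zero_iff_norm_tendsto_zero]
      have h4 := (Real.continuous_sqrt.tendsto _).comp h3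
      simpa [Function.comp_def, Real.sqrt_sq (norm_nonneg _)] using h4
    have hQk : Filter.Tendsto (fun F => Q F k) Filter.atTop (nhds 0) := by
      rw [Metric.tendsto_nhds]
      intro ε hε
      obtain ⟨l, hkl, hl⟩ := Metric.dense_iff.1 hD k (ε / 2) (by positivity)
      filter_upwards [Metric.tendsto_nhds.1 (hQD l hl) (ε / 2) (by positivity)] with F hFl
      rw [dist_zero_right] at hFl ⊢
      rw [Metric.mem_ball, dist_comm, dist_eq_norm] at hkl
      have h5 : Q F k = Q F (k - l) + Q F l := by rw [map_sub]; abel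
      have h6 : ‖Q F (k - l)‖ ≤ ‖k - l‖ := by
        refine ((Q F).le_opNorm _).trans ?_
        have := (hQp F).norm_le
        nlinarith [norm_nonneg (k - l)]
      rw [h5]
      linarith [norm_add_le (Q F (k - l)) (Q F l)]
    have h7 := hQk.const_sub (R (⋃ i, Δ i) k)
    rw [sub_zero] at h7
    refine h7.congr fun F => ?_
    rw [hQ F, add_apply, sum_apply]
    abel

end WeakPVM

/-! ### Orthogonal CP-measure spaces as projection-valued measures. -/

section Spaces

variable {X : Type u} [CStarAlgebra X] [PartialOrder X] [StarOrderedRing X]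
variable {H : Type v} [NormedAddCommGroup H] [InnerProductSpace ℂ H] [CompleteSpace H]
variable {M : VonNeumannAlgebra H} {T : CPMap X M}

theorem CPMeasure.complexMeasure_apply {S : Type s} [MeasurableSpace S] (μ : CPMeasure X M S)
    (ρ : NormalFunctional M) (x : X) {Δ : Set S} (hΔ : MeasurableSet Δ) :
    μ.complexMeasure ρ x Δ = ρ.1 ((μ.toFun ⟨Δ, hΔ⟩).app x) := by
  classical
  change (if h : MeasurableSet Δ then ρ.1 ((μ.toFun ⟨Δ, h⟩).app x) else 0 : ℂ) = _
  rw [dif_pos hΔ]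

theorem CPMeasure.toFun_union {S : Type s} [MeasurableSpace S] (μ : CPMeasure X M S)
    {Δ Δ' : Set S} (hΔ : MeasurableSet Δ) (hΔ' : MeasurableSet Δ') (hd : Disjoint Δ Δ') (x : X) :
    (μ.toFun ⟨Δ ∪ Δ', hΔ.union hΔ'⟩).1 x = (μ.toFun ⟨Δ, hΔ⟩).1 x + (μ.toFun ⟨Δ', hΔ'⟩).1 x := by
  refine NormalFunctional.ext_of_forall (A := (μ.toFun ⟨Δ ∪ Δ', hΔ.union hΔ'⟩).app x)
    (B := (μ.toFun ⟨Δ, hΔ⟩).app x + (μ.toFun ⟨Δ', hΔ'⟩).app x) fun ρ => ?_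
  rw [map_add, ← complexMeasure_apply, ← complexMeasure_apply, ← complexMeasure_apply]
  exact VectorMeasure.of_union hd hΔ hΔ'

theorem CPSpace.add_compl (E : CPSpace.{u, v, s} T) {Δ : Set E.S} (hΔ : MeasurableSet Δ) (x : X) :
    T.1 x = (E.μ.toFun ⟨Δ, hΔ⟩).1 x + (E.μ.toFun ⟨Δᶜ, hΔ.compl⟩).1 x := by
  rw [← E.μ.toFun_union hΔ hΔ.compl disjoint_compl_right]
  conv_lhs => rw [← E.barycenter]
  congr 3
  exact Subtype.ext (Set.union_compl_self Δ).symm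

variable {K : Type w} [NormedAddCommGroup K] [InnerProductSpace ℂ K] [CompleteSpace K]
variable (σ : MinimalStinespring T K)

theorem CPSpace.exists_density (E : CPSpace.{u, v, s} T) {Δ : Set E.S} (hΔ : MeasurableSet Δ) :
    ∃ R : K →L[ℂ] K, 0 ≤ R ∧ R ≤ 1 ∧ σ.IsDensity (fun x => (E.μ.toFun ⟨Δ, hΔ⟩).1 x) R :=
  MinimalStinespring.exists_density (D := (E.μ.toFun ⟨Δᶜ, hΔ.compl⟩).1) fun x => by
    rw [E.add_compl hΔ, add_sub_cancel_left]

variable {σ}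

theorem MinimalStinespring.IsDensity.cpMap_le {S S' : CPMap X M} {R R' : K →L[ℂ] K}
    (h : σ.IsDensity (fun x => S.1 x) R) (h' : σ.IsDensity (fun x => S'.1 x) R') (hR : R ≤ R') :
    CPMap.LE S S' := by
  have h1 := h'.sub h
  have h2 := h1.isRelative fun x => sub_mem (S'.2 x) (S.2 x)
  obtain ⟨D, hD⟩ := exists_cpMap_of_nonneg (sub_nonneg.2 hR) h2.1 h2.2
  exact ⟨D, fun x => (h1.2 x).trans (hD.2 x).symm⟩

theorem MinimalStinespring.IsDensity.le_of_cpMap_le {S S' : CPMap X M} {R R' : K →L[ℂ] K}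
    (h : σ.IsDensity (fun x => S.1 x) R) (h' : σ.IsDensity (fun x => S'.1 x) R')
    (hle : CPMap.LE S S') : R ≤ R' := by
  obtain ⟨D, hD⟩ := hle
  have h1 := h'.sub h
  rw [← sub_nonneg]
  refine clm_nonneg_of_dense σ.denseRange_assemble fun f => ?_
  have e : ⟪σ.assemble f, (R' - R) (σ.assemble f)⟫_ℂ = cpForm D.1.toLinearMap f f := by
    simp only [assemble_apply, Finsupp.sum, sum_inner, inner_sum, cpForm_apply, map_sum]
    rw [Finset.sum_comm]
    refine Finset.sum_congr rfl fun x _ => Finset.sum_congr rfl fun y _ => ?_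
    rw [h1.inner_eq x y]
    change ⟪f x, (S'.1 _ - S.1 _) (f y)⟫_ℂ = _
    rw [hD]
    rfl
  rw [e]
  exact cpForm_self_nonneg _ _

theorem MinimalStinespring.IsDensity.cpMap_ext {S S' : CPMap X M} {R : K →L[ℂ] K}
    (h : σ.IsDensity (fun x => S.1 x) R) (h' : σ.IsDensity (fun x => S'.1 x) R) : S = S' := by
  refine Subtype.ext (DFunLike.ext _ _ fun x => ?_)
  exact (h.2 x).trans (h'.2 x).symm

/-- `R (1 - R) = (1 - R) R (1 - R) + R (1 - R) R` is positive, lies below both `R` and `1 - R`, and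
is relative as a product. It is thus the density of a map below `S` and `S'`, which orthogonality
makes zero. -/
theorem isStarProjection_of_orthogonal {S S' : CPMap X M} {R : K →L[ℂ] K} (h0 : 0 ≤ R)
    (h1 : R ≤ 1) (hR : σ.IsDensity (fun x => S.1 x) R)
    (hR' : σ.IsDensity (fun x => S'.1 x) (1 - R))
    (ho : CPMap.Orthogonal S S') : IsStarProjection R := by
  have hsa : star R = R := (IsSelfAdjoint.of_nonneg h0).star_eq
  have hsa' : star (1 - R) = 1 - R := by rw [star_sub, star_one, hsa]
  have h1' : 0 ≤ 1 - R := sub_nonneg.2 h1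
  have hpos : 0 ≤ R * (1 - R) := by
    have h2 := star_left_conjugate_nonneg h0 (1 - R)
    have h3 := star_left_conjugate_nonneg h1' R
    rw [hsa'] at h2
    rw [hsa] at h3
    have e : R * (1 - R) = (1 - R) * R * (1 - R) + R * (1 - R) * R := by noncomm_ring
    rw [e]
    exact add_nonneg h2 h3
  have hle : R * (1 - R) ≤ R := by
    rw [← sub_nonneg]
    have e : R - R * (1 - R) = star R * R := by rw [hsa]; noncomm_ring
    rw [e]
    exact star_mul_self_nonneg R
  have hle' : R * (1 - R) ≤ 1 - R := by
    rw [← sub_nonneg]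
    have e : 1 - R - R * (1 - R) = star (1 - R) * (1 - R) := by rw [hsa']; noncomm_ring
    rw [e]
    exact star_mul_self_nonneg _
  have hrel := (hR.isRelative S.2).mul (hR'.isRelative S'.2)
  obtain ⟨D, hD⟩ := MinimalStinespring.exists_cpMap_of_nonneg hpos hrel.1 hrel.2
  have hz := ho D (hD.cpMap_le hR hle) (hD.cpMap_le hR' hle')
  have hz' : R * (1 - R) = 0 := hD.unique
    ⟨fun x => by rw [zero_mul, mul_zero], fun x => (hz x).trans (by rw [zero_mul]; ext; simp)⟩
  refine ⟨?_, hsa⟩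
  rw [mul_sub, mul_one, sub_eq_zero] at hz'
  exact hz'.symm

/-- The sum of two completely positive maps. -/
noncomputable def addCP (A B : X →CP (H →L[ℂ] H)) : X →CP (H →L[ℂ] H) where
  toLinearMap := A.toLinearMap + B.toLinearMap
  map_cstarMatrix_nonneg' k a ha := by
    have h1 := A.map_cstarMatrix_nonneg' k a ha
    have h2 := B.map_cstarMatrix_nonneg' k a ha
    exact add_nonneg h1 h2

theorem eq_zero_of_le_projection {Q R : K →L[ℂ] K} (hQ : 0 ≤ Q) (hR : IsStarProjection R)
    (h1 : Q ≤ R) (h2 : Q ≤ 1 - R) : Q = 0 := by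
  have hsa : star R = R := hR.isSelfAdjoint.star_eq
  have hi : R * R = R := hR.isIdempotentElem
  have hsa' : star (1 - R) = 1 - R := by rw [star_sub, star_one, hsa]
  obtain ⟨b, rfl⟩ := exists_eq_star_mul_self hQ
  have h3 : b * R = 0 := by
    rw [← CStarRing.star_mul_self_eq_zero_iff]
    refine le_antisymm ?_ (star_mul_self_nonneg _)
    have := star_left_conjugate_le_conjugate h2 R
    have e : star R * (1 - R) * R = 0 := by
      rw [hsa, mul_sub, mul_one, hi, sub_self, zero_mul]
    rw [e] at this
    rwa [star_mul, mul_assoc, ← mul_assoc (star b), ← mul_assoc]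
  have h4 : b * (1 - R) = 0 := by
    rw [← CStarRing.star_mul_self_eq_zero_iff]
    refine le_antisymm ?_ (star_mul_self_nonneg _)
    have := star_left_conjugate_le_conjugate h1 (1 - R)
    have e : star (1 - R) * R * (1 - R) = 0 := by
      rw [hsa', sub_mul, one_mul, hi, sub_self, zero_mul]
    rw [e] at this
    rwa [star_mul, mul_assoc, ← mul_assoc (star b), ← mul_assoc]
  rw [mul_sub, mul_one, h3, sub_zero] at h4
  rw [h4, mul_zero]

/-- A map below `S ≤ T` has a density `Q`; then `Q ≤ R` and `Q ≤ 1 - R`, which is impossible for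
nonzero `Q ≥ 0` when `R` is a projection. -/
theorem orthogonal_of_isStarProjection {S S' : CPMap X M} {R : K →L[ℂ] K}
    (hp : IsStarProjection R) (hR : σ.IsDensity (fun x => S.1 x) R)
    (hR' : σ.IsDensity (fun x => S'.1 x) (1 - R)) (hT : CPMap.LE S T) :
    CPMap.Orthogonal S S' := by
  intro D hDS hDS' x
  obtain ⟨C, hC⟩ := hT
  obtain ⟨B, hB⟩ := hDS
  obtain ⟨Q, hQ0, -, hQ⟩ := MinimalStinespring.exists_density (σ := σ) (S := D.1)
    (D := addCP B.1 C.1) (fun x => by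
      change _ = B.1 x + C.1 x
      rw [← hB, ← hC]; abel)
  have h1 : Q ≤ R := MinimalStinespring.IsDensity.le_of_cpMap_le hQ hR ⟨B, hB⟩
  have h2 : Q ≤ 1 - R := MinimalStinespring.IsDensity.le_of_cpMap_le hQ hR' hDS'
  have hz : Q = 0 := eq_zero_of_le_projection hQ0 hp h1 h2
  rw [hQ.2, hz, zero_mul]
  ext; simp

variable (σ) in
/-- An orthogonal CP-measure space is given by a projection-valued measure. -/
theorem OrthSpace.exists_pvm (E : OrthSpace.{u, v, s} T) :
    ∃ R : PVM E.1.S K, ∀ (Δ : Set E.1.S) (hΔ : MeasurableSet Δ),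
      σ.IsDensity (fun x => (E.1.μ.toFun ⟨Δ, hΔ⟩).1 x) (R.toFun Δ) := by
  classical
  choose! R hR0 hR1 hR using fun (Δ : Set E.1.S) (hΔ : MeasurableSet Δ) => E.1.exists_density σ hΔ
  have hadd : ∀ Δ Δ', MeasurableSet Δ → MeasurableSet Δ' → Disjoint Δ Δ' →
      R (Δ ∪ Δ') = R Δ + R Δ' := by
    intro Δ Δ' hΔ hΔ' hd
    refine (hR _ (hΔ.union hΔ')).unique ?_
    have h := (hR Δ hΔ).add (hR Δ' hΔ')
    refine ⟨h.1, fun x => ?_⟩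
    change (E.1.μ.toFun ⟨Δ ∪ Δ', hΔ.union hΔ'⟩).1 x = _
    rw [E.1.μ.toFun_union hΔ hΔ' hd, ← h.2]
  have huniv : R Set.univ = 1 := by
    refine (hR _ .univ).unique ?_
    have h := σ.isDensity_one
    rw [E.1.barycenter]
    exact h
  have hproj : ∀ Δ, MeasurableSet Δ → IsStarProjection (R Δ) := by
    intro Δ hΔ
    have hc : R Δᶜ = 1 - R Δ := by
      rw [← huniv, ← Set.union_compl_self Δ, hadd _ _ hΔ hΔ.compl disjoint_compl_right,
        add_sub_cancel_left]
    refine isStarProjection_of_orthogonal (hR0 Δ hΔ) (hR1 Δ hΔ) (hR Δ hΔ) ?_ (E.2 Δ hΔ)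
    rw [← hc]
    exact hR _ hΔ.compl
  -- On the dense range of `assemble`, matrix coefficients of `R(Δ)` are finite sums of vector
  -- functionals of `μ(Δ)`, and these are normal.
  refine ⟨PVM.ofWeak R hproj huniv hadd _ σ.denseRange_assemble ?_, hR⟩
  rintro Δ hΔ hd _ ⟨f, rfl⟩
  simp only [MinimalStinespring.assemble_apply, Finsupp.sum, sum_inner, inner_sum, map_sum]
  refine hasSum_sum fun x _ => hasSum_sum fun y _ => ?_
  simp_rw [fun i => (hR (Δ i) (hΔ i)).inner_eq, (hR _ (MeasurableSet.iUnion hΔ)).inner_eq]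
  have h := E.1.μ.hasSum_iUnion (fun i => ⟨Δ i, hΔ i⟩) hd (NormalFunctional.vector M (f y) (f x))
    (star y * x)
  simp_rw [NormalFunctional.vector_apply] at h
  exact h

variable (σ) in
/-- The projection-valued measure of an orthogonal CP-measure space. -/
noncomputable def OrthSpace.pvm (E : OrthSpace.{u, v, s} T) : PVM E.1.S K :=
  (E.exists_pvm σ).choose

theorem OrthSpace.isDensity_pvm (E : OrthSpace.{u, v, s} T) {Δ : Set E.1.S}
    (hΔ : MeasurableSet Δ) :
    σ.IsDensity (fun x => (E.1.μ.toFun ⟨Δ, hΔ⟩).1 x) ((E.pvm σ).toFun Δ) :=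
  (E.exists_pvm σ).choose_spec Δ hΔ

theorem OrthSpace.isRelative_pvm (E : OrthSpace.{u, v, s} T) {Δ : Set E.1.S}
    (hΔ : MeasurableSet Δ) : σ.IsRelative ((E.pvm σ).toFun Δ) :=
  (E.isDensity_pvm hΔ).isRelative (E.1.μ.toFun ⟨Δ, hΔ⟩).2

theorem OrthSpace.algebra_subset (E : OrthSpace.{u, v, s} T) :
    ((E.pvm σ).algebra : Set (K →L[ℂ] K)) ⊆ σ.relativeCommutant := by
  obtain ⟨G, hG⟩ := σ.exists_relativeCommutant_eq_centralizer
  rw [hG, PVM.coe_algebra, ← Set.centralizer_centralizer_centralizer G]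
  refine Set.centralizer_subset (Set.centralizer_subset ?_)
  rw [← hG]
  rintro _ ⟨Δ, hΔ, rfl⟩
  exact MinimalStinespring.mem_relativeCommutant_iff.2 (E.isRelative_pvm hΔ)

end Spaces

end CPTomita

namespace CPTomita

open scoped ComplexOrder
open ContinuousLinearMap

/-! ### Integrals against complex measures as functionals on `L^∞`. -/

section Integral

variable {S : Type*} [MeasurableSpace S]

instance isFiniteMeasure_variation (m : ComplexMeasure S) : IsFiniteMeasure m.variation := by
  refine isFiniteMeasure_of_le (m.re.totalVariation + m.im.totalVariation) ?_
  refine VectorMeasure.variation_le_of_forall_enorm_le fun Δ hΔ => ?_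
  have h1 : m Δ = ((m.re Δ : ℝ) : ℂ) + ((m.im Δ : ℝ) : ℂ) * Complex.I := (Complex.re_add_im _).symm
  rw [h1, Measure.add_apply]
  refine (enorm_add_le _ _).trans (add_le_add ?_ ?_)
  · refine le_of_eq_of_le ?_ (SignedMeasure.enorm_le_totalVariation _ _)
    rw [← ofReal_norm_eq_enorm, ← ofReal_norm_eq_enorm, Complex.norm_real]
  · refine le_of_eq_of_le ?_ (SignedMeasure.enorm_le_totalVariation _ _)
    rw [← ofReal_norm_eq_enorm, ← ofReal_norm_eq_enorm, norm_mul, Complex.norm_I, mul_one,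
      Complex.norm_real]

/-- Both sides are continuous in `f`, the integral because `m` has finite variation dominated by
`ν`, so agreement on simple functions suffices. -/
theorem integral_eq_of_indicator {ν : Measure S} [IsFiniteMeasure ν] {m : ComplexMeasure S}
    (hm : m.variation ≪ ν) (L : Lp ℂ ∞ ν →L[ℂ] ℂ)
    (hL : ∀ Δ hΔ, L (simpleLp ν ∞ (simpleInd Δ hΔ)) = m Δ) (f : Lp ℂ ∞ ν) :
    L f = m.integral (fun t => f t) (ContinuousLinearMap.mul ℝ ℂ) := by
  have hInt : ∀ f : Lp ℂ ∞ ν, m.Integrable (fun t => f t) := by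
    intro f
    refine Integrable.of_bound ((Lp.aestronglyMeasurable f).mono_ac hm) ‖f‖
      (hm.ae_le (linfty_ae_norm_le f))
  have hcont : Continuous fun f : Lp ℂ ∞ ν =>
      m.integral (fun t => f t) (ContinuousLinearMap.mul ℝ ℂ) := by
    refine (LipschitzWith.of_dist_le_mul
      (K := ⟨‖ContinuousLinearMap.mul ℝ ℂ‖ * m.variation.real Set.univ, by positivity⟩)
      fun f g => ?_).continuous
    rw [dist_eq_norm, dist_eq_norm, ← VectorMeasure.integral_fun_sub (hInt f) (hInt g)]
    refine (VectorMeasure.norm_integral_le_of_norm_le_const (C := ‖f - g‖) ?_).trans_eq ?_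
    · filter_upwards [hm.ae_le (linfty_ae_norm_le (f - g)), hm.ae_le (Lp.coeFn_sub f g)] with t h1 h2
      rwa [h2] at h1
    · rw [mul_assoc, mul_comm]; rfl
  refine denseRange_simpleLp_top.induction_on (p := fun f : Lp ℂ ∞ ν =>
    L f = m.integral (fun t => f t) (ContinuousLinearMap.mul ℝ ℂ)) f
    (isClosed_eq L.continuous hcont) fun φ => ?_
  have hsimp : ∀ φ : SimpleFunc S ℂ, m.integral (fun t => simpleLp ν ∞ φ t)
      (ContinuousLinearMap.mul ℝ ℂ) = m.integral φ (ContinuousLinearMap.mul ℝ ℂ) := fun φ =>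
    VectorMeasure.integral_congr_ae (hm.ae_le (simpleLp_coeFn ∞ φ))
  rw [hsimp]
  refine SimpleFunc.induction (motive := fun φ =>
    L (simpleLp ν ∞ φ) = m.integral φ (ContinuousLinearMap.mul ℝ ℂ)) (fun c Δ hΔ => ?_)
    (fun φ ψ _ h h' => ?_) φ
  · have e : SimpleFunc.piecewise Δ hΔ (SimpleFunc.const S c) (SimpleFunc.const S 0)
        = c • simpleInd Δ hΔ := by
      ext t
      rw [SimpleFunc.coe_smul, Pi.smul_apply, simpleInd_apply]
      by_cases ht : t ∈ Δ <;> simp [ht]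
    rw [e, map_smul, map_smul, hL]
    have e' : ((c • simpleInd Δ hΔ : SimpleFunc S ℂ) : S → ℂ) = Δ.indicator fun _ => c := by
      funext t
      rw [SimpleFunc.coe_smul, Pi.smul_apply, simpleInd_apply]
      by_cases ht : t ∈ Δ <;> simp [ht]
    rw [e', VectorMeasure.integral_eq_setToFun, setToFun_indicator_const _ hΔ (measure_ne_top _ _)]
    rfl
  · rw [map_add, map_add, h, h', ← hsimp, ← hsimp, ← VectorMeasure.integral_fun_add (hInt _) (hInt _),
      ← hsimp]
    refine VectorMeasure.integral_congr_ae ?_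
    filter_upwards [hm.ae_le (simpleLp_coeFn (m := ν) ∞ (φ + ψ)),
      hm.ae_le (simpleLp_coeFn (m := ν) ∞ φ), hm.ae_le (simpleLp_coeFn (m := ν) ∞ ψ)] with t h1 h2 h3
    rw [h1, h2, h3, SimpleFunc.add_apply]

end Integral

/-! ### The map `κ` of an orthogonal CP-measure space. -/

section Compatible

variable {X : Type u} [CStarAlgebra X] [PartialOrder X] [StarOrderedRing X]
variable {H : Type v} [NormedAddCommGroup H] [InnerProductSpace ℂ H] [CompleteSpace H]
variable {M : VonNeumannAlgebra H} {T : CPMap X M}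
variable {K : Type w} [NormedAddCommGroup K] [InnerProductSpace ℂ K] [CompleteSpace K]
variable {σ : MinimalStinespring T K}

theorem NormalFunctional.exists_bound (ρ : NormalFunctional M) :
    ∃ C : ℝ, ∀ A : M.toStarSubalgebra, ‖ρ.1 A‖ ≤ C * ‖(A : H →L[ℂ] H)‖ := by
  obtain ⟨x, y, hx, hy, h⟩ := ρ.2
  refine ⟨∑' n, (‖x n‖ ^ 2 + ‖y n‖ ^ 2), fun A => ?_⟩
  rw [← (h A).tsum_eq]
  refine tsum_of_norm_bounded ((hx.add hy).hasSum.mul_right _) fun n => ?_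
  refine (norm_inner_le_norm _ _).trans ?_
  have h1 := (A : H →L[ℂ] H).le_opNorm (y n)
  calc ‖x n‖ * ‖(A : H →L[ℂ] H) (y n)‖ ≤ ‖x n‖ * (‖(A : H →L[ℂ] H)‖ * ‖y n‖) := by gcongr
    _ = (‖x n‖ * ‖y n‖) * ‖(A : H →L[ℂ] H)‖ := by ring
    _ ≤ _ := by
      gcongr
      nlinarith [sq_nonneg (‖x n‖ - ‖y n‖), sq_nonneg (‖x n‖ + ‖y n‖)]

/-- An operator in the commutant that vanishes on the range of `V` is zero. -/
theorem MinimalStinespring.eq_zero_of_apply_eq_zero {A : K →L[ℂ] K}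
    (hc : ∀ x, A * σ.π x = σ.π x * A) (h : ∀ ξ, A (σ.V ξ) = 0) : A = 0 := by
  refine σ.ext_generators fun x y ξ η => ?_
  have : A (σ.π y (σ.V η)) = σ.π y (A (σ.V η)) :=
    congrArg (fun B : K →L[ℂ] K => B (σ.V η)) (hc y)
  rw [this, h, map_zero, zero_apply]

/-- `V* A* A V` is a positive element of `M` with vanishing diagonal coefficients at the `xₙ`, hence
zero; so `A V = 0`, and `A` commutes with `π`. -/
theorem MinimalStinespring.IsRelative.eq_zero_of_separating {A : K →L[ℂ] K}
    (hA : σ.IsRelative A) {x : ℕ → H}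
    (hx : ∀ B ∈ M, (∀ n, ⟪x n, (B : H →L[ℂ] H) (x n)⟫_ℂ = 0) → 0 ≤ B → B = 0)
    (h : ∀ n, A (σ.V (x n)) = 0) : A = 0 := by
  have hAA := hA.star.mul hA
  have hf : ∀ ξ η, ⟪ξ, (adjoint σ.V ∘L ((Star.star A * A) * σ.π 1) ∘L σ.V) η⟫_ℂ
      = ⟪A (σ.V ξ), A (σ.V η)⟫_ℂ := by
    intro ξ η
    rw [map_one, mul_one, comp_apply, adjoint_inner_right, comp_apply, inner_star_mul_self]
  have hz := hx _ (hAA.2 1) (fun n => by rw [hf, h, inner_zero_left]) (by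
    rw [clm_nonneg_iff]
    intro k
    rw [hf, inner_self_ofReal]
    exact_mod_cast by positivity)
  refine eq_zero_of_apply_eq_zero hA.1 fun ξ => ?_
  have := hf ξ ξ
  rw [hz, zero_apply, inner_zero_right] at this
  exact inner_self_eq_zero.1 this.symm

/-- Faithfulness makes `ρ(μ(Δ, 1)) = 0` equivalent to `V* R(Δ) V = 0`, that is to `R(Δ) V = 0`, and
by minimality to `R(Δ) = 0`. -/
theorem OrthSpace.compat (E : OrthSpace.{u, v, s} T) (ρ : NormalFaithfulState M)
    {ν : Measure E.1.S} (h : ν ≪ E.1.μ.scalarMeasure ρ) (h' : E.1.μ.scalarMeasure ρ ≪ ν) :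
    (E.pvm σ).Compat ν := by
  intro Δ hΔ
  have h1 : ν Δ = 0 ↔ E.1.μ.scalarMeasure ρ Δ = 0 := ⟨fun h0 => h' h0, fun h0 => h h0⟩
  have hpos : (0 : H →L[ℂ] H) ≤ (E.1.μ.toFun ⟨Δ, hΔ⟩).1 1 := map_nonneg _ zero_le_one
  have hd := E.isDensity_pvm (σ := σ) hΔ
  have hn := ρ.nonneg ((E.1.μ.toFun ⟨Δ, hΔ⟩).app 1) hpos
  rw [h1, CPMeasure.scalarMeasure_apply _ _ hΔ, ENNReal.ofReal_eq_zero]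
  constructor
  · intro h0
    have h2 : ρ.toFunctional.1 ((E.1.μ.toFun ⟨Δ, hΔ⟩).app 1) = 0 :=
      Complex.ext (le_antisymm h0 hn.1) hn.2
    have h3 := congrArg Subtype.val (ρ.faithful _ hpos h2)
    change (E.1.μ.toFun ⟨Δ, hΔ⟩).1 1 = 0 at h3
    refine MinimalStinespring.eq_zero_of_apply_eq_zero hd.1 fun ξ => ?_
    have h4 : ⟪σ.V ξ, (E.pvm σ).toFun Δ (σ.V ξ)⟫_ℂ = 0 := by
      have h5 := hd.2 1
      change (E.1.μ.toFun ⟨Δ, hΔ⟩).1 1 = _ at h5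
      rw [h3, map_one σ.π, mul_one] at h5
      rw [← adjoint_inner_right]
      change ⟪ξ, (adjoint σ.V ∘L (E.pvm σ).toFun Δ ∘L σ.V) ξ⟫_ℂ = 0
      rw [← h5, zero_apply, inner_zero_right]
    rw [((E.pvm σ).proj Δ hΔ).inner_apply_self] at h4
    have h6 : ‖(E.pvm σ).toFun Δ (σ.V ξ)‖ ^ 2 = 0 := by exact_mod_cast h4
    simpa using h6
  · intro h0
    have h3 : (E.1.μ.toFun ⟨Δ, hΔ⟩).app 1 = 0 := Subtype.ext (by
      change (E.1.μ.toFun ⟨Δ, hΔ⟩).1 1 = 0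
      refine (hd.2 1).trans ?_
      rw [h0, zero_mul]
      ext; simp)
    rw [h3, map_zero]
    simp

theorem OrthSpace.separating (E : OrthSpace.{u, v, s} T) {x : ℕ → H}
    (hx : ∀ B ∈ M, (∀ n, ⟪x n, (B : H →L[ℂ] H) (x n)⟫_ℂ = 0) → 0 ≤ B → B = 0)
    (Δ : Set E.1.S) (hΔ : MeasurableSet Δ) (h : ∀ n, (E.pvm σ).toFun Δ (σ.V (x n)) = 0) :
    (E.pvm σ).toFun Δ = 0 :=
  (E.isRelative_pvm hΔ).eq_zero_of_separating hx h

theorem OrthSpace.isRelative_kappa (E : OrthSpace.{u, v, s} T) {ν : Measure E.1.S}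
    [IsFiniteMeasure ν] (h : (E.pvm σ).Compat ν) (f : Lp ℂ ∞ ν) :
    σ.IsRelative ((E.pvm σ).kappa ν f) :=
  MinimalStinespring.mem_relativeCommutant_iff.1 (E.algebra_subset (h.kappa_mem_algebra f))

theorem OrthSpace.variation_absolutelyContinuous (E : OrthSpace.{u, v, s} T) {ν : Measure E.1.S}
    (h : (E.pvm σ).Compat ν) (ρ : NormalFunctional M) (x : X) :
    (E.1.μ.complexMeasure ρ x).variation ≪ ν := by
  refine Measure.AbsolutelyContinuous.mk fun Δ hΔ h0 => ?_
  rw [VectorMeasure.variation_apply_eq_zero hΔ]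
  intro Δ' hsub hΔ'
  have h1 : (E.pvm σ).toFun Δ' = 0 := (h Δ' hΔ').1 (measure_mono_null hsub h0)
  have h2 : (E.1.μ.toFun ⟨Δ', hΔ'⟩).app x = 0 := Subtype.ext (by
    change (E.1.μ.toFun ⟨Δ', hΔ'⟩).1 x = 0
    refine ((E.isDensity_pvm (σ := σ) hΔ').2 x).trans ?_
    rw [h1, zero_mul]
    ext; simp)
  rw [CPMeasure.complexMeasure_apply _ _ _ hΔ', h2, map_zero]

theorem OrthSpace.exists_functional (E : OrthSpace.{u, v, s} T) {ν : Measure E.1.S}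
    [IsFiniteMeasure ν] (h : (E.pvm σ).Compat ν) (ρ : NormalFunctional M) (x : X) :
    ∃ L : Lp ℂ ∞ ν →L[ℂ] ℂ, (∀ f, L f = ρ.1 ⟨_, (E.isRelative_kappa h f).2 x⟩) ∧
      ∀ Δ hΔ, L (simpleLp ν ∞ (simpleInd Δ hΔ)) = ρ.1 ((E.1.μ.toFun ⟨Δ, hΔ⟩).app x) := by
  let C : (K →L[ℂ] K) →L[ℂ] (H →L[ℂ] H) :=
    (ContinuousLinearMap.compL ℂ H K H (adjoint σ.V)) ∘L
      ((ContinuousLinearMap.compL ℂ H K K).flip (σ.π x ∘L σ.V))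
  obtain ⟨c, hc⟩ := ρ.exists_bound
  let L₀ : Lp ℂ ∞ ν →ₗ[ℂ] M.toStarSubalgebra :=
    { toFun := fun f => ⟨_, (E.isRelative_kappa h f).2 x⟩
      map_add' := fun f g => Subtype.ext (by
        change C ((E.pvm σ).kappa ν (f + g)) = C ((E.pvm σ).kappa ν f) + C ((E.pvm σ).kappa ν g)
        rw [map_add, map_add])
      map_smul' := fun a f => Subtype.ext (by
        change C ((E.pvm σ).kappa ν (a • f)) = a • C ((E.pvm σ).kappa ν f)
        rw [map_smul, map_smul]) }
  have hL₀ : ∀ f, ((L₀ f : M.toStarSubalgebra) : H →L[ℂ] H) = C ((E.pvm σ).kappa ν f) := fun f => rfl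
  let L : Lp ℂ ∞ ν →L[ℂ] ℂ := (ρ.1 ∘ₗ L₀).mkContinuous (|c| * ‖C ∘L (E.pvm σ).kappa ν‖) fun f => by
    refine (hc _).trans ?_
    rw [hL₀, mul_assoc]
    refine mul_le_mul (le_abs_self c) ((C ∘L (E.pvm σ).kappa ν).le_opNorm f) (norm_nonneg _)
      (abs_nonneg c)
  refine ⟨L, fun f => rfl, fun Δ hΔ => ?_⟩
  change ρ.1 _ = _
  congr 1
  refine Subtype.ext ?_
  change adjoint σ.V ∘L ((E.pvm σ).kappa ν (simpleLp ν ∞ (simpleInd Δ hΔ)) * σ.π x) ∘L σ.V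
    = (E.1.μ.toFun ⟨Δ, hΔ⟩).1 x
  rw [h.kappa_ind]
  exact ((E.isDensity_pvm hΔ).2 x).symm

/-- The integral with respect to the projection-valued measure has the integral property. -/
theorem OrthSpace.isIntegralMap_kappa (E : OrthSpace.{u, v, s} T) {ν : Measure E.1.S}
    [IsFiniteMeasure ν] (h : (E.pvm σ).Compat ν) :
    IsIntegralMap σ E.1.μ ((E.pvm σ).kappa ν).toLinearMap := by
  intro f x
  refine ⟨⟨_, (E.isRelative_kappa h f).2 x⟩, rfl, fun ρ => ?_⟩
  obtain ⟨L, hL, hL'⟩ := E.exists_functional h ρ x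
  refine (hL f).symm.trans
    (integral_eq_of_indicator (E.variation_absolutelyContinuous h ρ x) L (fun Δ hΔ => ?_) f)
  rw [CPMeasure.complexMeasure_apply _ _ _ hΔ, hL']

theorem IsIntegralMap.unique {S : Type s} [MeasurableSpace S] {μ : CPMeasure X M S} {ν : Measure S}
    {κ κ' : Lp ℂ ∞ ν →ₗ[ℂ] (K →L[ℂ] K)} (h : IsIntegralMap σ μ κ) (h' : IsIntegralMap σ μ κ')
    (hκ : ∀ f, σ.IsRelative (κ f)) (hκ' : ∀ f, σ.IsRelative (κ' f)) : κ' = κ := by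
  ext1 f
  refine (hκ' f).isDensity.unique ⟨(hκ f).1, fun x => ?_⟩
  obtain ⟨A, hA, hAρ⟩ := h f x
  obtain ⟨A', hA', hAρ'⟩ := h' f x
  change adjoint σ.V ∘L (κ' f * σ.π x) ∘L σ.V = _
  rw [← hA, ← hA']
  exact NormalFunctional.ext_of_forall fun ρ => by rw [hAρ, hAρ']

theorem OrthSpace.isStarIsoOnto_kappa (E : OrthSpace.{u, v, s} T) {ν : Measure E.1.S}
    [IsFiniteMeasure ν] (h : (E.pvm σ).Compat ν) (ρ : NormalFaithfulState M) :
    IsStarIsoOnto ((E.pvm σ).kappa ν).toLinearMap (E.pvm σ).algebra := by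
  obtain ⟨x, -, hx⟩ := ρ.exists_separating
  exact ⟨h.kappa_injective, h.range_kappa (E.separating hx), h.kappa_mul, h.kappa_star⟩

end Compatible

/-! ### From projection-valued measures to CP-measure spaces. -/

section Converse

variable {X : Type u} [CStarAlgebra X] [PartialOrder X] [StarOrderedRing X]
variable {H : Type v} [NormedAddCommGroup H] [InnerProductSpace ℂ H] [CompleteSpace H]
variable {M : VonNeumannAlgebra H} {T : CPMap X M}
variable {K : Type w} [NormedAddCommGroup K] [InnerProductSpace ℂ K] [CompleteSpace K]
variable {σ : MinimalStinespring T K}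

theorem _root_.IsStarProjection.clm_nonneg {p : K →L[ℂ] K} (hp : IsStarProjection p) : 0 ≤ p := by
  rw [clm_nonneg_iff]
  intro k
  rw [CPTomita.IsStarProjection.inner_apply_self hp]
  exact_mod_cast by positivity

/-- A projection-valued measure in the relative commutant defines an orthogonal CP-measure space. -/
theorem exists_orthSpace_of_pvm {S : Type s} [MeasurableSpace S] (R : PVM S K)
    (hR : ∀ Δ, MeasurableSet Δ → σ.IsRelative (R.toFun Δ)) :
    ∃ E : OrthSpace.{u, v, s} T, (E.pvm σ).algebra = R.algebra := by
  choose S' hS' using fun Δ : {Δ : Set S // MeasurableSet Δ} =>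
    MinimalStinespring.exists_cpMap_of_nonneg (σ := σ) (R.proj Δ.1 Δ.2).clm_nonneg (hR Δ.1 Δ.2).1
      (hR Δ.1 Δ.2).2
  let μ : CPMeasure X M S :=
    { toFun := S'
      hasSum_iUnion := fun Δ hd ρ x => by
        obtain ⟨a, b, ha, hb, hρ⟩ := ρ.2
        have hval : ∀ (Δ : {Δ : Set S // MeasurableSet Δ}) n,
            ⟪a n, ((S' Δ).app x : H →L[ℂ] H) (b n)⟫_ℂ
              = ⟪σ.V (a n), R.toFun Δ.1 (σ.π x (σ.V (b n)))⟫_ℂ := by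
          intro Δ n
          change ⟪a n, (S' Δ).1 x (b n)⟫_ℂ = _
          rw [show (S' Δ).1 x = _ from (hS' Δ).2 x, comp_apply, adjoint_inner_right]
          rfl
        have hU := MeasurableSet.iUnion fun i => (Δ i).2
        rw [← (hρ _).tsum_eq]
        have hF : ∀ F : Finset ℕ, ∑ i ∈ F, ρ.1 ((S' (Δ i)).app x)
            = ∑' n, ⟪σ.V (a n), R.toFun (⋃ i ∈ F, (Δ i).1) (σ.π x (σ.V (b n)))⟫_ℂ := by
          intro F
          rw [finitelyAdditive_biUnion R.union (fun i => (Δ i).2) hd F]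
          simp_rw [sum_apply, inner_sum, ← hval]
          exact (hasSum_sum fun i _ => hρ ((S' (Δ i)).app x)).tsum_eq.symm
        change Filter.Tendsto _ _ _
        simp_rw [hF]
        simp_rw [hval]
        -- A normal functional is a series in `n`, and each term converges by strong additivity of
        -- `R`. As `‖R(Δ)‖ ≤ 1`, all terms are dominated by a summable sequence.
        refine tendsto_tsum_of_dominated_convergence
          (bound := fun n => ‖σ.V (a n)‖ * ‖σ.π x (σ.V (b n))‖) ?_ ?_ ?_
        · have h1 := summable_sq_apply σ.V ha
          have h2 := summable_sq_apply (σ.π x ∘L σ.V) hb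
          refine Summable.of_nonneg_of_le (fun n => by positivity) (fun n => ?_) (h1.add h2)
          change _ ≤ ‖σ.V (a n)‖ ^ 2 + ‖σ.π x (σ.V (b n))‖ ^ 2
          nlinarith [sq_nonneg (‖σ.V (a n)‖ - ‖σ.π x (σ.V (b n))‖), norm_nonneg (σ.V (a n)),
            norm_nonneg (σ.π x (σ.V (b n)))]
        · intro n
          have h3 := R.hasSum (fun i => (Δ i).1) (fun i => (Δ i).2) hd (σ.π x (σ.V (b n)))
          have h4 := h3.mapL (innerSL ℂ (σ.V (a n)))
          refine Filter.Tendsto.congr (fun F => ?_) h4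
          rw [finitelyAdditive_biUnion R.union (fun i => (Δ i).2) hd F, sum_apply, inner_sum]
          rfl
        · refine Filter.Eventually.of_forall fun F n => ?_
          refine (norm_inner_le_norm _ _).trans ?_
          gcongr
          refine ((R.toFun _).le_opNorm _).trans ?_
          have h5 := (R.proj (⋃ i ∈ F, (Δ i).1)
            (Finset.measurableSet_biUnion F fun i _ => (Δ i).2)).norm_le
          nlinarith [norm_nonneg (σ.π x (σ.V (b n)))] }
  have hb : μ.toFun ⟨Set.univ, MeasurableSet.univ⟩ = T := by
    have h1 := hS' ⟨Set.univ, MeasurableSet.univ⟩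
    rw [R.univ] at h1
    exact h1.cpMap_ext σ.isDensity_one
  let E₀ : CPSpace.{u, v, s} T := ⟨S, μ, hb⟩
  have hc : ∀ Δ, MeasurableSet Δ → R.toFun Δᶜ = 1 - R.toFun Δ := by
    intro Δ hΔ
    rw [← R.univ, ← Set.union_compl_self Δ, R.union _ _ hΔ hΔ.compl disjoint_compl_right,
      add_sub_cancel_left]
  let E : OrthSpace.{u, v, s} T := ⟨E₀, fun Δ hΔ =>
    orthogonal_of_isStarProjection (σ := σ) (R.proj Δ hΔ) (hS' ⟨Δ, hΔ⟩)
      (by rw [← hc Δ hΔ]; exact hS' ⟨Δᶜ, hΔ.compl⟩)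
      ⟨S' ⟨Δᶜ, hΔ.compl⟩, fun x => by rw [E₀.add_compl hΔ]; exact add_sub_cancel_left _ _⟩⟩
  refine ⟨E, ?_⟩
  have hp : (E.pvm σ).projections = R.projections := by
    ext p
    refine exists_congr fun Δ => and_congr_right fun hΔ => ?_
    rw [(E.isDensity_pvm hΔ).unique (hS' ⟨Δ, hΔ⟩)]
  refine SetLike.coe_injective ?_
  rw [PVM.coe_algebra, PVM.coe_algebra, hp]

end Converse

end CPTomita

namespace CPTomita

open scoped ComplexOrder
open ContinuousLinearMap

/-! ### Embeddings of `L^∞` algebras as compressions of `L²`. -/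

section Compression

variable {S₁ S₂ : Type s} [MeasurableSpace S₁] [MeasurableSpace S₂] {m₁ : Measure S₁}
  {m₂ : Measure S₂} [IsFiniteMeasure m₁] [IsFiniteMeasure m₂]

/-- A trace-preserving embedding of `L^∞` algebras is spatially a compression. -/
theorem exists_spatialIsoCompression (θ : Lp ℂ ∞ m₁ →ₗ[ℂ] Lp ℂ ∞ m₂)
    (hmul : ∀ f g, θ (linftyMul f g) = linftyMul (θ f) (θ g)) (hstar : ∀ f, θ (star f) = star (θ f))
    (hnorm : ∀ f, ‖toL2 m₂ (θ f)‖ = ‖toL2 m₁ f‖) :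
    ∃ P, IsStarProjection P ∧ SpatialIsoCompression m₁ m₂ P := by
  let W₀ : Lp ℂ 2 m₁ →L[ℂ] Lp ℂ 2 m₂ := (toL2 m₂ ∘ₗ θ).extendOfNorm (toL2 m₁)
  have hW₀ : ∀ f, W₀ (toL2 m₁ f) = toL2 m₂ (θ f) := fun f =>
    LinearMap.extendOfNorm_eq (f := toL2 m₂ ∘ₗ θ) denseRange_toL2
      ⟨1, fun g => by rw [one_mul]; exact (hnorm g).le⟩ f
  let W : Lp ℂ 2 m₁ →ₗᵢ[ℂ] Lp ℂ 2 m₂ := ⟨W₀.toLinearMap, fun a =>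
    denseRange_toL2.induction_on (p := fun a => ‖W₀ a‖ = ‖a‖) a
      (isClosed_eq (by fun_prop) (by fun_prop)) fun f => by rw [hW₀, hnorm]⟩
  have hWW : W.toContinuousLinearMap = W₀ := rfl
  have hadj : adjoint W₀ ∘L W₀ = 1 := by
    ext1 a
    refine ext_inner_left ℂ fun b => ?_
    rw [comp_apply, adjoint_inner_right]
    exact W.inner_map_map b a
  have hadj' : ∀ a, adjoint W₀ (W₀ a) = a := fun a =>
    congrArg (fun A : Lp ℂ 2 m₁ →L[ℂ] Lp ℂ 2 m₁ => A a) hadj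
  have hInt : ∀ f, W₀ ∘L mulOp m₁ f = mulOp m₂ (θ f) ∘L W₀ := by
    intro f
    ext1 a
    refine denseRange_toL2.induction_on
      (p := fun a => (W₀ ∘L mulOp m₁ f) a = (mulOp m₂ (θ f) ∘L W₀) a) a
      (isClosed_eq (by fun_prop) (by fun_prop)) fun g => ?_
    rw [comp_apply, comp_apply, mulOp_toL2, hW₀, hW₀, mulOp_toL2, hmul]
  have hInt' : ∀ f, adjoint W₀ ∘L mulOp m₂ (θ f) = mulOp m₁ f ∘L adjoint W₀ := by
    intro f
    have h := congrArg adjoint (hInt (star f))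
    rw [adjoint_comp, adjoint_comp, hstar, adjoint_mulOp, adjoint_mulOp, star_star, star_star] at h
    exact h.symm
  -- `P = W W*` is the range projection of the isometry `W` extending `θ`.
  refine ⟨W₀ ∘L adjoint W₀, ⟨?_, ?_⟩, W, ?_, ?_⟩
  · ext1 a
    change W₀ (adjoint W₀ (W₀ (adjoint W₀ a))) = W₀ (adjoint W₀ a)
    rw [hadj']
  · change adjoint (W₀ ∘L adjoint W₀) = _
    rw [adjoint_comp, adjoint_adjoint]
  · ext b
    constructor
    · rintro ⟨a, rfl⟩
      exact ⟨W₀ a, congrArg W₀ (hadj' a)⟩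
    · rintro ⟨a, rfl⟩
      exact ⟨adjoint W₀ a, rfl⟩
  · rw [hWW]
    ext A
    constructor
    · rintro ⟨f, rfl⟩
      refine ⟨θ f, ?_⟩
      ext1 a
      change W₀ (adjoint W₀ (mulOp m₂ (θ f) (W₀ (adjoint W₀ a)))) = W₀ (mulOp m₁ f (adjoint W₀ a))
      have h := congrArg (fun A : Lp ℂ 2 m₁ →L[ℂ] Lp ℂ 2 m₂ => A (adjoint W₀ a)) (hInt f)
      change W₀ (mulOp m₁ f (adjoint W₀ a)) = mulOp m₂ (θ f) (W₀ (adjoint W₀ a)) at h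
      rw [← h, hadj']
    · rintro ⟨g, rfl⟩
      -- `W* g W` commutes with `L^∞(m₁)`, since `W` intertwines `f` with `θ f`; maximal abelianness
      -- makes it a multiplication operator even when `g` is not in the range of `θ`.
      obtain ⟨f, hf⟩ := exists_eq_mulOp (adjoint W₀ ∘L mulOp m₂ g ∘L W₀) (fun f => by
        rw [comp_assoc, comp_assoc, hInt, ← comp_assoc (mulOp m₂ g), ← mulOp_mul, linftyMul_comm,
          mulOp_mul, comp_assoc, ← comp_assoc (adjoint W₀), hInt', comp_assoc])
      refine ⟨f, ?_⟩
      change W₀ ∘L mulOp m₁ f ∘L adjoint W₀ = _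
      rw [← hf]
      rfl

end Compression

/-! ### Dominance is inclusion of the generated algebras. -/

section Dominance

variable {X : Type u} [CStarAlgebra X] [PartialOrder X] [StarOrderedRing X]
variable {H : Type v} [NormedAddCommGroup H] [InnerProductSpace ℂ H] [CompleteSpace H]
variable {M : VonNeumannAlgebra H} {T : CPMap X M}
variable {K : Type w} [NormedAddCommGroup K] [InnerProductSpace ℂ K] [CompleteSpace K]
variable {σ : MinimalStinespring T K}

instance isFiniteMeasure_scalarMeasure {S : Type s} [MeasurableSpace S] (μ : CPMeasure X M S)
    (ρ : NormalFaithfulState M) : IsFiniteMeasure (μ.scalarMeasure ρ) :=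
  ⟨by rw [CPMeasure.scalarMeasure_apply _ _ .univ]; exact ENNReal.ofReal_lt_top⟩

/-- The right side depends on `f` only through the operator `κ(f)`, so integrals over two different
spaces can be compared. -/
theorem OrthSpace.integral_scalarMeasure (E : OrthSpace.{u, v, s} T) (ρ : NormalFaithfulState M)
    (h : (E.pvm σ).Compat (E.1.μ.scalarMeasure ρ)) (f : Lp ℂ ∞ (E.1.μ.scalarMeasure ρ)) :
    ∫ t, f t ∂(E.1.μ.scalarMeasure ρ)
      = ρ.toFunctional.1 ⟨_, (E.isRelative_kappa h f).2 1⟩ := by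
  set m := E.1.μ.scalarMeasure ρ with hm
  obtain ⟨L, hL, hL'⟩ := E.exists_functional h ρ.toFunctional 1
  let J : Lp ℂ ∞ m →L[ℂ] ℂ := innerSL ℂ (simpleLp m 2 1) ∘L
    ((ContinuousLinearMap.mul ℂ ℂ).holderL m ∞ 2 2).flip (simpleLp m 2 1)
  have hJ : ∀ f, J f = ∫ t, f t ∂m := by
    intro f
    change ⟪simpleLp m 2 1, toL2 m f⟫_ℂ = _
    rw [L2.inner_def]
    refine integral_congr_ae ?_
    filter_upwards [toL2_coeFn f, simpleLp_coeFn (m := m) 2 1] with t h1 h2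
    rw [h1, h2]
    simp
  have hJL : J = L := by
    refine linfty_clm_ext fun Δ hΔ => ?_
    rw [hJ, hL']
    have h1 : ∫ t, simpleLp m ∞ (simpleInd Δ hΔ) t ∂m = ((m.real Δ : ℝ) : ℂ) := by
      rw [integral_congr_ae (simpleLp_coeFn (m := m) ∞ (simpleInd Δ hΔ))]
      simp_rw [simpleInd_apply]
      rw [integral_indicator hΔ]
      simp
    have hpos : (0 : H →L[ℂ] H) ≤ (E.1.μ.toFun ⟨Δ, hΔ⟩).1 1 := map_nonneg _ zero_le_one
    have hn := ρ.nonneg ((E.1.μ.toFun ⟨Δ, hΔ⟩).app 1) hpos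
    rw [h1, measureReal_def, hm, CPMeasure.scalarMeasure_apply _ _ hΔ, ENNReal.toReal_ofReal hn.1]
    exact Complex.ext rfl hn.2.symm
  rw [← hJ, hJL, hL]

theorem OrthSpace.algebra_le_of_dom {E₁ E₂ : OrthSpace.{u, v, s} T} (h : OrthSpace.Dom E₁ E₂) :
    (E₁.pvm σ).algebra ≤ (E₂.pvm σ).algebra := by
  intro A hA
  rw [PVM.mem_algebra_iff] at hA ⊢
  refine Set.centralizer_subset (Set.centralizer_subset ?_) hA
  rintro _ ⟨Δ, hΔ, rfl⟩
  obtain ⟨⟨Δ', hΔ'⟩, he⟩ := h.1 ⟨⟨Δ, hΔ⟩, rfl⟩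
  refine ⟨Δ', hΔ', (E₂.isDensity_pvm hΔ').unique ?_⟩
  rw [he]
  exact E₁.isDensity_pvm hΔ

/-- Projections of the smaller algebra are projections in the range of `κ₂`, hence values of the
second measure. The equation `κ₂ ∘ θ = κ₁` defines a *-homomorphism `θ` of `L^∞` algebras, isometric
in `L²` because both integrals are `ρ(V* κ(·) V)`. -/
theorem OrthSpace.dom_of_algebra_le (ρ : NormalFaithfulState M) {E₁ E₂ : OrthSpace.{u, v, s} T}
    (hle : (E₁.pvm σ).algebra ≤ (E₂.pvm σ).algebra) : OrthSpace.Dom E₁ E₂ := by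
  obtain ⟨x, -, hx⟩ := ρ.exists_separating
  have h₁ : (E₁.pvm σ).Compat (E₁.1.μ.scalarMeasure ρ) := E₁.compat ρ (by rfl) (by rfl)
  have h₂ : (E₂.pvm σ).Compat (E₂.1.μ.scalarMeasure ρ) := E₂.compat ρ (by rfl) (by rfl)
  have hex : ∀ A ∈ (E₁.pvm σ).algebra, ∃ f, (E₂.pvm σ).kappa (E₂.1.μ.scalarMeasure ρ) f = A :=
    fun A hA => h₂.exists_kappa_eq (E₂.separating hx) (hle hA)
  refine ⟨?_, ρ, ?_⟩
  · rintro _ ⟨⟨Δ, hΔ⟩, rfl⟩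
    obtain ⟨f, hf⟩ := hex _ ((E₁.pvm σ).toFun_mem_algebra hΔ)
    obtain ⟨Δ', hΔ', he⟩ := h₂.exists_toFun_eq (f := f) (by rw [hf]; exact (E₁.pvm σ).proj Δ hΔ)
    refine ⟨⟨Δ', hΔ'⟩, ?_⟩
    have hd := E₂.isDensity_pvm (σ := σ) hΔ'
    rw [he, hf] at hd
    exact hd.cpMap_ext (E₁.isDensity_pvm hΔ)
  · choose θ₀ hθ₀ using fun f => hex _ (h₁.kappa_mem_algebra f)
    let θ : Lp ℂ ∞ (E₁.1.μ.scalarMeasure ρ) →ₗ[ℂ] Lp ℂ ∞ (E₂.1.μ.scalarMeasure ρ) :=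
      { toFun := θ₀
        map_add' := fun f g => h₂.kappa_injective (by
          rw [map_add, hθ₀, hθ₀, hθ₀, map_add])
        map_smul' := fun c f => h₂.kappa_injective (by
          rw [map_smul, hθ₀, hθ₀, map_smul, RingHom.id_apply]) }
    have hθ : ∀ f, (E₂.pvm σ).kappa (E₂.1.μ.scalarMeasure ρ) (θ f)
        = (E₁.pvm σ).kappa (E₁.1.μ.scalarMeasure ρ) f := hθ₀
    have hmul : ∀ f g, θ (linftyMul f g) = linftyMul (θ f) (θ g) := fun f g =>
      h₂.kappa_injective (by rw [h₂.kappa_mul, hθ, hθ, hθ, h₁.kappa_mul])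
    have hstar : ∀ f, θ (star f) = star (θ f) := fun f =>
      h₂.kappa_injective (by rw [h₂.kappa_star, hθ, hθ, h₁.kappa_star])
    refine exists_spatialIsoCompression θ hmul hstar fun f => ?_
    have h3 : ((‖toL2 (E₂.1.μ.scalarMeasure ρ) (θ f)‖ ^ 2 : ℝ) : ℂ)
        = ((‖toL2 (E₁.1.μ.scalarMeasure ρ) f‖ ^ 2 : ℝ) : ℂ) := by
      rw [norm_toL2_sq, norm_toL2_sq, ← hstar, ← hmul, E₂.integral_scalarMeasure ρ h₂,
        E₁.integral_scalarMeasure ρ h₁]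
      congr 1
      refine Subtype.ext ?_
      change _ ∘L (_ * _) ∘L _ = _ ∘L (_ * _) ∘L _
      rw [hθ]
    have h4 : ‖toL2 (E₂.1.μ.scalarMeasure ρ) (θ f)‖ ^ 2
        = ‖toL2 (E₁.1.μ.scalarMeasure ρ) f‖ ^ 2 := by exact_mod_cast h3
    exact (pow_left_inj₀ (norm_nonneg _) (norm_nonneg _) two_ne_zero).1 h4

end Dominance

end CPTomita

namespace CPTomita

open scoped ComplexOrder
open ContinuousLinearMap

/-! ### The spectral measure of a representation of `C(S)`. -/

section Riesz

variable {S : Type*} [TopologicalSpace S] [CompactSpace S] [T2Space S] [MeasurableSpace S]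
  [BorelSpace S] {K : Type*} [NormedAddCommGroup K] [InnerProductSpace ℂ K] [CompleteSpace K]

open CompactlySupported in
/-- The spectral measure of a square-summable family of vectors. -/
theorem exists_spectralMeasure (Γ : C(S, ℂ) →⋆ₐ[ℂ] (K →L[ℂ] K)) {x : ℕ → K}
    (hx : Summable fun n => ‖x n‖ ^ 2) :
    ∃ m : Measure S, ∃ _ : IsFiniteMeasure m, m.Regular ∧
      ∀ g : C(S, ℂ), HasSum (fun n => ‖Γ g (x n)‖ ^ 2) (‖ContinuousMap.toLp 2 m ℂ g‖ ^ 2) := by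
  let c : C_c(S, ℝ) → C(S, ℂ) := fun g => ⟨fun t => (g t : ℂ), by fun_prop⟩
  have hsum : ∀ g, Summable fun n => (⟪x n, Γ g (x n)⟫_ℂ).re := fun g =>
    Complex.reCLM.summable (summable_inner_of_sq hx (summable_sq_apply (Γ g) hx))
  have hsq : ∀ (h : C(S, ℂ)) n, (⟪x n, Γ (star h * h) (x n)⟫_ℂ).re = ‖Γ h (x n)‖ ^ 2 := by
    intro h n
    rw [map_mul, map_star, inner_star_mul_self, inner_self_ofReal, Complex.ofReal_re]
  -- Riesz–Markov is applied to the sum of all the vector functionals at once, so no single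
  -- separating vector is required.
  let Λ₀ : C_c(S, ℝ) →ₗ[ℝ] ℝ :=
    { toFun := fun g => ∑' n, (⟪x n, Γ (c g) (x n)⟫_ℂ).re
      map_add' := fun g h => by
        rw [← (hsum _).tsum_add (hsum _)]
        refine tsum_congr fun n => ?_
        have : c (g + h) = c g + c h := by ext t; simp [c]
        rw [this, map_add, add_apply, inner_add_right, Complex.add_re]
      map_smul' := fun r g => by
        rw [RingHom.id_apply, smul_eq_mul, ← tsum_mul_left]
        refine tsum_congr fun n => ?_
        have : c (r • g) = (r : ℂ) • c g := by ext t; simp [c]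
        rw [this, map_smul, smul_apply, inner_smul_right, Complex.re_ofReal_mul] }
  let Λ : C_c(S, ℝ) →ₚ[ℝ] ℝ := PositiveLinearMap.mk₀ Λ₀ (fun g hg => by
    let r : C(S, ℂ) := ⟨fun t => ((√(g t) : ℝ) : ℂ), by fun_prop⟩
    have hr : c g = star r * r := by
      ext t
      have h0 : 0 ≤ g t := hg t
      change ((g t : ℝ) : ℂ) = star ((√(g t) : ℝ) : ℂ) * ((√(g t) : ℝ) : ℂ)
      rw [RCLike.star_def, Complex.conj_ofReal, ← Complex.ofReal_mul, Real.mul_self_sqrt h0]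
    change 0 ≤ ∑' n, (⟪x n, Γ (c g) (x n)⟫_ℂ).re
    rw [hr]
    refine tsum_nonneg fun n => ?_
    rw [hsq]
    positivity)
  refine ⟨RealRMK.rieszMeasure Λ, inferInstance, inferInstance, fun h => ?_⟩
  set m := RealRMK.rieszMeasure Λ
  let g : C_c(S, ℝ) := CompactlySupportedContinuousMap.continuousMapEquiv
    ⟨fun t => ‖h t‖ ^ 2, by fun_prop⟩
  have hg : c g = star h * h := by
    ext t
    change ((‖h t‖ ^ 2 : ℝ) : ℂ) = star (h t) * h t
    rw [RCLike.star_def, ← Complex.normSq_eq_conj_mul_self, Complex.normSq_eq_norm_sq]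
  have h1 : ‖ContinuousMap.toLp 2 m ℂ h‖ ^ 2 = ∑' n, ‖Γ h (x n)‖ ^ 2 := by
    have h2 := RealRMK.integral_rieszMeasure Λ g
    have h3 : Λ g = ∑' n, ‖Γ h (x n)‖ ^ 2 := by
      change ∑' n, (⟪x n, Γ (c g) (x n)⟫_ℂ).re = _
      rw [hg]
      exact tsum_congr (hsq h)
    rw [← h3, ← h2]
    have h4 : ((‖ContinuousMap.toLp 2 m ℂ h‖ ^ 2 : ℝ) : ℂ) = ((∫ t, g t ∂m : ℝ) : ℂ) := by
      rw [← inner_self_ofReal, L2.inner_def, ← integral_complex_ofReal]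
      refine integral_congr_ae ?_
      filter_upwards [ContinuousMap.coeFn_toLp (p := 2) (𝕜 := ℂ) m h] with t ht
      rw [ht, inner_self_ofReal]
      rfl
    exact_mod_cast h4
  rw [h1]
  exact (summable_sq_apply (Γ h) hx).hasSum

/-- The maps `g ↦ Γ(g) xₙ` extend to `L²`. -/
theorem exists_cyclicMap (Γ : C(S, ℂ) →⋆ₐ[ℂ] (K →L[ℂ] K)) {x : ℕ → K} {m : Measure S}
    [IsFiniteMeasure m] [m.Regular]
    (hm : ∀ g : C(S, ℂ), HasSum (fun n => ‖Γ g (x n)‖ ^ 2) (‖ContinuousMap.toLp 2 m ℂ g‖ ^ 2)) :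
    ∃ U : ℕ → Lp ℂ 2 m →L[ℂ] K, (∀ n g, U n (ContinuousMap.toLp 2 m ℂ g) = Γ g (x n)) ∧
      ∀ f, (∀ n, U n f = 0) → f = 0 := by
  have hd : DenseRange (ContinuousMap.toLp (E := ℂ) 2 m ℂ) :=
    ContinuousMap.toLp_denseRange ℂ m ℂ (by norm_num)
  let ι : C(S, ℂ) →ₗ[ℂ] Lp ℂ 2 m := (ContinuousMap.toLp (E := ℂ) 2 m ℂ).toLinearMap
  let G : ℕ → C(S, ℂ) →ₗ[ℂ] K := fun n =>
    { toFun := fun g => Γ g (x n)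
      map_add' := fun g h => by rw [map_add, add_apply]
      map_smul' := fun r g => by rw [map_smul, smul_apply, RingHom.id_apply] }
  have hb : ∀ n g, ‖G n g‖ ≤ 1 * ‖ι g‖ := fun n g => by
    rw [one_mul]
    refine (pow_le_pow_iff_left₀ (norm_nonneg _) (norm_nonneg _) two_ne_zero).1 ?_
    exact le_hasSum (hm g) n fun j _ => by positivity
  let U : ℕ → Lp ℂ 2 m →L[ℂ] K := fun n => (G n).extendOfNorm ι
  have hU : ∀ n g, U n (ContinuousMap.toLp 2 m ℂ g) = Γ g (x n) := fun n g =>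
    LinearMap.extendOfNorm_eq (f := G n) (e := ι) hd ⟨1, hb n⟩ g
  have hle : ∀ (N : ℕ) f, ∑ n ∈ Finset.range N, ‖U n f‖ ^ 2 ≤ ‖f‖ ^ 2 := by
    intro N f
    refine hd.induction_on (p := fun f => ∑ n ∈ Finset.range N, ‖U n f‖ ^ 2 ≤ ‖f‖ ^ 2) f
      (isClosed_le (by fun_prop) (by fun_prop)) fun g => ?_
    simp_rw [hU]
    exact sum_le_hasSum _ (fun j _ => by positivity) (hm g)
  refine ⟨U, hU, fun f hf => ?_⟩
  rw [← norm_le_zero_iff]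
  refine le_of_forall_pos_le_add fun ε hε => ?_
  obtain ⟨g, hg⟩ := hd.exists_dist_lt f (half_pos hε)
  rw [dist_eq_norm] at hg
  -- `‖g‖² = ∑ ‖Uₙ g‖² = ∑ ‖Uₙ (f - g)‖²`, since every `Uₙ` kills `f`. Hence `‖f‖ ≤ 2 ‖f - g‖`,
  -- which is arbitrarily small.
  have h1 : ‖ContinuousMap.toLp 2 m ℂ g‖ ^ 2 ≤ ‖f - ContinuousMap.toLp 2 m ℂ g‖ ^ 2 := by
    refine le_of_tendsto (hm g).tendsto_sum_nat (Filter.Eventually.of_forall fun N => ?_)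
    refine le_of_eq_of_le (Finset.sum_congr rfl fun n _ => ?_) (hle N _)
    rw [map_sub, hf, zero_sub, norm_neg, hU]
  have h2 := (pow_le_pow_iff_left₀ (norm_nonneg _) (norm_nonneg _) two_ne_zero).1 h1
  have h3 := norm_sub_norm_le f (ContinuousMap.toLp 2 m ℂ g)
  linarith

theorem norm_simpleLp_ind_sq {S : Type*} [MeasurableSpace S] {m : Measure S} [IsFiniteMeasure m]
    {Δ : Set S} (hΔ : MeasurableSet Δ) : ‖simpleLp m 2 (simpleInd Δ hΔ)‖ ^ 2 = m.real Δ := by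
  have h : ENNReal.ofReal (‖simpleLp m 2 (simpleInd Δ hΔ)‖ ^ 2) = m Δ := by
    rw [norm_sq_L2_eq_lintegral]
    calc _ = ∫⁻ t, Δ.indicator 1 t ∂m := by
          refine lintegral_congr_ae ?_
          filter_upwards [simpleLp_coeFn (m := m) 2 (simpleInd Δ hΔ)] with t h1
          rw [h1, simpleInd_apply]
          by_cases ht : t ∈ Δ <;> simp [ht]
      _ = m Δ := by rw [lintegral_indicator_one hΔ]
  rw [measureReal_def, ← h, ENNReal.toReal_ofReal (by positivity)]

theorem simpleInd_union {S : Type*} [MeasurableSpace S] {Δ Δ' : Set S} (hΔ : MeasurableSet Δ)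
    (hΔ' : MeasurableSet Δ') (hd : Disjoint Δ Δ') :
    simpleInd (Δ ∪ Δ') (hΔ.union hΔ') = simpleInd Δ hΔ + simpleInd Δ' hΔ' := by
  ext t
  rw [SimpleFunc.add_apply, simpleInd_apply, simpleInd_apply, simpleInd_apply,
    Set.indicator_union_of_disjoint hd]

theorem hasSum_simpleLp_ind {S : Type*} [MeasurableSpace S] {m : Measure S} [IsFiniteMeasure m]
    {Δ : ℕ → Set S} (hΔ : ∀ i, MeasurableSet (Δ i))
    (hd : Pairwise fun i j => Disjoint (Δ i) (Δ j)) :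
    HasSum (fun i => simpleLp m 2 (simpleInd (Δ i) (hΔ i)))
      (simpleLp m 2 (simpleInd (⋃ i, Δ i) (MeasurableSet.iUnion hΔ))) := by
  have hU := MeasurableSet.iUnion hΔ
  have hF : ∀ F : Finset ℕ, MeasurableSet (⋃ i ∈ F, Δ i) :=
    fun F => Finset.measurableSet_biUnion F fun j _ => hΔ j
  have hsum : ∀ F : Finset ℕ, simpleLp m 2 (simpleInd _ (hF F))
      = ∑ i ∈ F, simpleLp m 2 (simpleInd (Δ i) (hΔ i)) := by
    intro F
    induction F using Finset.induction_on with
    | empty =>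
      rw [Finset.sum_empty]
      have : simpleInd (⋃ i ∈ (∅ : Finset ℕ), Δ i) (hF ∅) = 0 := by
        ext t; simp [simpleInd_apply]
      rw [this, map_zero]
    | insert i F hi ih =>
      rw [Finset.sum_insert hi, ← ih, ← map_add, ← simpleInd_union]
      · congr 2
        exact Finset.set_biUnion_insert _ _ _
      · rw [Set.disjoint_iUnion₂_right]
        intro j hj
        exact hd fun h => hi (h ▸ hj)
  have hdiff : ∀ F : Finset ℕ, simpleLp m 2 (simpleInd _ hU)
      = simpleLp m 2 (simpleInd _ (hU.diff (hF F)))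
        + ∑ i ∈ F, simpleLp m 2 (simpleInd (Δ i) (hΔ i)) := by
    intro F
    rw [← hsum, ← map_add, ← simpleInd_union _ _ Set.disjoint_sdiff_left]
    congr 2
    rw [Set.diff_union_of_subset (Set.iUnion₂_subset fun i _ => Set.subset_iUnion Δ i)]
  have hreal : ∀ F : Finset ℕ, ‖simpleLp m 2 (simpleInd _ (hU.diff (hF F)))‖ ^ 2
      = m.real (⋃ i, Δ i) - ∑ i ∈ F, m.real (Δ i) := by
    intro F
    rw [norm_simpleLp_ind_sq, measureReal_diff (Set.iUnion₂_subset fun i _ =>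
      Set.subset_iUnion Δ i) (hF F), measureReal_biUnion_finset (fun i _ j _ hij => hd hij)
      fun i _ => hΔ i]
  have hm : HasSum (fun i => m.real (Δ i)) (m.real (⋃ i, Δ i)) := by
    have h := m.toSignedMeasure.hasSum_of_disjoint_iUnion hΔ hd
    simpa [Measure.toSignedMeasure_apply_measurable, hΔ, hU] using h
  have hz : Filter.Tendsto (fun F : Finset ℕ => simpleLp m 2 (simpleInd _ (hU.diff (hF F))))
      Filter.atTop (nhds 0) := by
    rw [tendsto_zero_iff_norm_tendsto_zero]
    have h1 := hm.const_sub (m.real (⋃ i, Δ i))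
    rw [sub_self] at h1
    have h2 := (Real.continuous_sqrt.tendsto _).comp h1
    rw [Real.sqrt_zero] at h2
    refine h2.congr fun F => ?_
    rw [Function.comp_apply, ← hreal, Real.sqrt_sq (norm_nonneg _)]
  have h3 := hz.const_sub (simpleLp m 2 (simpleInd _ hU))
  rw [sub_zero] at h3
  refine h3.congr fun F => ?_
  rw [hdiff F]
  abel

end Riesz

end CPTomita

namespace CPTomita

open scoped ComplexOrder
open ContinuousLinearMap

/-! ### Extending the continuous functional calculus to Borel sets. -/

section Spectral

variable {K : Type w} [NormedAddCommGroup K] [InnerProductSpace ℂ K] [CompleteSpace K]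
  {B : VonNeumannAlgebra K}

/-- For a separating family `(xₙ)` of `B`, the vectors `B' xₙ` are total. -/
theorem dense_span_commutant_apply {x : ℕ → K} (hsep : ∀ A ∈ B, (∀ n, A (x n) = 0) → A = 0) :
    Dense (Submodule.span ℂ {k : K | ∃ a ∈ B.commutant, ∃ n, k = a (x n)} : Set K) := by
  set D := Submodule.span ℂ {k : K | ∃ a ∈ B.commutant, ∃ n, k = a (x n)} with hD
  rw [Submodule.dense_iff_topologicalClosure_eq_top]
  haveI : CompleteSpace D.topologicalClosure :=
    (Submodule.isClosed_topologicalClosure _).completeSpace_coe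
  have hinv : ∀ y ∈ B.commutant, ∀ k ∈ D.topologicalClosure, y k ∈ D.topologicalClosure := by
    intro y hy k hk
    refine closure_minimal (s := (D : Set K)) (t := {k | y k ∈ D.topologicalClosure}) ?_
      ((Submodule.isClosed_topologicalClosure _).preimage y.continuous) hk
    intro k hk
    refine Submodule.le_topologicalClosure _ ?_
    refine Submodule.span_induction (p := fun k _ => y k ∈ D) ?_ (by rw [map_zero]; exact zero_mem _)
      (fun _ _ _ _ h h' => by rw [map_add]; exact add_mem h h')
      (fun c _ _ h => by rw [map_smul]; exact D.smul_mem c h) hk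
    rintro _ ⟨a, ha, n, rfl⟩
    exact Submodule.subset_span ⟨y * a, mul_mem hy ha, n, rfl⟩
  have hQ : D.topologicalClosure.starProjection ∈ B := by
    rw [VonNeumannAlgebra.IsStarProjection.mem_iff
      (isStarProjection_starProjection (U := D.topologicalClosure))]
    intro y hy
    rw [Submodule.range_starProjection]
    exact hinv y hy
  have hz := hsep (1 - D.topologicalClosure.starProjection) (sub_mem (one_mem _) hQ) fun n => by
    have : x n ∈ D.topologicalClosure := Submodule.le_topologicalClosure _
      (Submodule.subset_span ⟨1, one_mem _, n, rfl⟩)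
    rw [sub_apply, one_apply_eq_self, Submodule.starProjection_eq_self_iff.2 this, sub_self]
  rw [eq_top_iff]
  intro k _
  rw [← Submodule.starProjection_eq_self_iff, ← sub_eq_zero.1 hz, one_apply_eq_self]

theorem commutant_apply_comm {A a : K →L[ℂ] K} (hA : A ∈ B) (ha : a ∈ B.commutant) (k : K) :
    A (a k) = a (A k) :=
  congrArg (fun C : K →L[ℂ] K => C k) (VonNeumannAlgebra.mem_commutant_iff.1 ha A hA)

/-- The functions in `L²` that act as contractions of `B` on the separating family form a closed
set. -/
theorem isClosed_setOf_contraction {x : ℕ → K} (hsep : ∀ A ∈ B, (∀ n, A (x n) = 0) → A = 0)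
    {L : Type*} [NormedAddCommGroup L] [NormedSpace ℂ L] (U : ℕ → L →L[ℂ] K) :
    IsClosed {f : L | ∃ b ∈ B, ‖b‖ ≤ 1 ∧ ∀ n, b (x n) = U n f} := by
  refine isClosed_of_closure_subset fun f hf => ?_
  obtain ⟨g, hg, hgf⟩ := mem_closure_iff_seq_limit.1 hf
  choose b hb hb1 hbx using hg
  have hle : ∀ j k, ‖b j k‖ ≤ ‖k‖ := fun j k => by
    refine ((b j).le_opNorm k).trans ?_
    nlinarith [norm_nonneg k, hb1 j]
  -- On `a xₙ` with `a ∈ B'` the values are `a (Uₙ g_j)`, which converge. Such vectors are total and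
  -- the `b_j` are contractions, so a strong limit exists everywhere, and it stays in `B`.
  have hspan : ∀ k ∈ Submodule.span ℂ {k : K | ∃ a ∈ B.commutant, ∃ n, k = a (x n)},
      ∃ l, Filter.Tendsto (fun j => b j k) Filter.atTop (nhds l) := by
    intro k hk
    refine Submodule.span_induction
      (p := fun k _ => ∃ l, Filter.Tendsto (fun j => b j k) Filter.atTop (nhds l)) ?_
      ⟨0, by simp⟩ ?_ ?_ hk
    · rintro _ ⟨a, ha, n, rfl⟩
      refine ⟨a (U n f), ?_⟩
      simp_rw [fun j => commutant_apply_comm (hb j) ha, hbx]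
      exact ((a ∘L U n).continuous.tendsto f).comp hgf
    · rintro k k' _ _ ⟨l, hl⟩ ⟨l', hl'⟩
      exact ⟨l + l', by simp_rw [map_add]; exact hl.add hl'⟩
    · rintro c k _ ⟨l, hl⟩
      exact ⟨c • l, by simp_rw [map_smul]; exact hl.const_smul c⟩
  have hall : ∀ k, ∃ l, Filter.Tendsto (fun j => b j k) Filter.atTop (nhds l) := by
    intro k
    refine cauchySeq_tendsto_of_complete ?_
    rw [Metric.cauchySeq_iff']
    intro ε hε
    obtain ⟨k', hk', hkk'⟩ := Metric.dense_iff.1 (dense_span_commutant_apply hsep) k (ε / 3)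
      (by positivity)
    obtain ⟨l, hl⟩ := hspan k' hkk'
    obtain ⟨N, hN⟩ := Metric.cauchySeq_iff'.1 hl.cauchySeq (ε / 3) (by positivity)
    refine ⟨N, fun n hn => ?_⟩
    have h1 := hN n hn
    rw [Metric.mem_ball, dist_comm, dist_eq_norm] at hk'
    rw [dist_eq_norm] at h1 ⊢
    have e : b n k - b N k = b n (k - k') + (b n k' - b N k') - b N (k - k') := by
      rw [map_sub, map_sub]; abel
    rw [e]
    have h2 := norm_sub_le (b n (k - k') + (b n k' - b N k')) (b N (k - k'))
    have h3 := norm_add_le (b n (k - k')) (b n k' - b N k')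
    linarith [hle n (k - k'), hle N (k - k')]
  choose l hl using hall
  let A : K →L[ℂ] K := continuousLinearMapOfTendsto b (tendsto_pi_nhds.2 hl)
  have hA : ∀ k, Filter.Tendsto (fun j => b j k) Filter.atTop (nhds (A k)) := hl
  refine ⟨A, ?_, ?_, fun n => ?_⟩
  · rw [mem_vonNeumann_iff]
    intro a ha
    ext1 k
    refine tendsto_nhds_unique ((a.continuous.tendsto _).comp (hA k)) ?_
    refine (hA (a k)).congr fun j => ?_
    exact commutant_apply_comm (hb j) ha k
  · refine opNorm_le_bound _ zero_le_one fun k => ?_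
    rw [one_mul]
    exact le_of_tendsto (hA k).norm (Filter.Eventually.of_forall fun j => hle j k)
  · refine tendsto_nhds_unique (hA (x n)) ?_
    simp_rw [hbx]
    exact ((U n).continuous.tendsto f).comp hgf

variable {S : Type*} [TopologicalSpace S] [CompactSpace S] [T2Space S] [MeasurableSpace S]
  [BorelSpace S]

/-- The `L²` functions represented by contractions of `B` form a closed set. It contains the
continuous functions bounded by `1`, hence indicators of closed sets, hence by regularity indicators
of Borel sets. -/
theorem exists_projection_of_measurableSet (Γ : C(S, ℂ) →⋆ₐ[ℂ] (K →L[ℂ] K)) (hΓ : ∀ g, Γ g ∈ B)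
    {x : ℕ → K} (hsep : ∀ A ∈ B, (∀ n, A (x n) = 0) → A = 0) {m : Measure S} [IsFiniteMeasure m]
    [m.Regular] {U : ℕ → Lp ℂ 2 m →L[ℂ] K}
    (hU : ∀ n g, U n (ContinuousMap.toLp 2 m ℂ g) = Γ g (x n)) {Δ : Set S} (hΔ : MeasurableSet Δ) :
    ∃ b ∈ B, ∀ n, b (x n) = U n (simpleLp m 2 (simpleInd Δ hΔ)) := by
  have hcl := isClosed_setOf_contraction hsep U
  set 𝒢 := {f : Lp ℂ 2 m | ∃ b ∈ B, ‖b‖ ≤ 1 ∧ ∀ n, b (x n) = U n f}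
  have hcont : ∀ g : C(S, ℂ), (∀ t, ‖g t‖ ≤ 1) → ContinuousMap.toLp 2 m ℂ g ∈ 𝒢 := by
    intro g hg
    refine ⟨Γ g, hΓ g, ?_, fun n => (hU n g).symm⟩
    exact (NonUnitalStarAlgHom.norm_apply_le Γ g).trans
      ((ContinuousMap.norm_le g zero_le_one).2 hg)
  have hclosed : ∀ F : Set S, ∀ hF : IsClosed F,
      simpleLp m 2 (simpleInd F hF.measurableSet) ∈ 𝒢 := by
    intro F hF
    rw [← hcl.closure_eq, Metric.mem_closure_iff]
    intro ε hε
    obtain ⟨f, hfc, hfe, hfb, -, -⟩ := exists_continuous_eLpNorm_sub_le_of_closed (μ := m) (p := 2)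
      (by norm_num) hF isOpen_univ (Set.subset_univ F) (measure_ne_top m F) (1 : ℂ)
      (ε := ENNReal.ofReal (ε / 2)) (by simpa using hε)
    refine ⟨_, hcont ⟨f, hfc⟩ (fun t => by simpa using hfb t), ?_⟩
    rw [dist_comm, dist_eq_norm, Lp.norm_def]
    have h1 : eLpNorm (ContinuousMap.toLp 2 m ℂ ⟨f, hfc⟩ -
        simpleLp m 2 (simpleInd F hF.measurableSet) : Lp ℂ 2 m) 2 m
        = eLpNorm (fun t => f t - F.indicator (fun _ => (1 : ℂ)) t) 2 m := by
      refine eLpNorm_congr_ae ?_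
      filter_upwards [Lp.coeFn_sub (ContinuousMap.toLp 2 m ℂ ⟨f, hfc⟩)
        (simpleLp m 2 (simpleInd F hF.measurableSet)),
        ContinuousMap.coeFn_toLp (p := 2) (𝕜 := ℂ) m ⟨f, hfc⟩,
        simpleLp_coeFn (m := m) 2 (simpleInd F hF.measurableSet)] with t h1 h2 h3
      rw [h1, Pi.sub_apply, h2, h3, simpleInd_apply]
      rfl
    rw [h1]
    refine (ENNReal.toReal_le_of_le_ofReal (half_pos hε).le hfe).trans_lt (half_lt_self hε)
  have hmeas : simpleLp m 2 (simpleInd Δ hΔ) ∈ 𝒢 := by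
    rw [← hcl.closure_eq, Metric.mem_closure_iff]
    intro ε hε
    obtain ⟨F, hFΔ, hF, hFm⟩ := hΔ.exists_isClosed_sdiff_lt (measure_ne_top m Δ)
      (ε := ENNReal.ofReal (ε ^ 2)) (by simpa using hε.ne')
    refine ⟨_, hclosed F hF, ?_⟩
    have h1 : simpleLp m 2 (simpleInd Δ hΔ) = simpleLp m 2 (simpleInd F hF.measurableSet)
        + simpleLp m 2 (simpleInd (Δ \ F) (hΔ.diff hF.measurableSet)) := by
      rw [← map_add, ← simpleInd_union _ _ Set.disjoint_sdiff_right]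
      congr 2
      exact (Set.union_diff_cancel hFΔ).symm
    rw [dist_eq_norm, h1, add_sub_cancel_left]
    refine (pow_lt_pow_iff_left₀ (norm_nonneg _) hε.le two_ne_zero).1 ?_
    rw [norm_simpleLp_ind_sq]
    exact ENNReal.toReal_lt_of_lt_ofReal hFm
  obtain ⟨b, hb, -, hbx⟩ := hmeas
  exact ⟨b, hb, hbx⟩

/-- The continuous functional calculus of an abelian von Neumann algebra with a countable separating
family extends to a projection-valued measure that generates the algebra. -/
theorem exists_pvm_of_starAlgHom (Γ : C(S, ℂ) →⋆ₐ[ℂ] (K →L[ℂ] K)) (hΓ : ∀ A, A ∈ B ↔ ∃ g, Γ g = A)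
    {x : ℕ → K} (hx : Summable fun n => ‖x n‖ ^ 2)
    (hsep : ∀ A ∈ B, (∀ n, A (x n) = 0) → A = 0) : ∃ R : PVM S K, R.algebra = B := by
  obtain ⟨m, hfin, hreg, hm⟩ := exists_spectralMeasure Γ hx
  obtain ⟨U, hU, hU0⟩ := exists_cyclicMap Γ hm
  have hΓB : ∀ g, Γ g ∈ B := fun g => (hΓ _).2 ⟨g, rfl⟩
  have hcomm : ∀ A ∈ B, ∀ A' ∈ B, A * A' = A' * A := by
    intro A hA A' hA'
    obtain ⟨g, rfl⟩ := (hΓ A).1 hA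
    obtain ⟨g', rfl⟩ := (hΓ A').1 hA'
    rw [← map_mul, mul_comm, map_mul]
  have hext : ∀ A ∈ B, ∀ A' ∈ B, (∀ n, A (x n) = A' (x n)) → A = A' := by
    intro A hA A' hA' h
    refine sub_eq_zero.1 (hsep _ (sub_mem hA hA') fun n => ?_)
    rw [sub_apply, h, sub_self]
  have hd : DenseRange (ContinuousMap.toLp (E := ℂ) 2 m ℂ) :=
    ContinuousMap.toLp_denseRange ℂ m ℂ (by norm_num)
  choose! R hRB hRx using fun (Δ : Set S) (hΔ : MeasurableSet Δ) =>
    exists_projection_of_measurableSet Γ hΓB hsep hU hΔ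
  have hmul1 : ∀ n (g : C(S, ℂ)) f,
      Γ g (U n f) = U n (mulOp m (ContinuousMap.toLp ∞ m ℂ g) f) := by
    intro n g f
    refine hd.induction_on
      (p := fun f => Γ g (U n f) = U n (mulOp m (ContinuousMap.toLp ∞ m ℂ g) f)) f
      (isClosed_eq (by fun_prop) (by fun_prop)) fun h => ?_
    have e : mulOp m (ContinuousMap.toLp ∞ m ℂ g) (ContinuousMap.toLp 2 m ℂ h)
        = ContinuousMap.toLp 2 m ℂ (g * h) := by
      refine Lp.ext ?_
      filter_upwards [mulOp_coeFn (ContinuousMap.toLp ∞ m ℂ g) (ContinuousMap.toLp 2 m ℂ h),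
        ContinuousMap.coeFn_toLp (p := ∞) (𝕜 := ℂ) m g,
        ContinuousMap.coeFn_toLp (p := 2) (𝕜 := ℂ) m h,
        ContinuousMap.coeFn_toLp (p := 2) (𝕜 := ℂ) m (g * h)] with t h1 h2 h3 h4
      rw [h1, h2, h3, h4, ContinuousMap.mul_apply]
    rw [e, hU, hU, map_mul]
    rfl
  have hmul2 : ∀ n Δ (hΔ : MeasurableSet Δ) f,
      R Δ (U n f) = U n (mulOp m (simpleLp m ∞ (simpleInd Δ hΔ)) f) := by
    intro n Δ hΔ f
    refine hd.induction_on
      (p := fun f => R Δ (U n f) = U n (mulOp m (simpleLp m ∞ (simpleInd Δ hΔ)) f)) f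
      (isClosed_eq (by fun_prop) (by fun_prop)) fun h => ?_
    have e : mulOp m (ContinuousMap.toLp ∞ m ℂ h) (simpleLp m 2 (simpleInd Δ hΔ))
        = mulOp m (simpleLp m ∞ (simpleInd Δ hΔ)) (ContinuousMap.toLp 2 m ℂ h) := by
      refine Lp.ext ?_
      filter_upwards [mulOp_coeFn (ContinuousMap.toLp ∞ m ℂ h) (simpleLp m 2 (simpleInd Δ hΔ)),
        mulOp_coeFn (simpleLp m ∞ (simpleInd Δ hΔ)) (ContinuousMap.toLp 2 m ℂ h),
        ContinuousMap.coeFn_toLp (p := ∞) (𝕜 := ℂ) m h,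
        ContinuousMap.coeFn_toLp (p := 2) (𝕜 := ℂ) m h,
        simpleLp_coeFn (m := m) 2 (simpleInd Δ hΔ),
        simpleLp_coeFn (m := m) ∞ (simpleInd Δ hΔ)] with t h1 h2 h3 h4 h5 h6
      rw [h1, h2, h3, h4, h5, h6, mul_comm]
    have hc : R Δ (Γ h (x n)) = Γ h (R Δ (x n)) :=
      congrArg (fun A : K →L[ℂ] K => A (x n)) (hcomm _ (hRB Δ hΔ) _ (hΓB h))
    rw [hU, hc, hRx Δ hΔ, hmul1, e]
  have hmul : ∀ Δ, MeasurableSet Δ → R Δ * R Δ = R Δ := by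
    intro Δ hΔ
    refine hext _ (mul_mem (hRB Δ hΔ) (hRB Δ hΔ)) _ (hRB Δ hΔ) fun n => ?_
    rw [mul_def, comp_apply, hRx Δ hΔ, hmul2 n Δ hΔ, ← toL2_simpleLp, mulOp_toL2, ← simpleLp_mul,
      simpleInd_mul]
    simp_rw [Set.inter_self]
  have hproj : ∀ Δ, MeasurableSet Δ → IsStarProjection (R Δ) := by
    intro Δ hΔ
    -- Elements of the abelian algebra `B` are normal, and a normal idempotent is a projection.
    rw [ContinuousLinearMap.isStarProjection_iff_isIdempotentElem_and_isStarNormal]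
    exact ⟨hmul Δ hΔ, ⟨hcomm _ (star_mem (hRB Δ hΔ)) _ (hRB Δ hΔ)⟩⟩
  have huniv : R Set.univ = 1 := by
    refine hext _ (hRB _ .univ) _ (one_mem _) fun n => ?_
    have e : simpleLp m 2 1 = ContinuousMap.toLp 2 m ℂ 1 := by
      refine Lp.ext ?_
      filter_upwards [simpleLp_coeFn (m := m) 2 1,
        ContinuousMap.coeFn_toLp (p := 2) (𝕜 := ℂ) m (1 : C(S, ℂ))] with t h1 h2
      rw [h1, h2]
      rfl
    rw [hRx _ .univ, simpleInd_univ, e, hU, map_one]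
  have hunion : ∀ Δ Δ', MeasurableSet Δ → MeasurableSet Δ' → Disjoint Δ Δ' →
      R (Δ ∪ Δ') = R Δ + R Δ' := by
    intro Δ Δ' hΔ hΔ' hdis
    refine hext _ (hRB _ (hΔ.union hΔ')) _ (add_mem (hRB _ hΔ) (hRB _ hΔ')) fun n => ?_
    rw [add_apply, hRx _ (hΔ.union hΔ'), hRx _ hΔ, hRx _ hΔ', simpleInd_union hΔ hΔ' hdis, map_add,
      map_add]
  let P : PVM S K := PVM.ofWeak R hproj huniv hunion _ (dense_span_commutant_apply hsep) (by
    intro Δ hΔ hdis k hk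
    refine HasSum.mapL (innerSL ℂ k) ?_
    refine Submodule.span_induction
      (p := fun k _ => HasSum (fun i => R (Δ i) k) (R (⋃ i, Δ i) k)) ?_ ?_ ?_ ?_ hk
    · rintro _ ⟨a, ha, n, rfl⟩
      have h := (hasSum_simpleLp_ind (m := m) hΔ hdis).mapL (a ∘L U n)
      rw [commutant_apply_comm (hRB _ (MeasurableSet.iUnion hΔ)) ha, hRx _ (MeasurableSet.iUnion hΔ)]
      refine h.congr_fun fun i => ?_
      rw [commutant_apply_comm (hRB _ (hΔ i)) ha, hRx _ (hΔ i)]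
      rfl
    · simp [hasSum_zero]
    · intro k k' _ _ h h'
      simp_rw [map_add]
      exact h.add h'
    · intro c k _ h
      simp_rw [map_smul]
      exact h.const_smul c)
  have hP : P.toFun = R := rfl
  have hle : P.algebra ≤ B := by
    intro A hA
    rw [PVM.mem_algebra_iff] at hA
    rw [mem_vonNeumann_iff]
    intro a ha
    refine hA a ?_
    rintro _ ⟨Δ, hΔ, rfl⟩
    exact VonNeumannAlgebra.mem_commutant_iff.1 ha _ (hRB Δ hΔ)
  have hcompat : P.Compat m := by
    intro Δ hΔ
    rw [hP]
    have h1 : m Δ = 0 ↔ simpleLp m 2 (simpleInd Δ hΔ) = 0 := by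
      rw [← norm_eq_zero, ← pow_eq_zero_iff (a := ‖simpleLp m 2 (simpleInd Δ hΔ)‖) two_ne_zero,
        norm_simpleLp_ind_sq hΔ, measureReal_eq_zero_iff]
    rw [h1]
    constructor
    · intro h
      refine hsep _ (hRB Δ hΔ) fun n => ?_
      rw [hRx Δ hΔ, h, map_zero]
    · intro h
      refine hU0 _ fun n => ?_
      rw [← hRx Δ hΔ, h, zero_apply]
  -- For continuous `g` this identifies `κ(g)` with `Γ g` on the separating family, so the measure
  -- generates all of `B`.
  have hkap : ∀ n f, P.kappa m f (x n) = U n (toL2 m f) := by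
    intro n f
    have h := linfty_clm_ext (m := m) (F := ContinuousLinearMap.apply ℂ K (x n) ∘L P.kappa m)
      (G := U n ∘L ((ContinuousLinearMap.mul ℂ ℂ).holderL m ∞ 2 2).flip (simpleLp m 2 1))
      (fun Δ hΔ => by
        change P.kappa m _ (x n) = U n (toL2 m _)
        rw [hcompat.kappa_ind, toL2_simpleLp]
        exact hRx Δ hΔ n)
    exact congrArg (fun F : Lp ℂ ∞ m →L[ℂ] K => F f) h
  refine ⟨P, le_antisymm hle fun A hA => ?_⟩
  obtain ⟨g, rfl⟩ := (hΓ A).1 hA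
  have hg : Γ g = P.kappa m (ContinuousMap.toLp ∞ m ℂ g) := by
    refine hext _ hA _ (hle (hcompat.kappa_mem_algebra _)) fun n => ?_
    rw [hkap, ← hU]
    congr 1
    refine Lp.ext ?_
    filter_upwards [toL2_coeFn (ContinuousMap.toLp ∞ m ℂ g),
      ContinuousMap.coeFn_toLp (p := ∞) (𝕜 := ℂ) m g,
      ContinuousMap.coeFn_toLp (p := 2) (𝕜 := ℂ) m g] with t h1 h2 h3
    rw [h1, h2, h3]
  rw [hg]
  exact hcompat.kappa_mem_algebra _

end Spectral

/-! ### Abelian von Neumann algebras through the Gelfand transform. -/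

section Gelfand

variable {K : Type w} [NormedAddCommGroup K] [InnerProductSpace ℂ K] [CompleteSpace K]

/-- The spectral theorem for abelian von Neumann algebras with a countable separating family. -/
theorem exists_pvm_of_abelian {B : VonNeumannAlgebra K} (hB : ∀ a ∈ B, ∀ b ∈ B, a * b = b * a)
    {x : ℕ → K} (hx : Summable fun n => ‖x n‖ ^ 2)
    (hsep : ∀ A ∈ B, (∀ n, A (x n) = 0) → A = 0) :
    ∃ (S : Type w) (_ : MeasurableSpace S) (R : PVM S K), R.algebra = B := by
  haveI : IsClosed (B.toStarSubalgebra : Set (K →L[ℂ] K)) := by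
    have : (B.toStarSubalgebra : Set (K →L[ℂ] K)) = Set.centralizer (Set.centralizer B) :=
      B.centralizer_centralizer.symm
    rw [this]
    exact Set.isClosed_centralizer _
  letI : CommCStarAlgebra B.toStarSubalgebra :=
    { (inferInstance : CStarAlgebra B.toStarSubalgebra) with
      mul_comm := fun a b => Subtype.ext (hB a a.2 b b.2) }
  let S := WeakDual.characterSpace ℂ B.toStarSubalgebra
  letI : MeasurableSpace S := borel S
  haveI : BorelSpace S := ⟨rfl⟩
  let Γ : C(S, ℂ) →⋆ₐ[ℂ] (K →L[ℂ] K) := B.toStarSubalgebra.subtype.comp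
    ((gelfandStarTransform B.toStarSubalgebra).symm : C(S, ℂ) →⋆ₐ[ℂ] B.toStarSubalgebra)
  obtain ⟨R, hR⟩ := exists_pvm_of_starAlgHom (B := B) Γ (fun A => by
    constructor
    · intro hA
      refine ⟨gelfandStarTransform B.toStarSubalgebra ⟨A, hA⟩, ?_⟩
      change (((gelfandStarTransform B.toStarSubalgebra).symm
        (gelfandStarTransform B.toStarSubalgebra ⟨A, hA⟩) : B.toStarSubalgebra) : K →L[ℂ] K) = A
      rw [StarAlgEquiv.symm_apply_apply]
    · rintro ⟨g, rfl⟩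
      exact ((gelfandStarTransform B.toStarSubalgebra).symm g).2) hx hsep
  exact ⟨S, inferInstance, R, hR⟩

end Gelfand

end CPTomita

namespace CPTomita

open scoped ComplexOrder
open ContinuousLinearMap

/-- An order isomorphism of partial orders is an isomorphism of the associated categories. -/
noncomputable def isoCatOfOrderIso {α β : Type*} [PartialOrder α] [PartialOrder β] (e : α ≃o β) :
    CategoryTheory.IsoCat α β where
  functor := e.monotone.functor
  inverse := e.symm.monotone.functor
  unit_eq := CategoryTheory.Functor.ext (fun a => (e.symm_apply_apply a).symm)
    fun _ _ _ => Subsingleton.elim _ _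
  counit_eq := CategoryTheory.Functor.ext (fun b => e.apply_symm_apply b)
    fun _ _ _ => Subsingleton.elim _ _

/-! ### The isomorphism of categories. -/

section Main

variable {X : Type u} [CStarAlgebra X] [PartialOrder X] [StarOrderedRing X]
variable {H : Type v} [NormedAddCommGroup H] [InnerProductSpace ℂ H] [CompleteSpace H]
variable {M : VonNeumannAlgebra H} {T : CPMap X M}
variable {K : Type w} [NormedAddCommGroup K] [InnerProductSpace ℂ K] [CompleteSpace K]

theorem OrthSpace.dom_iff (σ : MinimalStinespring T K) (ρ : NormalFaithfulState M)
    (E₁ E₂ : OrthSpace.{u, v, s} T) :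
    OrthSpace.Dom E₁ E₂ ↔ (E₁.pvm σ).algebra ≤ (E₂.pvm σ).algebra :=
  ⟨OrthSpace.algebra_le_of_dom, OrthSpace.dom_of_algebra_le ρ⟩

theorem OrthSpace.isPreorder_dom (σ : MinimalStinespring T K) (ρ : NormalFaithfulState M) :
    IsPreorder (OrthSpace.{u, v, s} T) OrthSpace.Dom where
  refl E := (OrthSpace.dom_iff σ ρ E E).2 le_rfl
  trans E₁ E₂ E₃ h₁₂ h₂₃ := (OrthSpace.dom_iff σ ρ E₁ E₃).2
    (((OrthSpace.dom_iff σ ρ E₁ E₂).1 h₁₂).trans ((OrthSpace.dom_iff σ ρ E₂ E₃).1 h₂₃))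

/-- The abelian von Neumann algebra of an orthogonal CP-measure space. -/
noncomputable def OrthSpace.toAbvN (σ : MinimalStinespring T K) (E : OrthSpace.{u, v, s} T) :
    AbvN σ :=
  ⟨(E.pvm σ).algebra, E.algebra_subset, fun _ ha _ hb => (E.pvm σ).algebra_commute ha hb⟩

/-- The vectors `V xₙ`, for `xₙ` separating `M`, separate `B`, so the spectral theorem applies. The
measurable space is the spectrum of `B`, which fixes its universe as that of `K`. -/
theorem OrthSpace.exists_toAbvN_eq (σ : MinimalStinespring T K) (ρ : NormalFaithfulState M)
    (B : AbvN σ) : ∃ E : OrthSpace.{u, v, w} T, E.toAbvN σ = B := by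
  obtain ⟨x, hx, hsep⟩ := ρ.exists_separating
  have hrel : ∀ A ∈ B.1, σ.IsRelative A := fun A hA =>
    MinimalStinespring.mem_relativeCommutant_iff.1 (B.2.1 hA)
  obtain ⟨S, _, R, hR⟩ := exists_pvm_of_abelian B.2.2 (summable_sq_apply σ.V hx)
    fun A hA h => (hrel A hA).eq_zero_of_separating hsep h
  obtain ⟨E, hE⟩ := exists_orthSpace_of_pvm (σ := σ) R fun Δ hΔ =>
    hrel _ (hR ▸ R.toFun_mem_algebra hΔ)
  exact ⟨E, Subtype.ext (hE.trans hR)⟩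

theorem OT.exists_orderIso (σ : MinimalStinespring T K) (ρ : NormalFaithfulState M)
    (h : IsPreorder (OrthSpace.{u, v, w} T) OrthSpace.Dom) :
    ∃ e : OT h ≃o AbvN σ, ∀ E, e (OT.mk h E) = E.toAbvN σ := by
  letI := dominancePreorder h
  have hle : ∀ E₁ E₂ : OrthSpace.{u, v, w} T, E₁ ≤ E₂ ↔ E₁.toAbvN σ ≤ E₂.toAbvN σ :=
    fun E₁ E₂ => OrthSpace.dom_iff σ ρ E₁ E₂
  let f : OT h → AbvN σ := Quotient.lift (OrthSpace.toAbvN σ) fun E₁ E₂ hE =>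
    le_antisymm ((hle E₁ E₂).1 hE.1) ((hle E₂ E₁).1 hE.2)
  have hf : ∀ a b : OT h, f a ≤ f b ↔ a ≤ b := by
    intro a b
    induction a using Quotient.inductionOn with | _ E₁ =>
    induction b using Quotient.inductionOn with | _ E₂ =>
    exact (hle E₁ E₂).symm
  have hinj : Function.Injective f := fun a b hab =>
    le_antisymm ((hf a b).1 hab.le) ((hf b a).1 hab.ge)
  have hsurj : Function.Surjective f := fun B => by
    obtain ⟨E, hE⟩ := OrthSpace.exists_toAbvN_eq σ ρ B
    exact ⟨OT.mk h E, hE⟩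
  exact ⟨⟨Equiv.ofBijective f ⟨hinj, hsurj⟩, fun {a b} => hf a b⟩, fun E => rfl⟩

end Main

end CPTomita

theorem mainTheorem1 {X : Type u} [CStarAlgebra X] [PartialOrder X] [StarOrderedRing X]
    {H : Type v} [NormedAddCommGroup H] [InnerProductSpace ℂ H] [CompleteSpace H] [Nontrivial H]
    (M : VonNeumannAlgebra H) (hM : IsSigmaFinite M) (T : CPMap X M)
    {K : Type w} [NormedAddCommGroup K] [InnerProductSpace ℂ K] [CompleteSpace K]
    (σ : MinimalStinespring T K) :
    ∃ h : IsPreorder (OrthSpace.{u, v, w} T) OrthSpace.Dom,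
    ∃ Φ : CategoryTheory.IsoCat (OT h) (AbvN σ),
      ∀ (E : OrthSpace.{u, v, w} T) (ν : Measure E.1.S), IsFiniteMeasure ν →
        (∃ ρ : NormalFaithfulState M,
          ν ≪ E.1.μ.scalarMeasure ρ ∧ E.1.μ.scalarMeasure ρ ≪ ν) →
        ∃ κ : Lp ℂ ∞ ν →ₗ[ℂ] (K →L[ℂ] K),
          IsStarIsoOnto κ (Φ.functor.obj (OT.mk h E)).1 ∧
          IsIntegralMap σ E.1.μ κ ∧
          ∀ κ' : Lp ℂ ∞ ν →ₗ[ℂ] (K →L[ℂ] K), (∀ f, κ' f ∈ σ.relativeCommutant) →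
            IsIntegralMap σ E.1.μ κ' → κ' = κ := by
  obtain ⟨ρ₀⟩ := hM.nonempty_normalFaithfulState
  have h : IsPreorder (OrthSpace.{u, v, w} T) OrthSpace.Dom := OrthSpace.isPreorder_dom σ ρ₀
  obtain ⟨e, he⟩ := OT.exists_orderIso σ ρ₀ h
  refine ⟨h, isoCatOfOrderIso e, fun E ν hν ⟨ρ, hνρ, hρν⟩ => ?_⟩
  have hc : (E.pvm σ).Compat ν := E.compat ρ hνρ hρν
  have hB : ((isoCatOfOrderIso e).functor.obj (OT.mk h E)).1 = (E.pvm σ).algebra :=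
    congrArg Subtype.val (he E)
  refine ⟨((E.pvm σ).kappa ν).toLinearMap, ?_, E.isIntegralMap_kappa hc, fun κ' hκ' hi => ?_⟩
  · rw [hB]
    exact E.isStarIsoOnto_kappa hc ρ
  · exact (E.isIntegralMap_kappa hc).unique hi (E.isRelative_kappa hc) fun f =>
      MinimalStinespring.mem_relativeCommutant_iff.1 (hκ' f)
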